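/- Let $H_{\mathrm{pend}}(\lambda,\Lambda)=-\tfrac32\Lambda^2+V(\lambda)$ with $V(\lambda)=1-\cos\lambda-\frac{1}{\sqrt{2+2\cos\lambda}}$, and consider the Hamiltonian system $\dot\lambda=\partial_\Lambda H_{\mathrm{pend}}=-3\Lambda$, $\dot\Lambda=-\partial_\lambda H_{\mathrm{pend}}=-\sin\lambda\,\bigl(1-(2+2\cos\lambda)^{-3/2}\bigr)$, which is singular at $\lambda=\pi$ (mod $2\pi$) and has a saddle at $(0,0)$. Let $\sigma(t)=(\lambda_h(t),\Lambda_h(t))$, $t\in\mathbb R$, be the time parametrization of its right separatrix: the solution, defined for all real times and avoiding the singularity, that is homoclinic to $(0,0)$ (it tends to $(0,0)$ as $t\to\pm\infty$) and satisfies $\sigma(0)=(\lambda_0,0)$ with $\lambda_0\in(\tfrac23\pi,\pi)$. Put $a_\pm=-\frac12\pm\frac{\sqrt2}{2}$ and $$A=\int_0^{a_+}\frac{1}{1-x}\sqrt{\frac{x}{3(x+1)(a_+-x)(x-a_-)}}\,dx .$$ This integral converges and $A\approx 0.177744$, that is, $|A-0.177744|<5\cdot10^{-7}$. Moreover: 1.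 $\sigma$ extends analytically to the strip $\Pi_A=\{t\in\mathbb C:\ |\operatorname{Im}t|<A\}$. 2. The extension has exactly two singularities on $\partial\Pi_A$, namely $t=\pm iA$: a point $t_0\in\partial\Pi_A$ has the property that $\sigma$ coincides on $\Pi_A$ near $t_0$ with a function analytic at $t_0$ if and only if $t_0\ne\pm iA$. 3. There exist $\nu>0$ and $\alpha_+\in\mathbb C$ with $\alpha_+^3=\frac12$ such that, setting $\alpha_-=\overline{\alpha_+}$ (so $\alpha_-^3=\frac12$), $\sigma$ extends analytically to the union of $\Pi_A$ and the two slit discs $$D_+=\{0<|t-iA|<\nu,\ \arg(t-iA)\in(-\tfrac{3\pi}{2},\tfrac{\pi}{2})\},\qquad D_-=\{0<|t+iA|<\nu,\ \arg(t+iA)\in(-\tfrac{\pi}{2},\tfrac{3\pi}{2})\},$$ and for $t\in D_\pm$ (upper signs on $D_+$, lower signs on $D_-$) $$\lambda_h(t)=\pi+3\alpha_\pm(t\mp iA)^{2/3}+\mathcal O\bigl(|t\mp iA|^{4/3}\bigr),\qquad \Lambda_h(t)=-\frac{2\alpha_\pm}{3}(t\mp iA)^{-1/3}+\mathcal O\bigl(|t\mp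 iA|^{1/3}\bigr),$$ where the powers are taken with the indicated determinations of the argument and the implied constants are uniform on $D_\pm$. -/

import Mathlib

open Filter Topology Set

noncomputable section

/-- The potential `V(λ) = 1 - cos λ - 1/√(2 + 2 cos λ)`. -/
def pendV (l : ℝ) : ℝ := 1 - Real.cos l - 1 / Real.sqrt (2 + 2 * Real.cos l)

/-- The Hamiltonian `H_pend(λ, Λ) = -(3/2) Λ² + V(λ)`. -/
def pendH (l L : ℝ) : ℝ := -(3 / 2) * L ^ 2 + pendV l

/-- `(l, L)` is the time parametrization of the right separatrix of `H_pend`, the angle being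
lifted from the circle to `ℝ`: a solution, avoiding the collision `λ = π (mod 2π)`, of Hamilton's
equations `λ' = ∂H/∂Λ`, `Λ' = -∂H/∂λ`, starting at a point `(λ₀, 0)` with `2π/3 < λ₀ < π`, and
homoclinic to the saddle `(0, 0)`. -/
structure IsRightSeparatrix (l L : ℝ → ℝ) : Prop where
  avoids_collision : ∀ t, Real.cos (l t) ≠ -1
  hasDerivAt_angle : ∀ t, HasDerivAt l (deriv (fun y => pendH (l t) y) (L t)) t
  hasDerivAt_momentum : ∀ t, HasDerivAt L (-deriv (fun x => pendH x (L t)) (l t)) t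
  angle_zero : l 0 ∈ Ioo (2 / 3 * Real.pi) Real.pi
  momentum_zero : L 0 = 0
  tendsto_atTop : Tendsto (fun t => (l t, L t)) atTop (𝓝 (0, 0))
  tendsto_atBot : Tendsto (fun t => (l t, L t)) atBot (𝓝 (0, 0))

/-- `a₊ = -1/2 + √2/2`. -/
def aPlus : ℝ := -(1 / 2) + Real.sqrt 2 / 2

/-- `a₋ = -1/2 - √2/2`. -/
def aMinus : ℝ := -(1 / 2) - Real.sqrt 2 / 2

/-- The integrand of `A`. -/
def widthIntegrand (x : ℝ) : ℝ :=
  1 / (1 - x) * Real.sqrt (x / (3 * (x + 1) * (aPlus - x) * (x - aMinus)))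

/-- `A = ∫_0^{a₊} (1/(1-x)) √(x / (3 (x+1) (a₊-x) (x-a₋))) dx`. -/
def stripWidth : ℝ := ∫ x in (0 : ℝ)..aPlus, widthIntegrand x

/-- The strip `|Im t| < a`. -/
def complexStrip (a : ℝ) : Set ℂ := {t | |t.im| < a}

/-- The point `c + r e^{iθ}`. -/
def polarPoint (c : ℂ) (r θ : ℝ) : ℂ := c + (r : ℂ) * Complex.exp ((θ : ℂ) * Complex.I)

/-- The sector `0 < |t - c| < ν`, `arg (t - c) ∈ (θ₁, θ₂)`. -/
def sector (c : ℂ) (ν θ₁ θ₂ : ℝ) : Set ℂ :=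
  {t | ∃ r ∈ Ioo 0 ν, ∃ θ ∈ Ioo θ₁ θ₂, t = polarPoint c r θ}

/-- The branch of the power `τ ^ s` at the point `τ = r e^{iθ}`, the argument of `τ` being `θ`:
its value is `r ^ s e^{isθ}`. -/
def polarPow (r θ s : ℝ) : ℂ :=
  ((r ^ s : ℝ) : ℂ) * Complex.exp ((s : ℂ) * (θ : ℂ) * Complex.I)

/-- `f`, given on `Ω`, has a singularity at the boundary point `t₀` of `Ω`: no function analytic
at `t₀` coincides with `f` on the points of `Ω` close to `t₀`. -/
def IsBoundarySingularity (f : ℂ → ℂ × ℂ) (Ω : Set ℂ) (t₀ : ℂ) : Prop :=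
  t₀ ∈ frontier Ω ∧ ¬ ∃ g : ℂ → ℂ × ℂ, AnalyticAt ℂ g t₀ ∧ ∀ᶠ t in 𝓝[Ω] t₀, g t = f t

/-- On the sector `0 < |t - c| < ν`, `arg (t - c) ∈ (θ₁, θ₂)`, the components of `σ` are
`π + 3 α (t - c)^{2/3} + O((t - c)^{4/3})` and
`-(2 α / 3) (t - c)^{-1/3} + O((t - c)^{1/3})`. -/
def HasBranchExpansion (σ : ℂ → ℂ × ℂ) (c : ℂ) (ν θ₁ θ₂ : ℝ) (α : ℂ) : Prop :=
  ∃ C : ℝ, ∀ r ∈ Ioo 0 ν, ∀ θ ∈ Ioo θ₁ θ₂,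
    ‖(σ (polarPoint c r θ)).1 - ((Real.pi : ℂ) + 3 * α * polarPow r θ (2 / 3))‖
        ≤ C * r ^ (4 / 3 : ℝ) ∧
    ‖(σ (polarPoint c r θ)).2 - (-(2 * α / 3) * polarPow r θ (-(1 / 3)))‖
        ≤ C * r ^ (1 / 3 : ℝ)

end

/-! ### The principal square root -/

/-! Put c = cos(λ/2). On the energy level −1/2 of the saddle, Λ²c = (4/3)(1−c)(c−a₊)(c−a₋), so time
is an integral in c with algebraic singularities. The substitution c = (C−κ)/(C+1), C = cosh y,
removes the turning point c = a₊ (now y = 0), sends the saddle c = 1 to y = ±∞, and makes the time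
form f(y) dy, with f² rational in C (`densitySq`). The angle λ = 4 arctan √((1+κ)/(2(C+m))) is
analytic for |Im y| < π/2, even at the collision c = 0, that is at y = ±iβ with cos β = κ.
Singularities can thus only come from inverting T(y) = ∫₀^y f (`timeMap`). The real solution
satisfies T(y(t)) = t (`exists_uniformization`).

For Re C > 0, f² meets the closed negative axis only on the slits beyond ±iβ, so Re f > 0 elsewhere
and T is injective on |Im y| < β (`injOn_timeMap`). Moreover Im f² has the sign of Im C, so Im T
increases along horizontal half-lines in the first quadrant: with iA the limit of T at iβ, the rest
of the line Im y = β goes strictly above height A (`width_lt_timeMap_im`) or, by symmetry, strictly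
below −A for Im y = −β. Connectedness of vertical segments then shows that the image of T contains
the closed strip |Im t| ≤ A minus ±iA (`mem_timeMap_image`), and λ∘T⁻¹ is analytic near all these
points. Integrating f up the imaginary axis and returning to the variable c identifies A with the
given integral (`isTimeWidth_stripWidth`).

At the corner f² has a simple zero. With y = i(β−v) one gets i(t−iA) = v^{3/2} n(v), n(0) > 0, so v
is analytic in (i(t−iA))^{2/3} and λ = F((i(t−iA))^{2/3}) with F(0) = π, F′(0)³ = −27/2
(`exists_cornerExpansion`). This gives both expansions and α³ = 1/2, and Λ = −λ′/3 blows up, so ±iA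
are singular. The identity theorem matches this branch with λ∘T⁻¹ (`eqOn_angleExt_twoThirds`); the
lower disc follows by reflection. -/

theorem Complex.sqrt_mul_self_eq (z : ℂ) : Complex.sqrt z * Complex.sqrt z = z := by
  rw [← sq, Complex.sqrt]
  exact_mod_cast Complex.cpow_ofNat_inv_pow z 2

theorem Complex.re_sqrt_pos {z : ℂ} (hz : z ∈ Complex.slitPlane) : 0 < (Complex.sqrt z).re := by
  have h0 := Complex.slitPlane_ne_zero hz
  have h1 := Complex.neg_pi_lt_arg z
  have h2 := (Complex.arg_le_pi z).lt_of_ne (Complex.slitPlane_arg_ne_pi hz)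
  rw [Complex.sqrt, Complex.cpow_def_of_ne_zero h0, Complex.exp_re]
  have : (Complex.log z * 2⁻¹).im = z.arg / 2 := by
    rw [show (2⁻¹ : ℂ) = ((2⁻¹ : ℝ) : ℂ) by norm_num, Complex.im_mul_ofReal, Complex.log_im]
    ring
  rw [this]
  exact mul_pos (Real.exp_pos _) (Real.cos_pos_of_mem_Ioo ⟨by linarith, by linarith⟩)

theorem Complex.im_sqrt_pos {z : ℂ} (hz : 0 < z.im) : 0 < (Complex.sqrt z).im := by
  have hs : z ∈ Complex.slitPlane := Or.inr hz.ne'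
  have h1 := Complex.re_sqrt_pos hs
  have h2 := congrArg Complex.im (Complex.sqrt_mul_self_eq z)
  rw [Complex.mul_im] at h2
  by_contra! h
  nlinarith

theorem Complex.re_le_re_sqrt_sq (z : ℂ) : z.re ≤ (Complex.sqrt z).re ^ 2 := by
  have h2 := congrArg Complex.re (Complex.sqrt_mul_self_eq z)
  rw [Complex.mul_re] at h2
  nlinarith [sq_nonneg (Complex.sqrt z).im]

theorem Complex.norm_sqrt_sq (z : ℂ) : ‖Complex.sqrt z‖ ^ 2 = ‖z‖ := by
  rw [sq, ← norm_mul, Complex.sqrt_mul_self_eq]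

theorem Complex.sqrt_conj {z : ℂ} (hz : z ∈ Complex.slitPlane) :
    Complex.sqrt (starRingEnd ℂ z) = starRingEnd ℂ (Complex.sqrt z) := by
  have := Complex.cpow_conj (starRingEnd ℂ z) (2⁻¹ : ℂ)
    (by
      have hz' : (starRingEnd ℂ z) ∈ Complex.slitPlane := by
        rw [Complex.mem_slitPlane_iff] at hz ⊢
        simpa using hz
      exact Complex.slitPlane_arg_ne_pi hz')
  simpa [Complex.sqrt, Complex.conj_ofNat] using this

theorem Complex.sqrt_ofReal_of_nonneg {x : ℝ} (hx : 0 ≤ x) :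
    Complex.sqrt (x : ℂ) = (Real.sqrt x : ℂ) := by
  rw [Real.sqrt_eq_rpow, Complex.ofReal_cpow hx]
  simp [Complex.sqrt]

/-! ### Weighted integrals over the segments issued from the origin -/

/-- The compact segment has a compact thickening inside U; a bound for f′ there dominates the
differentiated integrand. -/
theorem hasDerivAt_integral_segment {f : ℂ → ℂ} {U : Set ℂ} (hU : IsOpen U)
    (hf : DifferentiableOn ℂ f U) {k : ℝ → ℝ} (hk : Continuous k) {z : ℂ}
    (hz : ∀ s ∈ Icc (0 : ℝ) 1, (s : ℂ) * z ∈ U) :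
    HasDerivAt (fun w => ∫ s in (0 : ℝ)..1, (k s : ℂ) * f (s * w))
      (∫ s in (0 : ℝ)..1, (k s : ℂ) * (s * deriv f (s * z))) z := by
  set K : Set ℂ := (fun s : ℝ => (s : ℂ) * z) '' Icc 0 1 with hK
  have hKc : IsCompact K := isCompact_Icc.image (by fun_prop)
  obtain ⟨δ, hδ, hδU⟩ := hKc.exists_cthickening_subset_open hU (by
    rintro _ ⟨s, hs, rfl⟩
    exact hz s hs)
  have hmem : ∀ s ∈ Icc (0 : ℝ) 1, ∀ w ∈ Metric.ball z δ,
      (s : ℂ) * w ∈ Metric.cthickening δ K := by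
    intro s hs w hw
    refine Metric.mem_cthickening_of_dist_le _ ((s : ℂ) * z) δ K ⟨s, hs, rfl⟩ ?_
    rw [dist_eq_norm, ← mul_sub, norm_mul, Complex.norm_real, Real.norm_of_nonneg hs.1]
    have := mem_ball_iff_norm.1 hw
    nlinarith [hs.1, hs.2, norm_nonneg (w - z)]
  have hf' : DifferentiableOn ℂ (deriv f) U := hf.deriv hU
  have hcc : IsCompact (Metric.cthickening δ K) := hKc.cthickening
  obtain ⟨M, hM⟩ := hcc.exists_bound_of_continuousOn (hf'.continuousOn.mono hδU)
  have hcont : ∀ F : ℂ → ℂ, ContinuousOn F U → ∀ w ∈ Metric.ball z δ,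
      ContinuousOn (fun s : ℝ => F ((s : ℂ) * w)) (uIcc (0 : ℝ) 1) := by
    intro F hF w hw
    rw [uIcc_of_le zero_le_one]
    exact hF.comp (by fun_prop) fun s hs => hδU (hmem s hs w hw)
  have hsub : uIoc (0 : ℝ) 1 ⊆ uIcc 0 1 := uIoc_subset_uIcc
  have hkC : Continuous (fun s : ℝ => (k s : ℂ)) := by fun_prop
  have hzb : z ∈ Metric.ball z δ := Metric.mem_ball_self hδ
  refine (intervalIntegral.hasDerivAt_integral_of_dominated_loc_of_deriv_le
    (F := fun w s => (k s : ℂ) * f (s * w)) (F' := fun w s => (k s : ℂ) * (s * deriv f (s * w)))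
    (s := Metric.ball z δ) (bound := fun s => |k s| * |M|) (Metric.ball_mem_nhds z hδ) ?_ ?_ ?_ ?_
    ?_ ?_).2
  · filter_upwards [Metric.ball_mem_nhds z hδ] with w hw
    exact ((hkC.continuousOn.mul (hcont f hf.continuousOn w hw)).mono hsub).aestronglyMeasurable
      measurableSet_uIoc
  · exact (hkC.continuousOn.mul (hcont f hf.continuousOn z hzb)).intervalIntegrable
  · refine ((hkC.continuousOn.mul (ContinuousOn.mul (by fun_prop)
      (hcont _ hf'.continuousOn z hzb))).mono hsub).aestronglyMeasurable measurableSet_uIoc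
  · refine MeasureTheory.ae_of_all _ fun s hs w hw => ?_
    have hs' : s ∈ Icc (0 : ℝ) 1 := by
      have := hsub hs
      rwa [uIcc_of_le zero_le_one] at this
    rw [norm_mul, norm_mul, Complex.norm_real, Complex.norm_real, Real.norm_eq_abs,
      Real.norm_of_nonneg hs'.1]
    have h1 := hM _ (hmem s hs' w hw)
    have h2 : ‖deriv f (s * w)‖ ≤ |M| := h1.trans (le_abs_self M)
    have : s * ‖deriv f (s * w)‖ ≤ |M| := by
      nlinarith [hs'.1, hs'.2, norm_nonneg (deriv f (s * w))]
    exact mul_le_mul_of_nonneg_left this (abs_nonneg _)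
  · exact Continuous.intervalIntegrable (by fun_prop) _ _
  · refine MeasureTheory.ae_of_all _ fun s hs w hw => ?_
    have hs' : s ∈ Icc (0 : ℝ) 1 := by
      have := hsub hs
      rwa [uIcc_of_le zero_le_one] at this
    have hin := hδU (hmem s hs' w hw)
    have h1 : HasDerivAt f (deriv f (s * w)) (s * w) :=
      (hf.differentiableAt (hU.mem_nhds hin)).hasDerivAt
    have h2 : HasDerivAt (fun w : ℂ => (s : ℂ) * w) (s : ℂ) w := by
      simpa using (hasDerivAt_id w).const_mul (s : ℂ)
    have h3 := (h1.comp w h2).const_mul (k s : ℂ)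
    rwa [mul_comm (deriv f _) (s : ℂ)] at h3

theorem continuousOn_comp_segment {F : ℂ → ℂ} {U : Set ℂ} (hF : ContinuousOn F U) {z : ℂ}
    (hz : ∀ s ∈ Icc (0 : ℝ) 1, (s : ℂ) * z ∈ U) :
    ContinuousOn (fun s : ℝ => F ((s : ℂ) * z)) (uIcc (0 : ℝ) 1) := by
  rw [uIcc_of_le zero_le_one]
  exact hF.comp (by fun_prop) hz

theorem hasDerivAt_comp_segment {f : ℂ → ℂ} {U : Set ℂ} (hU : IsOpen U)
    (hf : DifferentiableOn ℂ f U) {z : ℂ} {s : ℝ} (hs : (s : ℂ) * z ∈ U) :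
    HasDerivAt (fun s : ℝ => f ((s : ℂ) * z)) (deriv f (s * z) * z) s := by
  have h1 : HasDerivAt f (deriv f (s * z)) (s * z) :=
    (hf.differentiableAt (hU.mem_nhds hs)).hasDerivAt
  have h2 : HasDerivAt (fun w : ℝ => (w : ℂ) * z) z s := by
    simpa using (Complex.ofRealCLM.hasDerivAt (x := s)).mul_const z
  exact h1.comp s h2

/-- The primitive of `f` along the segments issued from the origin. -/
noncomputable def segmentPrimitive (f : ℂ → ℂ) (z : ℂ) : ℂ :=
  z * ∫ s in (0 : ℝ)..1, f ((s : ℂ) * z)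

/-- The product rule produces the integral of f(sz) + sz f′(sz), which is d/ds of s f(sz). -/
theorem hasDerivAt_segmentPrimitive {f : ℂ → ℂ} {U : Set ℂ} (hU : IsOpen U)
    (hf : DifferentiableOn ℂ f U) {z : ℂ} (hz : ∀ s ∈ Icc (0 : ℝ) 1, (s : ℂ) * z ∈ U) :
    HasDerivAt (segmentPrimitive f) (f z) z := by
  have h1 := hasDerivAt_integral_segment hU hf (k := fun _ => 1) continuous_const hz
  have h2 := (hasDerivAt_id z).mul h1
  have hf' : DifferentiableOn ℂ (deriv f) U := hf.deriv hU
  have hint : ∫ s in (0 : ℝ)..1, (f ((s : ℂ) * z) + z * ((s : ℂ) * deriv f (s * z))) = f z := by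
    have := intervalIntegral.integral_eq_sub_of_hasDerivAt
      (f := fun s : ℝ => (s : ℂ) * f (s * z))
      (f' := fun s : ℝ => f ((s : ℂ) * z) + z * ((s : ℂ) * deriv f (s * z))) (a := 0) (b := 1)
      (by
        intro s hs
        rw [uIcc_of_le zero_le_one] at hs
        have h3 := (Complex.ofRealCLM.hasDerivAt (x := s)).mul
          (hasDerivAt_comp_segment hU hf (hz s hs))
        refine h3.congr_deriv ?_
        simp only [Complex.ofRealCLM_apply, Complex.ofReal_one]
        ring)
      (ContinuousOn.intervalIntegrable ((continuousOn_comp_segment hf.continuousOn hz).add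
        (continuousOn_const.mul (ContinuousOn.mul (by fun_prop)
          (continuousOn_comp_segment hf'.continuousOn hz)))))
    simpa using this
  refine (h2.congr_of_eventuallyEq ?_).congr_deriv ?_
  · exact Eventually.of_forall fun w => by simp [segmentPrimitive]
  · rw [intervalIntegral.integral_add, intervalIntegral.integral_const_mul] at hint
    · simpa using hint
    · exact (continuousOn_comp_segment hf.continuousOn hz).intervalIntegrable
    · exact (continuousOn_const.mul (ContinuousOn.mul (by fun_prop)
          (continuousOn_comp_segment hf'.continuousOn hz))).intervalIntegrable

/-- Formally z^{3/2} times this mean is a primitive of z^{1/2} f(z). The relation, obtained by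
integrating d/ds (s^{3/2} f(sz)), expresses this without choosing a branch, so it also holds at z =
0. -/
theorem hasDerivAt_sqrtWeightedMean {f : ℂ → ℂ} {U : Set ℂ} (hU : IsOpen U)
    (hf : DifferentiableOn ℂ f U) {z : ℂ} (hz : ∀ s ∈ Icc (0 : ℝ) 1, (s : ℂ) * z ∈ U) :
    ∃ n' : ℂ, HasDerivAt (fun w => ∫ s in (0 : ℝ)..1, (Real.sqrt s : ℂ) * f (s * w)) n' z ∧
      3 / 2 * (∫ s in (0 : ℝ)..1, (Real.sqrt s : ℂ) * f (s * z)) + z * n' = f z := by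
  have h1 := hasDerivAt_integral_segment hU hf (k := Real.sqrt) Real.continuous_sqrt hz
  refine ⟨_, h1, ?_⟩
  have hf' : DifferentiableOn ℂ (deriv f) U := hf.deriv hU
  have hs0 : Continuous fun s : ℝ => (Real.sqrt s : ℂ) :=
    Complex.continuous_ofReal.comp Real.continuous_sqrt
  have hi1 : IntervalIntegrable (fun s : ℝ => (Real.sqrt s : ℂ) * f (s * z))
      MeasureTheory.volume 0 1 :=
    (hs0.continuousOn.mul (continuousOn_comp_segment hf.continuousOn hz)).intervalIntegrable
  have hi2 : IntervalIntegrable (fun s : ℝ => (Real.sqrt s : ℂ) * (s * deriv f (s * z)))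
      MeasureTheory.volume 0 1 :=
    (hs0.continuousOn.mul (ContinuousOn.mul (by fun_prop)
      (continuousOn_comp_segment hf'.continuousOn hz))).intervalIntegrable
  have hint := intervalIntegral.integral_eq_sub_of_hasDerivAt_of_le (a := 0) (b := 1)
      (f := fun s : ℝ => ((s * Real.sqrt s : ℝ) : ℂ) * f (s * z))
      (f' := fun s : ℝ => 3 / 2 * ((Real.sqrt s : ℂ) * f ((s : ℂ) * z)) +
        z * ((Real.sqrt s : ℂ) * ((s : ℂ) * deriv f (s * z)))) zero_le_one
      (by
        refine ContinuousOn.mul (by fun_prop) ?_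
        rw [← uIcc_of_le zero_le_one]
        exact continuousOn_comp_segment hf.continuousOn hz)
      (by
        intro s hs
        have hsne : s ≠ 0 := hs.1.ne'
        have h2 : HasDerivAt (fun s : ℝ => s * Real.sqrt s) (3 / 2 * Real.sqrt s) s := by
          refine ((hasDerivAt_id s).mul (Real.hasDerivAt_sqrt hsne)).congr_deriv ?_
          have h3 := Real.sq_sqrt hs.1.le
          have h4 : Real.sqrt s ≠ 0 := (Real.sqrt_pos.2 hs.1).ne'
          simp only [id]
          field_simp
          nlinarith
        have h3 := h2.ofReal_comp.mul (hasDerivAt_comp_segment hU hf (hz s ⟨hs.1.le, hs.2.le⟩))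
        refine h3.congr_deriv ?_
        push_cast
        ring)
      ((hi1.const_mul _).add (hi2.const_mul _))
  rw [intervalIntegral.integral_add (hi1.const_mul _) (hi2.const_mul _),
    intervalIntegral.integral_const_mul, intervalIntegral.integral_const_mul] at hint
  simpa using hint

/-! ### Injectivity and inverses of holomorphic functions -/

/-- A function whose derivative has positive real part on a convex set is injective there. -/
theorem injOn_of_re_deriv_pos {f f' : ℂ → ℂ} {S : Set ℂ} (hS : Convex ℝ S)
    (hf : ∀ z ∈ S, HasDerivAt f (f' z) z) (hpos : ∀ z ∈ S, 0 < (f' z).re) : InjOn f S := by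
  intro a ha b hb hab
  by_contra hne
  have hd : b - a ≠ 0 := sub_ne_zero.2 (Ne.symm hne)
  have hmem : ∀ t ∈ Icc (0 : ℝ) 1, a + t * (b - a) ∈ S := by
    intro t ht
    have := hS ha hb (sub_nonneg.2 ht.2) ht.1 (by ring)
    convert this using 1
    simp only [Complex.real_smul]
    push_cast
    ring
  -- Along the segment, Re(f · conj(b−a)) has derivative Re f′ · |b−a|² > 0, while equal end values
  -- would force a zero slope somewhere.
  have hline : ∀ t ∈ Icc (0 : ℝ) 1, HasDerivAt
      (fun t : ℝ => (f (a + t * (b - a)) * starRingEnd ℂ (b - a)).re)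
      ((f' (a + t * (b - a)) * (b - a) * starRingEnd ℂ (b - a)).re) t := by
    intro t ht
    have h2 : HasDerivAt (fun w : ℝ => a + (w : ℂ) * (b - a)) (b - a) t := by
      simpa using ((Complex.ofRealCLM.hasDerivAt (x := t)).mul_const (b - a)).const_add a
    have h3 := ((hf _ (hmem t ht)).comp t h2).mul_const (starRingEnd ℂ (b - a))
    exact Complex.reCLM.hasFDerivAt.comp_hasDerivAt t h3
  obtain ⟨c, hc, hc'⟩ := exists_hasDerivAt_eq_slope _ _ zero_lt_one
    (fun t ht => (hline t ht).continuousAt.continuousWithinAt)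
    (fun t ht => hline t (Ioo_subset_Icc_self ht))
  have h0 : (f' (a + c * (b - a)) * (b - a) * starRingEnd ℂ (b - a)).re
      = (f' (a + c * (b - a))).re * Complex.normSq (b - a) := by
    rw [mul_assoc, Complex.mul_conj]
    simp
  rw [h0] at hc'
  have h1 : (0 : ℝ) < (f' (a + c * (b - a))).re * Complex.normSq (b - a) :=
    mul_pos (hpos _ (hmem c (Ioo_subset_Icc_self hc))) (Complex.normSq_pos.2 hd)
  rw [hc'] at h1
  simp [hab] at h1

/-- Injectivity forces the set-theoretic inverse to coincide near f z with the local inverse given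
by the inverse function theorem. -/
theorem hasDerivAt_invFunOn {f : ℂ → ℂ} {S : Set ℂ} (hS : IsOpen S)
    (hf : DifferentiableOn ℂ f S) (hinj : InjOn f S) {z : ℂ} (hz : z ∈ S) (hne : deriv f z ≠ 0) :
    HasDerivAt (Function.invFunOn f S) (deriv f z)⁻¹ (f z) := by
  have hst : HasStrictDerivAt f (deriv f z) z :=
    (hf.analyticAt (hS.mem_nhds hz)).hasStrictDerivAt
  have h1 := hst.to_localInverse hne
  refine h1.hasDerivAt.congr_of_eventuallyEq ?_
  have hz0 : hst.localInverse f (deriv f z) z hne (f z) = z :=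
    HasStrictFDerivAt.localInverse_apply_image _
  have hmem : ∀ᶠ w in 𝓝 (f z), hst.localInverse f (deriv f z) z hne w ∈ S :=
    h1.hasDerivAt.continuousAt.eventually (by rw [hz0]; exact hS.mem_nhds hz)
  filter_upwards [hmem, hst.eventually_right_inverse hne] with w hw hw2
  have hex : ∃ a ∈ S, f a = w := ⟨_, hw, hw2⟩
  exact hinj (Function.invFunOn_mem hex) hw ((Function.invFunOn_eq hex).trans hw2.symm)

theorem isOpen_image_of_deriv_ne_zero {f : ℂ → ℂ} {S : Set ℂ} (hS : IsOpen S)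
    (hf : DifferentiableOn ℂ f S) (hne : ∀ z ∈ S, deriv f z ≠ 0) : IsOpen (f '' S) := by
  rw [isOpen_iff_mem_nhds]
  rintro _ ⟨z, hz, rfl⟩
  have hst : HasStrictDerivAt f (deriv f z) z :=
    (hf.analyticAt (hS.mem_nhds hz)).hasStrictDerivAt
  rw [← hst.map_nhds_eq (hne z hz)]
  exact image_mem_map (hS.mem_nhds hz)

noncomputable section

/-! ### The time density in the uniformizing variable

With `cos (l / 2) = (C - κ) / (C + 1)`, `C = cosh y`, the time form of the separatrix is
`timeDensity y dy`. -/

/-- In the variable C, the collision c = 0 is at `kap` = 1 − 2a₊, while c = −1 and c = a₋ are at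
−`poleM` and −`poleN`. -/
def kap : ℝ := 2 - Real.sqrt 2
def poleM : ℝ := (Real.sqrt 2 - 1) / 2
def poleN : ℝ := (12 * Real.sqrt 2 - 15) / 7
def bet : ℝ := Real.arccos kap

theorem sqrt_two_bounds : 1.4142 < Real.sqrt 2 ∧ Real.sqrt 2 < 1.4143 :=
  ⟨Real.lt_sqrt_of_sq_lt (by norm_num), (Real.sqrt_lt' (by norm_num)).2 (by norm_num)⟩

theorem kap_bounds : 0.58 < kap ∧ kap < 0.59 := by
  have := sqrt_two_bounds
  constructor <;> (unfold kap; linarith)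

theorem poleM_bounds : 0.2 < poleM ∧ poleM < 0.21 := by
  have := sqrt_two_bounds
  constructor <;> (unfold poleM; linarith)

theorem poleN_bounds : 0.28 < poleN ∧ poleN < 0.29 := by
  have := sqrt_two_bounds
  constructor <;> (unfold poleN; linarith)

theorem pole_sum_bounds : 1 - kap < poleM + poleN ∧ poleM + poleN < 1 - kap + 0.08 := by
  have := sqrt_two_bounds
  constructor <;> (unfold kap poleM poleN; linarith)

theorem cos_bet : Real.cos bet = kap :=
  Real.cos_arccos (by linarith [kap_bounds.1]) (by linarith [kap_bounds.2])

theorem bet_pos : 0 < bet := Real.arccos_pos.2 (by linarith [kap_bounds.2])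

theorem bet_lt : bet < Real.pi / 2 := Real.arccos_lt_pi_div_two.2 (by linarith [kap_bounds.1])

theorem kap_lt_cos {x : ℝ} (hx : |x| < bet) : kap < Real.cos x := by
  rw [← cos_bet, ← Real.cos_abs x]
  exact Real.cos_lt_cos_of_nonneg_of_le_pi (abs_nonneg x) (by linarith [bet_lt, Real.pi_pos]) hx

theorem Complex.cosh_re_eq (y : ℂ) : (Complex.cosh y).re = Real.cosh y.re * Real.cos y.im := by
  conv_lhs => rw [← Complex.re_add_im y]
  rw [Complex.cosh_add, Complex.cosh_mul_I, Complex.sinh_mul_I]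
  simp [← Complex.ofReal_cosh, ← Complex.ofReal_sinh, ← Complex.ofReal_cos, ← Complex.ofReal_sin]

theorem Complex.cosh_im_eq (y : ℂ) : (Complex.cosh y).im = Real.sinh y.re * Real.sin y.im := by
  conv_lhs => rw [← Complex.re_add_im y]
  rw [Complex.cosh_add, Complex.cosh_mul_I, Complex.sinh_mul_I]
  simp [← Complex.ofReal_cosh, ← Complex.ofReal_sinh, ← Complex.ofReal_cos, ← Complex.ofReal_sin]

/-- The square of the time density as a function of `C = cosh y`. -/
def densitySq (C : ℂ) : ℂ := 2 / 21 * ((C - kap) * (C + 1) / ((C + poleM) * (C + poleN)))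

def timeDensity (y : ℂ) : ℂ := Complex.sqrt (densitySq (Complex.cosh y))

/-! ### Sign and size of the squared density in the half-plane Re C > 0 -/

theorem add_ofReal_ne_zero {C : ℂ} (hC : 0 < C.re) {r : ℝ} (hr : 0 < r) : C + r ≠ 0 := by
  intro h
  have := congrArg Complex.re h
  simp at this
  linarith

theorem densitySq_den_ne_zero {C : ℂ} (hC : 0 < C.re) : (C + poleM) * (C + poleN) ≠ 0 :=
  mul_ne_zero (add_ofReal_ne_zero hC (by linarith [poleM_bounds.1]))
    (add_ofReal_ne_zero hC (by linarith [poleN_bounds.1]))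

/-- The imaginary part of numerator times conjugate denominator (real quadratics in C) is Im C times
a real factor. That factor is positive because m + n > 1 − κ; its only negative term is dominated by
(κ + mn)(m + n). -/
theorem densitySq_im {C : ℂ} (hC : 0 < C.re) : ∃ p : ℝ, 0 < p ∧ (densitySq C).im = p * C.im := by
  have hD := Complex.normSq_pos.2 (densitySq_den_ne_zero hC)
  refine ⟨2 / 21 * ((poleM + poleN - (1 - kap)) * (C.re ^ 2 + C.im ^ 2 - poleM * poleN)
    + (kap + poleM * poleN) * (2 * C.re + poleM + poleN)) /
      Complex.normSq ((C + poleM) * (C + poleN)), ?_, ?_⟩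
  · refine div_pos (mul_pos (by norm_num) ?_) hD
    obtain ⟨h1, h2⟩ := kap_bounds
    obtain ⟨h3, h4⟩ := poleM_bounds
    obtain ⟨h5, h6⟩ := poleN_bounds
    obtain ⟨h7, h8⟩ := pole_sum_bounds
    have hmn : 0 < poleM * poleN := by nlinarith
    have hmn2 : poleM * poleN < 0.21 * 0.29 := by nlinarith
    have e1 : 0 ≤ (poleM + poleN - (1 - kap)) * (C.re ^ 2 + C.im ^ 2) :=
      mul_nonneg (by linarith) (by positivity)
    have e2 : (poleM + poleN - (1 - kap)) * (poleM * poleN) ≤ 0.08 * (0.21 * 0.29) :=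
      mul_le_mul (by linarith) hmn2.le hmn.le (by norm_num)
    have e3 : 0.58 * 0.48 ≤ (kap + poleM * poleN) * (2 * C.re + poleM + poleN) :=
      mul_le_mul (by linarith) (by linarith) (by norm_num) (by linarith)
    nlinarith
  · have h21 : (2 / 21 : ℂ) = ((2 / 21 : ℝ) : ℂ) := by norm_num
    rw [densitySq, h21, Complex.im_ofReal_mul, Complex.div_im]
    simp only [Complex.mul_re, Complex.mul_im, Complex.add_re, Complex.add_im, Complex.sub_re,
      Complex.sub_im, Complex.ofReal_re, Complex.ofReal_im, Complex.one_re, Complex.one_im]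
    field_simp
    ring

theorem densitySq_mem_slitPlane {C : ℂ} (hC : 0 < C.re) (hr : C.im = 0 → kap < C.re) :
    densitySq C ∈ Complex.slitPlane := by
  by_cases h0 : C.im = 0
  · left
    have hk := hr h0
    have hCr : C = (C.re : ℂ) := Complex.ext rfl (by simpa using h0)
    have : densitySq C = ((2 / 21 * ((C.re - kap) * (C.re + 1) /
        ((C.re + poleM) * (C.re + poleN))) : ℝ) : ℂ) := by
      rw [densitySq, hCr]
      push_cast
      simp
    rw [this, Complex.ofReal_re]
    have h3 := poleM_bounds.1
    have h5 := poleN_bounds.1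
    have : 0 < C.re - kap := by linarith
    have : 0 < C.re + poleM := by linarith
    have : 0 < C.re + poleN := by linarith
    positivity
  · right
    obtain ⟨p, hp, h⟩ := densitySq_im hC
    rw [h]
    exact mul_ne_zero hp.ne' h0

/-- Isolates the limit 2/21 at infinity. The O(1/|C|) remainder gives the upper bound on |f| and,
for large C, the lower bound on Re f. -/
theorem densitySq_eq {C : ℂ} (hC : 0 < C.re) : densitySq C =
    2 / 21 * (1 + (((1 - kap - (poleM + poleN) : ℝ) : ℂ) * C - ((kap + poleM * poleN : ℝ) : ℂ)) /
      ((C + poleM) * (C + poleN))) := by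
  have := densitySq_den_ne_zero hC
  rw [densitySq, one_add_div this]
  congr 2
  push_cast
  ring

theorem densitySq_remainder {C : ℂ} (hC : 0 < C.re) :
    ‖(((1 - kap - (poleM + poleN) : ℝ) : ℂ) * C - ((kap + poleM * poleN : ℝ) : ℂ)) /
      ((C + poleM) * (C + poleN))‖ ≤ (0.08 * ‖C‖ + 0.66) / ‖C‖ ^ 2 := by
  obtain ⟨h1, h2⟩ := kap_bounds
  obtain ⟨h3, h4⟩ := poleM_bounds
  obtain ⟨h5, h6⟩ := poleN_bounds
  obtain ⟨h7, h8⟩ := pole_sum_bounds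
  have hC0 : 0 < ‖C‖ := norm_pos_iff.2 fun h => by simp [h] at hC
  have key : ∀ r : ℝ, 0 < r → ‖C‖ ≤ ‖C + r‖ := by
    intro r hr
    refine abs_le_of_sq_le_sq' ?_ (norm_nonneg _) |>.2
    rw [Complex.sq_norm, Complex.sq_norm, Complex.normSq_apply, Complex.normSq_apply]
    simp
    nlinarith
  rw [norm_div]
  refine div_le_div₀ (by positivity) ?_ (by positivity) ?_
  · refine (norm_sub_le _ _).trans (add_le_add ?_ ?_)
    · rw [norm_mul, Complex.norm_real, Real.norm_eq_abs]
      exact mul_le_mul_of_nonneg_right (abs_le.2 ⟨by linarith, by linarith⟩) (norm_nonneg _)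
    · rw [Complex.norm_real, Real.norm_eq_abs]
      have hmn : 0 < poleM * poleN := by nlinarith
      have hmn2 : poleM * poleN < 0.21 * 0.29 := by nlinarith
      exact abs_le.2 ⟨by linarith, by linarith⟩
  · rw [norm_mul, sq]
    exact mul_le_mul (key _ (by linarith)) (key _ (by linarith)) hC0.le (norm_nonneg _)

theorem densitySq_norm_le {C : ℂ} (hC : 1 / 2 ≤ C.re) : ‖densitySq C‖ ≤ 1 := by
  have hC' : 0 < C.re := by linarith
  have h1 := densitySq_remainder hC'
  have h2 : 1 / 2 ≤ ‖C‖ := hC.trans (Complex.re_le_norm C)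
  rw [densitySq_eq hC', norm_mul]
  have h3 : (0.08 * ‖C‖ + 0.66) / ‖C‖ ^ 2 ≤ 3 := by
    rw [div_le_iff₀ (by positivity)]
    nlinarith
  have h4 := norm_add_le (1 : ℂ) ((((1 - kap - (poleM + poleN) : ℝ) : ℂ) * C -
    ((kap + poleM * poleN : ℝ) : ℂ)) / ((C + poleM) * (C + poleN)))
  rw [norm_one] at h4
  have h5 : ‖(2 / 21 : ℂ)‖ = 2 / 21 := by norm_num
  rw [h5]
  linarith

theorem densitySq_re_ge {C : ℂ} (hC : 0 < C.re) (hn : 2 ≤ ‖C‖) : 1 / 21 ≤ (densitySq C).re := by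
  have h1 := densitySq_remainder hC
  have h3 : (0.08 * ‖C‖ + 0.66) / ‖C‖ ^ 2 ≤ 1 / 2 := by
    rw [div_le_iff₀ (by positivity)]
    nlinarith
  have h21 : (2 / 21 : ℂ) = ((2 / 21 : ℝ) : ℂ) := by norm_num
  rw [densitySq_eq hC, h21, Complex.re_ofReal_mul, Complex.add_re, Complex.one_re]
  have := neg_le_of_abs_le (Complex.abs_re_le_norm ((((1 - kap - (poleM + poleN) : ℝ) : ℂ) * C -
    ((kap + poleM * poleN : ℝ) : ℂ)) / ((C + poleM) * (C + poleN))))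
  linarith

/-! ### The domains -/

/-- The strip `|Im y| < π / 2` slit along `{iθ : |θ| ≥ β}`. -/
def slitStrip : Set ℂ := {y | |y.im| < Real.pi / 2 ∧ (y.re = 0 → |y.im| < bet)}

/-- The strip on which the time map is univalent. -/
def innerStrip : Set ℂ := {y | |y.im| < bet}

theorem innerStrip_subset : innerStrip ⊆ slitStrip := fun _ hy =>
  ⟨lt_trans hy bet_lt, fun _ => hy⟩

theorem isOpen_innerStrip : IsOpen innerStrip :=
  isOpen_lt (by fun_prop) continuous_const

theorem isOpen_slitStrip : IsOpen slitStrip := by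
  have : slitStrip = {y : ℂ | |y.im| < Real.pi / 2} ∩ ({y : ℂ | y.re ≠ 0} ∪ {y | |y.im| < bet}) := by
    ext y
    simp only [slitStrip, mem_inter_iff, mem_union, mem_ofPred_eq]
    tauto
  rw [this]
  refine (isOpen_lt (by fun_prop) continuous_const).inter
    ((isOpen_ne_fun (by fun_prop) continuous_const).union (isOpen_lt (by fun_prop) continuous_const))

theorem convex_innerStrip : Convex ℝ innerStrip := by
  have : innerStrip = Complex.imCLM ⁻¹' (Ioo (-bet) bet) := by
    ext y
    simp [innerStrip, abs_lt]
  rw [this]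
  exact (convex_Ioo _ _).is_linear_preimage Complex.imCLM.toLinearMap.isLinear

/-- Star-shapedness about 0 is what allows the time map to be an integral along radial segments,
although the slit domain is not convex. -/
theorem segment_mem_slitStrip {y : ℂ} (hy : y ∈ slitStrip) :
    ∀ s ∈ Icc (0 : ℝ) 1, (s : ℂ) * y ∈ slitStrip := by
  intro s hs
  have h1 : |s * y.im| ≤ |y.im| := by
    rw [abs_mul, abs_of_nonneg hs.1]
    nlinarith [hs.2, abs_nonneg y.im]
  refine ⟨by simpa using lt_of_le_of_lt h1 hy.1, fun h => ?_⟩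
  have h2 : s * y.re = 0 := by simpa using h
  rcases mul_eq_zero.1 h2 with h3 | h3
  · simpa [h3] using bet_pos
  · simpa using lt_of_le_of_lt h1 (hy.2 h3)

theorem cosh_re_pos {y : ℂ} (hy : |y.im| < Real.pi / 2) : 0 < (Complex.cosh y).re := by
  rw [Complex.cosh_re_eq]
  exact mul_pos (Real.cosh_pos _) (Real.cos_pos_of_mem_Ioo (abs_lt.1 hy))

theorem kap_lt_cosh_re {y : ℂ} (hy : y ∈ innerStrip) : kap < (Complex.cosh y).re := by
  rw [Complex.cosh_re_eq]
  have h1 := kap_lt_cos hy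
  have h2 := Real.one_le_cosh y.re
  have h3 := kap_bounds.1
  nlinarith

theorem densitySq_cosh_mem_slitPlane {y : ℂ} (hy : y ∈ slitStrip) :
    densitySq (Complex.cosh y) ∈ Complex.slitPlane := by
  refine densitySq_mem_slitPlane (cosh_re_pos hy.1) fun h => ?_
  rw [Complex.cosh_im_eq] at h
  rcases mul_eq_zero.1 h with h | h
  · exact kap_lt_cosh_re (hy.2 (Real.sinh_eq_zero.1 h))
  · have hpi := abs_lt.1 hy.1
    have h0 : y.im = 0 := (Real.sin_eq_zero_iff_of_lt_of_lt (by linarith [Real.pi_pos])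
      (by linarith [Real.pi_pos])).1 h
    exact kap_lt_cosh_re (by simpa [innerStrip, h0] using bet_pos)

theorem differentiableAt_densitySq_cosh {y : ℂ} (hy : |y.im| < Real.pi / 2) :
    DifferentiableAt ℂ (fun y => densitySq (Complex.cosh y)) y := by
  have := densitySq_den_ne_zero (cosh_re_pos hy)
  unfold densitySq
  fun_prop (disch := assumption)

theorem differentiableOn_timeDensity : DifferentiableOn ℂ timeDensity slitStrip := by
  intro y hy
  exact ((Complex.differentiableAt_sqrt (densitySq_cosh_mem_slitPlane hy)).comp y
    (differentiableAt_densitySq_cosh hy.1)).differentiableWithinAt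

theorem timeDensity_re_pos {y : ℂ} (hy : y ∈ slitStrip) : 0 < (timeDensity y).re :=
  Complex.re_sqrt_pos (densitySq_cosh_mem_slitPlane hy)

theorem timeDensity_im_pos {y : ℂ} (hx : 0 < y.re) (h0 : 0 < y.im) (h1 : y.im < Real.pi / 2) :
    0 < (timeDensity y).im := by
  refine Complex.im_sqrt_pos ?_
  obtain ⟨p, hp, h⟩ := densitySq_im (cosh_re_pos (y := y) (abs_lt.2 ⟨by linarith, h1⟩))
  rw [h, Complex.cosh_im_eq]
  exact mul_pos hp (mul_pos (Real.sinh_pos_iff.2 hx)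
    (Real.sin_pos_of_pos_of_lt_pi h0 (by linarith [Real.pi_pos])))

theorem timeDensity_norm_le {y : ℂ} (hy : y ∈ innerStrip) : ‖timeDensity y‖ ≤ 1 := by
  have h1 := densitySq_norm_le (C := Complex.cosh y)
    (by linarith [kap_lt_cosh_re hy, kap_bounds.1])
  rw [← Complex.norm_sqrt_sq] at h1
  exact (sq_le_one_iff₀ (norm_nonneg _)).1 h1

theorem timeDensity_re_ge {y : ℂ} (hy : y ∈ innerStrip) (hx : 2 ≤ y.re) :
    1 / 5 ≤ (timeDensity y).re := by
  have hpos := timeDensity_re_pos (innerStrip_subset hy)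
  have h0 := cosh_re_pos (innerStrip_subset hy).1
  have hsinh : 2 ≤ Real.sinh y.re := hx.trans (Real.self_le_sinh_iff.2 (by linarith))
  have hn : 2 ≤ ‖Complex.cosh y‖ := by
    refine abs_le_of_sq_le_sq' ?_ (norm_nonneg _) |>.2
    rw [Complex.sq_norm, Complex.normSq_apply, Complex.cosh_re_eq, Complex.cosh_im_eq]
    -- |cosh y|² = sinh²(Re y) + cos²(Im y) ≥ 4.
    nlinarith [Real.cosh_sq y.re, Real.sin_sq_add_cos_sq y.im, sq_nonneg (Real.cos y.im)]
  -- Re f² ≥ 1/21 gives (Re f)² ≥ 1/21 > 1/25.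
  have h1 := densitySq_re_ge h0 hn
  have h2 := Complex.re_le_re_sqrt_sq (densitySq (Complex.cosh y))
  change _ ≤ (timeDensity y).re ^ 2 at h2
  nlinarith

theorem timeDensity_neg (y : ℂ) : timeDensity (-y) = timeDensity y := by
  simp [timeDensity]

theorem timeDensity_conj {y : ℂ} (hy : y ∈ slitStrip) :
    timeDensity (starRingEnd ℂ y) = starRingEnd ℂ (timeDensity y) := by
  rw [timeDensity, timeDensity, ← Complex.sqrt_conj (densitySq_cosh_mem_slitPlane hy),
    Complex.cosh_conj]
  simp [densitySq, map_ofNat]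

/-! ### The time map -/

/-- The complex time as a function of the uniformizing variable. -/
def timeMap : ℂ → ℂ := segmentPrimitive timeDensity

theorem hasDerivAt_timeMap {y : ℂ} (hy : y ∈ slitStrip) :
    HasDerivAt timeMap (timeDensity y) y :=
  hasDerivAt_segmentPrimitive isOpen_slitStrip differentiableOn_timeDensity
    (segment_mem_slitStrip hy)

theorem timeMap_zero : timeMap 0 = 0 := by simp [timeMap, segmentPrimitive]

theorem timeMap_neg (y : ℂ) : timeMap (-y) = -timeMap y := by
  simp [timeMap, segmentPrimitive, timeDensity_neg]

theorem timeMap_conj {y : ℂ} (hy : y ∈ slitStrip) :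
    timeMap (starRingEnd ℂ y) = starRingEnd ℂ (timeMap y) := by
  simp only [timeMap, segmentPrimitive, map_mul]
  congr 1
  rw [intervalIntegral.integral_of_le zero_le_one, intervalIntegral.integral_of_le zero_le_one,
    ← integral_conj, ← intervalIntegral.integral_of_le zero_le_one,
    ← intervalIntegral.integral_of_le zero_le_one]
  refine intervalIntegral.integral_congr fun s hs => ?_
  rw [uIcc_of_le zero_le_one] at hs
  have := timeDensity_conj (segment_mem_slitStrip hy s hs)
  simpa using this

theorem injOn_timeMap : InjOn timeMap innerStrip :=
  injOn_of_re_deriv_pos convex_innerStrip (fun _ hz => hasDerivAt_timeMap (innerStrip_subset hz))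
    (fun _ hz => timeDensity_re_pos (innerStrip_subset hz))

theorem mk_mem_innerStrip {x θ : ℝ} (hθ : |θ| < bet) : (⟨x, θ⟩ : ℂ) ∈ innerStrip := hθ

/-- T is odd and commutes with conjugation, and conj(iθ) = −iθ. -/
theorem timeMap_imaginary_re {θ : ℝ} (hθ : |θ| < bet) : (timeMap ⟨0, θ⟩).re = 0 := by
  have h1 := timeMap_conj (innerStrip_subset (mk_mem_innerStrip (x := 0) hθ))
  have h2 : starRingEnd ℂ (⟨0, θ⟩ : ℂ) = -⟨0, θ⟩ := by
    apply Complex.ext <;> simp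
  rw [h2, timeMap_neg] at h1
  have := congrArg Complex.re h1
  simp at this
  linarith

theorem timeMap_real_im (x : ℝ) : (timeMap ⟨x, 0⟩).im = 0 := by
  have h1 := timeMap_conj (y := ⟨x, 0⟩) (innerStrip_subset (mk_mem_innerStrip (by simpa using bet_pos)))
  have h2 : starRingEnd ℂ (⟨x, 0⟩ : ℂ) = ⟨x, 0⟩ := by
    apply Complex.ext <;> simp
  rw [h2] at h1
  have := congrArg Complex.im h1
  simp at this
  linarith

theorem hasDerivAt_timeMap_horizontal {x θ : ℝ} (hy : (⟨x, θ⟩ : ℂ) ∈ slitStrip) :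
    HasDerivAt (fun x : ℝ => timeMap ⟨x, θ⟩) (timeDensity ⟨x, θ⟩) x := by
  have h2 : HasDerivAt (fun w : ℝ => (w : ℂ) + θ * Complex.I) 1 x := by
    simpa using (Complex.ofRealCLM.hasDerivAt (x := x)).add_const (θ * Complex.I)
  have he : ∀ w : ℝ, (w : ℂ) + θ * Complex.I = ⟨w, θ⟩ := fun w => (Complex.mk_eq_add_mul_I w θ).symm
  have h3 : HasDerivAt timeMap (timeDensity ⟨x, θ⟩) ((x : ℂ) + θ * Complex.I) := by
    rw [he]
    exact hasDerivAt_timeMap hy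
  simpa [he, Function.comp_def] using h3.comp x h2

theorem timeMap_re_strictMono {θ : ℝ} (hθ : |θ| < bet) :
    StrictMono fun x : ℝ => (timeMap ⟨x, θ⟩).re := by
  have hd : ∀ x : ℝ, HasDerivAt (fun x : ℝ => (timeMap ⟨x, θ⟩).re) (timeDensity ⟨x, θ⟩).re x :=
    fun x => Complex.reCLM.hasFDerivAt.comp_hasDerivAt x
      (hasDerivAt_timeMap_horizontal (innerStrip_subset (mk_mem_innerStrip hθ)))
  refine strictMono_of_deriv_pos fun x => ?_
  rw [(hd x).deriv]
  exact timeDensity_re_pos (innerStrip_subset (mk_mem_innerStrip hθ))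

theorem timeMap_re_ge {θ : ℝ} (hθ : |θ| < bet) {x : ℝ} (hx : 2 ≤ x) :
    (x - 2) / 5 ≤ (timeMap ⟨x, θ⟩).re := by
  have hd : ∀ x : ℝ, HasDerivAt (fun x : ℝ => (timeMap ⟨x, θ⟩).re) (timeDensity ⟨x, θ⟩).re x :=
    fun x => Complex.reCLM.hasFDerivAt.comp_hasDerivAt x
      (hasDerivAt_timeMap_horizontal (innerStrip_subset (mk_mem_innerStrip hθ)))
  have h2 := timeMap_re_strictMono hθ (show (0 : ℝ) < 2 by norm_num)
  simp only [timeMap_imaginary_re hθ] at h2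
  have h3 := (convex_Ici (2 : ℝ)).mul_sub_le_image_sub_of_le_deriv
    (f := fun x : ℝ => (timeMap ⟨x, θ⟩).re) (C := 1 / 5)
    (fun x _ => (hd x).continuousAt.continuousWithinAt)
    (fun x _ => (hd x).differentiableAt.differentiableWithinAt)
    (fun x hx => by
      rw [(hd x).deriv]
      rw [interior_Ici] at hx
      exact timeDensity_re_ge (mk_mem_innerStrip hθ) (le_of_lt hx))
    2 self_mem_Ici x hx hx
  linarith

/-- Properness in the real direction: a bound on Re T confines y to a compact set. -/
theorem timeMap_re_abs_ge {y : ℂ} (hy : y ∈ innerStrip) :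
    (|y.re| - 2) / 5 ≤ |(timeMap y).re| := by
  have key : ∀ y ∈ innerStrip, 2 ≤ y.re → (|y.re| - 2) / 5 ≤ |(timeMap y).re| := by
    intro y hy h
    rw [abs_of_nonneg (by linarith : 0 ≤ y.re)]
    exact (timeMap_re_ge (x := y.re) (θ := y.im) hy h).trans (le_abs_self _)
  rcases le_or_gt 2 |y.re| with h | h
  · rcases le_abs.1 h with h | h
    · exact key y hy h
    · have := key (-y) (by simpa [innerStrip] using hy) (by simpa using h)
      simpa [timeMap_neg] using this
  · exact le_trans (by linarith) (abs_nonneg _)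

/-- Follows from |f| ≤ 1 and Re T = 0 on the imaginary axis. It prevents a sequence whose times tend
to a limit with nonzero real part from approaching the imaginary axis. -/
theorem timeMap_re_abs_le {y : ℂ} (hy : y ∈ innerStrip) : |(timeMap y).re| ≤ |y.re| := by
  have hy0 : (⟨0, y.im⟩ : ℂ) ∈ innerStrip := hy
  have h := convex_innerStrip.norm_image_sub_le_of_norm_hasDerivWithin_le (f := timeMap)
    (f' := timeDensity) (C := 1)
    (fun z hz => (hasDerivAt_timeMap (innerStrip_subset hz)).hasDerivWithinAt)
    (fun z hz => timeDensity_norm_le hz) hy0 hy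
  have h1 : ‖y - ⟨0, y.im⟩‖ = |y.re| := by
    have : y - ⟨0, y.im⟩ = (y.re : ℂ) := by apply Complex.ext <;> simp
    rw [this, Complex.norm_real, Real.norm_eq_abs]
  rw [h1, one_mul] at h
  have h2 := (Complex.abs_re_le_norm _).trans h
  rwa [Complex.sub_re, timeMap_imaginary_re hy, sub_zero] at h2

/-- Only x > 0 is allowed: for θ ≥ β the point iθ lies on the slit. -/
theorem timeMap_im_strictMonoOn {θ : ℝ} (h0 : 0 < θ) (h1 : θ < Real.pi / 2) :
    StrictMonoOn (fun x : ℝ => (timeMap ⟨x, θ⟩).im) (Ioi 0) := by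
  have hd : ∀ x ∈ Ioi (0 : ℝ), HasDerivAt (fun x : ℝ => (timeMap ⟨x, θ⟩).im)
      (timeDensity ⟨x, θ⟩).im x := by
    intro x hx
    exact Complex.imCLM.hasFDerivAt.comp_hasDerivAt x (hasDerivAt_timeMap_horizontal
      ⟨abs_lt.2 ⟨by simp only; linarith, h1⟩, fun h => absurd h (ne_of_gt hx)⟩)
  refine strictMonoOn_of_deriv_pos (convex_Ioi 0)
    (fun x hx => (hd x hx).continuousAt.continuousWithinAt) fun x hx => ?_
  rw [interior_Ioi] at hx
  rw [(hd x hx).deriv]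
  exact timeDensity_im_pos hx h0 h1

theorem timeMap_im_ge_imaginary {x θ : ℝ} (hx : 0 < x) (h0 : 0 < θ) (h1 : θ < bet) :
    (timeMap ⟨0, θ⟩).im ≤ (timeMap ⟨x, θ⟩).im := by
  have hθ : |θ| < bet := by rwa [abs_of_pos h0]
  have hc : ContinuousWithinAt (fun x : ℝ => (timeMap ⟨x, θ⟩).im) (Ioi 0) 0 :=
    (Complex.continuous_im.continuousAt.comp (hasDerivAt_timeMap_horizontal
      (innerStrip_subset (mk_mem_innerStrip hθ))).continuousAt).continuousWithinAt
  refine le_of_tendsto hc.tendsto ?_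
  filter_upwards [Ioo_mem_nhdsGT hx] with z hz
  exact (timeMap_im_strictMonoOn h0 (h1.trans bet_lt) hz.1 hx hz.2).le

end

/-! ### The image of the time map -/

theorem hasDerivAt_timeMap_vertical {x θ : ℝ} (hy : (⟨x, θ⟩ : ℂ) ∈ slitStrip) :
    HasDerivAt (fun θ : ℝ => timeMap ⟨x, θ⟩) (timeDensity ⟨x, θ⟩ * Complex.I) θ := by
  have h2 : HasDerivAt (fun w : ℝ => (x : ℂ) + w * Complex.I) Complex.I θ := by
    simpa using ((Complex.ofRealCLM.hasDerivAt (x := θ)).mul_const Complex.I).const_add (x : ℂ)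
  have he : ∀ w : ℝ, (x : ℂ) + w * Complex.I = ⟨x, w⟩ := fun w => (Complex.mk_eq_add_mul_I x w).symm
  have h3 : HasDerivAt timeMap (timeDensity ⟨x, θ⟩) ((x : ℂ) + θ * Complex.I) := by
    rw [he]
    exact hasDerivAt_timeMap hy
  simpa [he, Function.comp_def] using h3.comp θ h2

theorem hasDerivAt_timeMap_imaginary_im {θ : ℝ} (hθ : |θ| < bet) :
    HasDerivAt (fun θ : ℝ => (timeMap ⟨0, θ⟩).im) (timeDensity ⟨0, θ⟩).re θ := by
  have := Complex.imCLM.hasFDerivAt.comp_hasDerivAt θ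
    (hasDerivAt_timeMap_vertical (innerStrip_subset (mk_mem_innerStrip (x := 0) hθ)))
  simpa [Function.comp_def] using this

theorem timeMap_imaginary_strictMonoOn :
    StrictMonoOn (fun θ : ℝ => (timeMap ⟨0, θ⟩).im) (Ioo (-bet) bet) := by
  refine strictMonoOn_of_deriv_pos (convex_Ioo _ _) (fun θ hθ =>
    (hasDerivAt_timeMap_imaginary_im (abs_lt.2 hθ)).continuousAt.continuousWithinAt) fun θ hθ => ?_
  rw [interior_Ioo] at hθ
  rw [(hasDerivAt_timeMap_imaginary_im (abs_lt.2 hθ)).deriv]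
  exact timeDensity_re_pos (innerStrip_subset (mk_mem_innerStrip (abs_lt.2 hθ)))

theorem timeMap_imaginary_im_pos {θ : ℝ} (h0 : 0 < θ) (h1 : θ < bet) :
    0 < (timeMap ⟨0, θ⟩).im := by
  have := timeMap_imaginary_strictMonoOn ⟨by linarith [bet_pos], bet_pos⟩
    ⟨by linarith [bet_pos], h1⟩ h0
  have h2 := timeMap_real_im 0
  simp only at this
  linarith

/-- The value `i A` of the time map at the corner `i β`. -/
def IsTimeWidth (A : ℝ) : Prop := Tendsto (fun θ : ℝ => (timeMap ⟨0, θ⟩).im) (𝓝[<] bet) (𝓝 A)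

theorem timeMap_imaginary_im_lt {A : ℝ} (hA : IsTimeWidth A) {θ : ℝ} (h0 : 0 < θ) (h1 : θ < bet) :
    (timeMap ⟨0, θ⟩).im < A := by
  obtain ⟨ψ, h2, h3⟩ := exists_between h1
  have h4 := timeMap_imaginary_strictMonoOn ⟨by linarith [bet_pos], h1⟩
    ⟨by linarith [bet_pos], h3⟩ h2
  refine lt_of_lt_of_le h4 (ge_of_tendsto hA ?_)
  filter_upwards [Ioo_mem_nhdsLT h3] with z hz
  exact (timeMap_imaginary_strictMonoOn ⟨by linarith [bet_pos], h3⟩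
    ⟨by linarith [bet_pos, hz.1], hz.2⟩ hz.1).le

theorem width_pos {A : ℝ} (hA : IsTimeWidth A) : 0 < A := by
  have h1 : bet / 2 < bet := by linarith [bet_pos]
  have h0 : 0 < bet / 2 := by linarith [bet_pos]
  exact (timeMap_imaginary_im_pos h0 h1).trans (timeMap_imaginary_im_lt hA h0 h1)

/-- Letting θ ↑ β in the comparison with the imaginary axis gives the weak inequality for every
positive abscissa; monotonicity from x/2 to x makes it strict. -/
theorem width_lt_timeMap_im {A : ℝ} (hA : IsTimeWidth A) {x : ℝ} (hx : 0 < x) : A < (timeMap ⟨x, bet⟩).im := by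
  have hge : ∀ x : ℝ, 0 < x → A ≤ (timeMap ⟨x, bet⟩).im := by
    intro x hx
    have hc : ContinuousAt (fun θ : ℝ => (timeMap ⟨x, θ⟩).im) bet :=
      Complex.continuous_im.continuousAt.comp (hasDerivAt_timeMap_vertical
        ⟨by simpa [abs_of_pos bet_pos] using bet_lt, fun h => absurd h hx.ne'⟩).continuousAt
    refine le_of_tendsto_of_tendsto hA (hc.continuousWithinAt (s := Iio bet)).tendsto ?_
    filter_upwards [Ioo_mem_nhdsLT bet_pos] with θ hθ
    exact timeMap_im_ge_imaginary hx hθ.1 hθ.2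
  have h2 : x / 2 < x := by linarith
  have h3 : 0 < x / 2 := by linarith
  exact (hge _ h3).trans_lt (timeMap_im_strictMonoOn bet_pos bet_lt h3 hx h2)

theorem width_lt_abs_timeMap_im {A : ℝ} (hA : IsTimeWidth A) {y : ℂ} (hx : y.re ≠ 0) (hy : |y.im| = bet) :
    A < |(timeMap y).im| := by
  have key : ∀ y : ℂ, 0 < y.re → |y.im| = bet → A < |(timeMap y).im| := by
    intro y hx hy
    have hyU : y ∈ slitStrip := ⟨hy ▸ bet_lt, fun h => absurd h hx.ne'⟩
    have h1 := width_lt_timeMap_im hA hx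
    rcases (abs_eq bet_pos.le).1 hy with h | h
    · rw [← h] at h1
      exact h1.trans_le (le_abs_self _)
    · have h2 : (⟨y.re, bet⟩ : ℂ) = starRingEnd ℂ y := by
        apply Complex.ext <;> simp [h]
      rw [h2, timeMap_conj hyU, Complex.conj_im] at h1
      exact h1.trans_le (neg_le_abs _)
  rcases lt_or_gt_of_ne hx with h | h
  · have := key (-y) (by simpa using h) (by simpa using hy)
    simpa [timeMap_neg] using this
  · exact key y h hy

/-- Relative closedness of the image. Properness gives a limit point y of the preimages, with Re y ≠
0 since Re w ≠ 0, so T is continuous at y; y on the boundary |Im y| = β is excluded because |Im T| >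
A there. -/
theorem mem_image_of_tendsto {A : ℝ} (hA : IsTimeWidth A) {u : ℕ → ℂ} (hu : ∀ n, u n ∈ innerStrip) {w : ℂ}
    (hw : Tendsto (fun n => timeMap (u n)) atTop (𝓝 w)) (hre : w.re ≠ 0) (him : |w.im| ≤ A) :
    w ∈ timeMap '' innerStrip := by
  have hre' : Tendsto (fun n => (timeMap (u n)).re) atTop (𝓝 w.re) :=
    (Complex.continuous_re.tendsto w).comp hw
  obtain ⟨M, hM⟩ := hre'.abs.bddAbove_range
  have hbd : ∀ n, u n ∈ (Icc (-(5 * M + 2)) (5 * M + 2)) ×ℂ (Icc (-bet) bet) := by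
    intro n
    have h1 := timeMap_re_abs_ge (hu n)
    have h2 : |(timeMap (u n)).re| ≤ M := hM ⟨n, rfl⟩
    exact ⟨abs_le.1 (by linarith), abs_le.1 (le_of_lt (hu n))⟩
  obtain ⟨y, hy, φ, hφ, hlim⟩ := (isCompact_Icc.reProdIm isCompact_Icc).tendsto_subseq hbd
  have hwφ : Tendsto (fun n => timeMap (u (φ n))) atTop (𝓝 w) := hw.comp hφ.tendsto_atTop
  have hyre : y.re ≠ 0 := by
    intro h0
    have h1 : Tendsto (fun n => |(u (φ n)).re|) atTop (𝓝 0) := by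
      have := ((Complex.continuous_re.tendsto y).comp hlim).abs
      simpa [h0, Function.comp_def] using this
    have h2 : Tendsto (fun n => |(timeMap (u (φ n))).re|) atTop (𝓝 0) :=
      squeeze_zero (fun _ => abs_nonneg _) (fun n => timeMap_re_abs_le (hu (φ n))) h1
    have h3 := tendsto_nhds_unique h2 (hre'.comp hφ.tendsto_atTop).abs
    exact hre (abs_eq_zero.1 h3.symm)
  have hyb : |y.im| ≤ bet := abs_le.2 hy.2
  have hyU : y ∈ slitStrip := ⟨hyb.trans_lt bet_lt, fun h => absurd h hyre⟩
  have hTy : timeMap y = w :=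
    tendsto_nhds_unique ((hasDerivAt_timeMap hyU).continuousAt.tendsto.comp hlim) hwφ
  rcases hyb.lt_or_eq with h | h
  · exact ⟨y, h, hTy⟩
  · have := width_lt_abs_timeMap_im hA hyre h
    rw [hTy] at this
    linarith

theorem isOpen_timeMap_image : IsOpen (timeMap '' innerStrip) := by
  refine isOpen_image_of_deriv_ne_zero isOpen_innerStrip (fun z hz =>
    (hasDerivAt_timeMap (innerStrip_subset hz)).differentiableAt.differentiableWithinAt)
    fun z hz h => ?_
  rw [(hasDerivAt_timeMap (innerStrip_subset hz)).deriv] at h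
  have := timeDensity_re_pos (innerStrip_subset hz)
  simp [h] at this

theorem ofReal_mem_timeMap_image (t : ℝ) : (t : ℂ) ∈ timeMap '' innerStrip := by
  have hθ : |(0 : ℝ)| < bet := by simpa using bet_pos
  have hc : Continuous fun x : ℝ => (timeMap ⟨x, 0⟩).re :=
    continuous_iff_continuousAt.2 fun x => Complex.continuous_re.continuousAt.comp
      (hasDerivAt_timeMap_horizontal (innerStrip_subset (mk_mem_innerStrip hθ))).continuousAt
  have hR : ∀ R : ℝ, 0 ≤ R → R ≤ (timeMap ⟨5 * R + 2, 0⟩).re := by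
    intro R hR
    have := timeMap_re_ge hθ (x := 5 * R + 2) (by linarith)
    linarith
  have h1 := hR |t| (abs_nonneg t)
  have h2 : (timeMap ⟨-(5 * |t| + 2), 0⟩).re ≤ -|t| := by
    have h3 : (⟨-(5 * |t| + 2), 0⟩ : ℂ) = -⟨5 * |t| + 2, 0⟩ := by apply Complex.ext <;> simp
    rw [h3, timeMap_neg, Complex.neg_re]
    linarith
  obtain ⟨x, -, hx⟩ := intermediate_value_Icc
    (show -(5 * |t| + 2) ≤ 5 * |t| + 2 by linarith [abs_nonneg t]) hc.continuousOn
    ⟨h2.trans (neg_abs_le t), (le_abs_self t).trans h1⟩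
  exact ⟨⟨x, 0⟩, mk_mem_innerStrip hθ, Complex.ext hx (by simpa using timeMap_real_im x)⟩

theorem imaginary_mem_timeMap_image {A : ℝ} (hA : IsTimeWidth A) {b : ℝ} (hb : |b| < A) :
    (⟨0, b⟩ : ℂ) ∈ timeMap '' innerStrip := by
  have key : ∀ b : ℝ, 0 ≤ b → b < A → (⟨0, b⟩ : ℂ) ∈ timeMap '' innerStrip := by
    intro b h0 hb
    obtain ⟨ψ, hψ, hψ2⟩ := ((hA.eventually (lt_mem_nhds hb)).and (Ioo_mem_nhdsLT bet_pos)).exists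
    have hc : ContinuousOn (fun θ : ℝ => (timeMap ⟨0, θ⟩).im) (Icc 0 ψ) := fun θ hθ =>
      (hasDerivAt_timeMap_imaginary_im (abs_lt.2 ⟨by linarith [hθ.1, bet_pos],
        by linarith [hθ.2, hψ2.2]⟩)).continuousAt.continuousWithinAt
    obtain ⟨θ, hθ, hθ2⟩ := intermediate_value_Icc hψ2.1.le hc
      ⟨by simpa [timeMap_real_im] using h0, hψ.le⟩
    have hθb : |θ| < bet := abs_lt.2 ⟨by linarith [hθ.1, bet_pos], by linarith [hθ.2, hψ2.2]⟩
    exact ⟨⟨0, θ⟩, mk_mem_innerStrip hθb,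
      Complex.ext (by simpa using timeMap_imaginary_re hθb) hθ2⟩
  rcases le_total 0 b with h | h
  · exact key b h (abs_lt.1 hb).2
  · obtain ⟨y, hy, hy2⟩ := key (-b) (by linarith) (by linarith [(abs_lt.1 hb).1])
    refine ⟨-y, by simpa [innerStrip] using hy, ?_⟩
    rw [timeMap_neg, hy2]
    apply Complex.ext <;> simp

/-- The image of the time map contains the closed strip `|Im t| ≤ A` except for `± i A`. -/
theorem mem_timeMap_image {A : ℝ} (hA : IsTimeWidth A) {w : ℂ} (him : |w.im| ≤ A) (hne : w.re = 0 → |w.im| < A) :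
    w ∈ timeMap '' innerStrip := by
  by_cases hre : w.re = 0
  · have : w = ⟨0, w.im⟩ := Complex.ext hre rfl
    rw [this]
    exact imaginary_mem_timeMap_image hA (hne hre)
  · set V : Set ℂ := (fun b : ℝ => (⟨w.re, b⟩ : ℂ)) '' Icc (-A) A with hV
    have hcont : Continuous fun b : ℝ => (⟨w.re, b⟩ : ℂ) := by
      simp only [Complex.mk_eq_add_mul_I]
      fun_prop
    have hVp : IsPreconnected V := isPreconnected_Icc.image _ hcont.continuousOn
    have hA0 := width_pos hA
    -- The vertical segment is connected, meets the open image at its real point, and contains no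
    -- point of the closure outside the image; hence it lies in the image.
    refine hVp.subset_of_closure_inter_subset (isOpen_timeMap_image) ?_ ?_
      (⟨w.im, abs_le.1 him, rfl⟩ : w ∈ V)
    · exact ⟨(w.re : ℂ), ⟨0, ⟨by linarith, hA0.le⟩, rfl⟩, ofReal_mem_timeMap_image w.re⟩
    · rintro _ ⟨hcl, b, hb, rfl⟩
      obtain ⟨v, hv, hlim⟩ := mem_closure_iff_seq_limit.1 hcl
      choose u hu huv using hv
      exact mem_image_of_tendsto hA hu (by simpa [huv] using hlim) hre (abs_le.2 hb)

/-- The inverse of the time map. -/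
noncomputable def timeInv : ℂ → ℂ := Function.invFunOn timeMap innerStrip

theorem timeInv_timeMap {y : ℂ} (hy : y ∈ innerStrip) : timeInv (timeMap y) = y :=
  injOn_timeMap.leftInvOn_invFunOn hy

theorem hasDerivAt_timeInv {y : ℂ} (hy : y ∈ innerStrip) :
    HasDerivAt timeInv (timeDensity y)⁻¹ (timeMap y) := by
  have hd := (hasDerivAt_timeMap (innerStrip_subset hy)).deriv
  have hne : deriv timeMap y ≠ 0 := by
    intro h
    rw [hd] at h
    have := timeDensity_re_pos (innerStrip_subset hy)
    simp [h] at this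
  rw [← hd]
  exact hasDerivAt_invFunOn isOpen_innerStrip (fun z hz =>
    (hasDerivAt_timeMap (innerStrip_subset hz)).differentiableAt.differentiableWithinAt)
    injOn_timeMap hy hne

theorem differentiableOn_timeInv : DifferentiableOn ℂ timeInv (timeMap '' innerStrip) := by
  rintro _ ⟨y, hy, rfl⟩
  exact (hasDerivAt_timeInv hy).differentiableAt.differentiableWithinAt

theorem timeInv_mem {w : ℂ} (hw : w ∈ timeMap '' innerStrip) : timeInv w ∈ innerStrip :=
  Function.invFunOn_mem hw

/-! ### The width of the strip -/

theorem aPlus_bounds : 0.20710678 < aPlus ∧ aPlus < 0.20710679 := by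
  have h1 : 1.41421356 < Real.sqrt 2 := Real.lt_sqrt_of_sq_lt (by norm_num)
  have h2 : Real.sqrt 2 < 1.41421358 := (Real.sqrt_lt' (by norm_num)).2 (by norm_num)
  constructor <;> (unfold aPlus; linarith)

theorem integrableOn_Ioo_iff_intervalIntegrable {f : ℝ → ℝ} {a b : ℝ} (hab : a ≤ b) :
    MeasureTheory.IntegrableOn f (Ioo a b) ↔
      IntervalIntegrable f MeasureTheory.volume a b := by
  rw [intervalIntegrable_iff_integrableOn_Ioo_of_le hab]

theorem integral_Ioo_eq_interval {f : ℝ → ℝ} {a b : ℝ} (hab : a ≤ b) :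
    ∫ x in Ioo a b, f x = ∫ x in a..b, f x := by
  rw [intervalIntegral.integral_of_le hab, MeasureTheory.integral_Ioc_eq_integral_Ioo]

/-- The integrand of the width after the substitution `x = a₊ sin² φ`. -/
noncomputable def widthKernel (x : ℝ) : ℝ := 1 / ((1 - x) * Real.sqrt (3 * (1 + x) * (x - aMinus)))

theorem sinSq_image : (fun φ => aPlus * Real.sin φ ^ 2) '' Ioo 0 (Real.pi / 2) = Ioo 0 aPlus := by
  have ha := aPlus_bounds
  ext x
  constructor
  · rintro ⟨φ, hφ, rfl⟩
    have h1 : 0 < Real.sin φ := Real.sin_pos_of_pos_of_lt_pi hφ.1 (by linarith [hφ.2, Real.pi_pos])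
    have h2 : 0 < Real.cos φ := Real.cos_pos_of_mem_Ioo ⟨by linarith [hφ.1, Real.pi_pos], hφ.2⟩
    have h3 := Real.sin_sq_add_cos_sq φ
    simp only
    constructor <;> nlinarith [mul_pos h2 h2, mul_pos h1 h1]
  · intro hx
    have hpos : 0 < aPlus := by linarith
    have h0 : 0 < x / aPlus := div_pos hx.1 hpos
    have h1 : x / aPlus < 1 := (div_lt_one hpos).2 hx.2
    have h2 : Real.sqrt (x / aPlus) < 1 := by
      rw [Real.sqrt_lt' one_pos]
      simpa using h1
    refine ⟨Real.arcsin (Real.sqrt (x / aPlus)), ⟨Real.arcsin_pos.2 (Real.sqrt_pos.2 h0),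
      Real.arcsin_lt_pi_div_two.2 h2⟩, ?_⟩
    simp only
    rw [Real.sin_arcsin (by linarith [Real.sqrt_nonneg (x / aPlus)]) h2.le, Real.sq_sqrt h0.le]
    field_simp

/-- With a₊ − x = a₊ cos²φ the Jacobian cancels the inverse square-root singularity at a₊. The
resulting continuous integrand yields both convergence and the numerical value. -/
theorem widthIntegrand_sinSq {φ : ℝ} (hφ : φ ∈ Ioo 0 (Real.pi / 2)) :
    |aPlus * (2 * Real.sin φ * Real.cos φ)| • widthIntegrand (aPlus * Real.sin φ ^ 2) =
      2 * aPlus * Real.sin φ ^ 2 * widthKernel (aPlus * Real.sin φ ^ 2) := by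
  have ha := aPlus_bounds
  have hs2 := sqrt_two_bounds
  have h1 : 0 < Real.sin φ := Real.sin_pos_of_pos_of_lt_pi hφ.1 (by linarith [hφ.2, Real.pi_pos])
  have h2 : 0 < Real.cos φ := Real.cos_pos_of_mem_Ioo ⟨by linarith [hφ.1, Real.pi_pos], hφ.2⟩
  have h3 := Real.sin_sq_add_cos_sq φ
  have hpos : 0 < aPlus := by linarith
  set x := aPlus * Real.sin φ ^ 2 with hx
  have hx0 : 0 < x := by positivity
  have hxm : 0 < x - aMinus := by unfold aMinus; linarith
  have hap : aPlus - x = aPlus * Real.cos φ ^ 2 := by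
    rw [hx, show Real.cos φ ^ 2 = 1 - Real.sin φ ^ 2 by linarith]
    ring
  have hq : x / (3 * (x + 1) * (aPlus - x) * (x - aMinus)) =
      (Real.sin φ / Real.cos φ) ^ 2 / (3 * (1 + x) * (x - aMinus)) := by
    rw [hap]
    nth_rewrite 1 [hx]
    field_simp
    ring
  rw [widthIntegrand, hq, Real.sqrt_div (sq_nonneg _), Real.sqrt_sq (by positivity), widthKernel,
    abs_of_pos (by positivity), smul_eq_mul]
  have hx1 : 0 < 1 - x := by
    have : x < 1 := by nlinarith [mul_pos h2 h2]
    linarith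
  have : 0 < Real.sqrt (3 * (1 + x) * (x - aMinus)) := Real.sqrt_pos.2 (by positivity)
  field_simp

theorem continuousOn_widthKernel : ContinuousOn widthKernel (Icc 0 aPlus) := by
  have ha := aPlus_bounds
  have hs2 := sqrt_two_bounds
  unfold widthKernel
  refine ContinuousOn.div continuousOn_const (by fun_prop) fun x hx => ?_
  have hxm : 0 < x - aMinus := by unfold aMinus; linarith [hx.1]
  have h1 : 0 < 1 - x := by linarith [hx.2]
  have h2 : 0 < 1 + x := by linarith [hx.1]
  have : 0 < Real.sqrt (3 * (1 + x) * (x - aMinus)) := Real.sqrt_pos.2 (by positivity)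
  positivity

theorem sinSq_mem (φ : ℝ) : aPlus * Real.sin φ ^ 2 ∈ Icc 0 aPlus := by
  have hpos : 0 < aPlus := by linarith [aPlus_bounds.1]
  have := Real.sin_sq_le_one φ
  exact ⟨by positivity, by nlinarith⟩

theorem continuous_widthKernel_sinSq : Continuous fun φ : ℝ =>
    2 * aPlus * Real.sin φ ^ 2 * widthKernel (aPlus * Real.sin φ ^ 2) :=
  Continuous.mul (by fun_prop)
    (continuousOn_widthKernel.comp_continuous (by fun_prop) fun φ => sinSq_mem φ)

theorem hasDerivAt_sinSq (φ : ℝ) : HasDerivAt (fun φ => aPlus * Real.sin φ ^ 2)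
    (aPlus * (2 * Real.sin φ * Real.cos φ)) φ := by
  simpa using ((Real.hasDerivAt_sin φ).pow 2).const_mul aPlus

theorem injOn_sinSq : InjOn (fun φ => aPlus * Real.sin φ ^ 2) (Ioo 0 (Real.pi / 2)) := by
  intro a ha b hb hab
  have hpos : 0 < aPlus := by linarith [aPlus_bounds.1]
  have h1 : Real.sin a ^ 2 = Real.sin b ^ 2 := mul_left_cancel₀ hpos.ne' hab
  have h2 : 0 < Real.sin a := Real.sin_pos_of_pos_of_lt_pi ha.1 (by linarith [ha.2, Real.pi_pos])
  have h3 : 0 < Real.sin b := Real.sin_pos_of_pos_of_lt_pi hb.1 (by linarith [hb.2, Real.pi_pos])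
  exact Real.injOn_sin ⟨by linarith [ha.1, Real.pi_pos], ha.2.le⟩
    ⟨by linarith [hb.1, Real.pi_pos], hb.2.le⟩ ((sq_eq_sq₀ h2.le h3.le).1 h1)

theorem intervalIntegrable_widthIntegrand :
    IntervalIntegrable widthIntegrand MeasureTheory.volume 0 aPlus := by
  have hpos : 0 < aPlus := by linarith [aPlus_bounds.1]
  rw [← integrableOn_Ioo_iff_intervalIntegrable hpos.le, ← sinSq_image,
    MeasureTheory.integrableOn_image_iff_integrableOn_abs_deriv_smul measurableSet_Ioo
      (fun φ _ => (hasDerivAt_sinSq φ).hasDerivWithinAt) injOn_sinSq,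
    MeasureTheory.integrableOn_congr_fun (fun φ hφ => widthIntegrand_sinSq hφ) measurableSet_Ioo,
    integrableOn_Ioo_iff_intervalIntegrable (by linarith [Real.pi_pos])]
  exact continuous_widthKernel_sinSq.intervalIntegrable _ _

theorem stripWidth_eq_sinSq : stripWidth = ∫ φ in (0 : ℝ)..Real.pi / 2,
    2 * aPlus * Real.sin φ ^ 2 * widthKernel (aPlus * Real.sin φ ^ 2) := by
  have hpos : 0 < aPlus := by linarith [aPlus_bounds.1]
  rw [stripWidth, ← integral_Ioo_eq_interval hpos.le, ← sinSq_image,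
    MeasureTheory.integral_image_eq_integral_abs_deriv_smul measurableSet_Ioo
      (fun φ _ => (hasDerivAt_sinSq φ).hasDerivWithinAt) injOn_sinSq,
    MeasureTheory.setIntegral_congr_fun measurableSet_Ioo (fun φ hφ => widthIntegrand_sinSq hφ),
    integral_Ioo_eq_interval (by linarith [Real.pi_pos])]

/-! ### Numerical evaluation -/

/-- A polynomial approximation of `widthKernel` on `[0, a₊]`. -/
noncomputable def kernelApprox (x : ℝ) : ℝ :=
  0.525492573 + 0.045075786 * x + 0.486335921 * x ^ 2 + 0.077484189 * x ^ 3 +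
    0.473570494 * x ^ 4 + 0.01404752 * x ^ 5 + 0.673309084 * x ^ 6

/-- Clearing the denominator and squaring turns the lower bound on `widthKernel` into a polynomial
inequality; 1.2071067812 is −a₋ rounded up, which is the safe side. -/
theorem kernelApprox_lower {x : ℝ} (h0 : 0 ≤ x) (h1 : x ≤ 0.20711) :
    3 * (1 + x) * (x + 1.2071067812) * ((1 - x) * (kernelApprox x - 3 * 10⁻¹ ^ 7)) ^ 2 ≤ 1 := by
  -- Recentring at the midpoint of the interval makes the bounds |z|^k ≤ 0.10356^k tight enough for
  -- the expanded inequality to be settled linearly in the powers of z.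
  obtain ⟨z, rfl⟩ : ∃ z, x = z + 0.10355 := ⟨x - 0.10355, by ring⟩
  have hz : |z| ≤ 0.10356 := abs_le.2 ⟨by linarith, by linarith⟩
  have hp : ∀ k : ℕ, -(0.10356 : ℝ) ^ k ≤ z ^ k ∧ z ^ k ≤ 0.10356 ^ k := fun k => by
    rw [← abs_le, abs_pow]
    exact pow_le_pow_left₀ (abs_nonneg z) hz k
  unfold kernelApprox
  linarith [(hp 1).1, (hp 2).1, (hp 3).1, (hp 4).1, (hp 5).1, (hp 6).1, (hp 7).1, (hp 8).1,
    (hp 9).1, (hp 10).1, (hp 11).1, (hp 12).1, (hp 13).1, (hp 14).1, (hp 15).1, (hp 16).1,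
    (hp 17).1, (hp 18).1, (hp 1).2, (hp 2).2, (hp 3).2, (hp 4).2, (hp 5).2, (hp 6).2, (hp 7).2,
    (hp 8).2, (hp 9).2, (hp 10).2, (hp 11).2, (hp 12).2, (hp 13).2, (hp 14).2, (hp 15).2,
    (hp 16).2, (hp 17).2, (hp 18).2]

/-- Counterpart for the upper bound on the kernel, with −a₋ rounded down. -/
theorem kernelApprox_upper {x : ℝ} (h0 : 0 ≤ x) (h1 : x ≤ 0.20711) :
    1 ≤ 3 * (1 + x) * (x + 1.2071067811) * ((1 - x) * (kernelApprox x + 3 * 10⁻¹ ^ 7)) ^ 2 := by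
  obtain ⟨z, rfl⟩ : ∃ z, x = z + 0.10355 := ⟨x - 0.10355, by ring⟩
  have hz : |z| ≤ 0.10356 := abs_le.2 ⟨by linarith, by linarith⟩
  have hp : ∀ k : ℕ, -(0.10356 : ℝ) ^ k ≤ z ^ k ∧ z ^ k ≤ 0.10356 ^ k := fun k => by
    rw [← abs_le, abs_pow]
    exact pow_le_pow_left₀ (abs_nonneg z) hz k
  unfold kernelApprox
  linarith [(hp 1).1, (hp 2).1, (hp 3).1, (hp 4).1, (hp 5).1, (hp 6).1, (hp 7).1, (hp 8).1,
    (hp 9).1, (hp 10).1, (hp 11).1, (hp 12).1, (hp 13).1, (hp 14).1, (hp 15).1, (hp 16).1,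
    (hp 17).1, (hp 18).1, (hp 1).2, (hp 2).2, (hp 3).2, (hp 4).2, (hp 5).2, (hp 6).2, (hp 7).2,
    (hp 8).2, (hp 9).2, (hp 10).2, (hp 11).2, (hp 12).2, (hp 13).2, (hp 14).2, (hp 15).2,
    (hp 16).2, (hp 17).2, (hp 18).2]

theorem widthKernel_approx {x : ℝ} (hx : x ∈ Icc 0 aPlus) :
    |widthKernel x - kernelApprox x| ≤ 3 * 10⁻¹ ^ 7 := by
  have ha := aPlus_bounds
  have hm : 1.2071067811 ≤ -aMinus ∧ -aMinus ≤ 1.2071067812 := by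
    have h1 : 1.4142135623 < Real.sqrt 2 := Real.lt_sqrt_of_sq_lt (by norm_num)
    have h2 : Real.sqrt 2 < 1.4142135624 := (Real.sqrt_lt' (by norm_num)).2 (by norm_num)
    constructor <;> (unfold aMinus; linarith)
  have h0 := hx.1
  have h1 : x ≤ 0.20711 := by linarith [hx.2]
  have hP : 0.5 ≤ kernelApprox x := by
    unfold kernelApprox
    have : 0 ≤ 0.045075786 * x + 0.486335921 * x ^ 2 + 0.077484189 * x ^ 3 +
      0.473570494 * x ^ 4 + 0.01404752 * x ^ 5 + 0.673309084 * x ^ 6 := by positivity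
    linarith
  have hlow := kernelApprox_lower h0 h1
  have hup := kernelApprox_upper h0 h1
  set Q := 3 * (1 + x) * (x - aMinus) with hQ
  have hQ0 : 0 < Q := by
    have : 0 < x - aMinus := by linarith
    positivity
  have hx1 : 0 < 1 - x := by linarith
  have hlow' : Q * ((1 - x) * (kernelApprox x - 3 * 10⁻¹ ^ 7)) ^ 2 ≤ 1 := by
    refine le_trans (mul_le_mul_of_nonneg_right ?_ (sq_nonneg _)) hlow
    exact mul_le_mul_of_nonneg_left (by linarith) (by positivity)
  have hup' : 1 ≤ Q * ((1 - x) * (kernelApprox x + 3 * 10⁻¹ ^ 7)) ^ 2 := by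
    refine le_trans hup (mul_le_mul_of_nonneg_right ?_ (sq_nonneg _))
    exact mul_le_mul_of_nonneg_left (by linarith) (by positivity)
  have hs := Real.sqrt_pos.2 hQ0
  have hss := Real.sq_sqrt hQ0.le
  rw [← hss, ← mul_pow] at hlow' hup'
  have e1 := (sq_le_one_iff_abs_le_one _).1 hlow'
  have e2 : 1 ≤ Real.sqrt Q * ((1 - x) * (kernelApprox x + 3 * 10⁻¹ ^ 7)) := by
    have hpos : 0 ≤ Real.sqrt Q * ((1 - x) * (kernelApprox x + 3 * 10⁻¹ ^ 7)) := by
      have : 0 ≤ kernelApprox x := by linarith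
      positivity
    exact (one_le_sq_iff₀ hpos).1 hup'
  have e3 := (abs_le.1 e1).2
  have hden : 0 < (1 - x) * Real.sqrt Q := mul_pos hx1 hs
  rw [widthKernel, abs_le]
  constructor
  · have : kernelApprox x - 3 * 10⁻¹ ^ 7 ≤ 1 / ((1 - x) * Real.sqrt Q) := by
      rw [le_div_iff₀ hden]
      linarith
    linarith
  · have : 1 / ((1 - x) * Real.sqrt Q) ≤ kernelApprox x + 3 * 10⁻¹ ^ 7 := by
      rw [div_le_iff₀ hden]
      linarith
    linarith

theorem integral_sin_pow_succ (n : ℕ) : ∫ φ in (0 : ℝ)..Real.pi / 2, Real.sin φ ^ (n + 2) =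
    (n + 1) / (n + 2) * ∫ φ in (0 : ℝ)..Real.pi / 2, Real.sin φ ^ n := by
  rw [integral_sin_pow]
  simp

theorem abs_stripWidth_sub_lt : |stripWidth - 0.177744| < 5 * 10 ^ (-7 : ℤ) := by
  obtain ⟨ha1, ha2⟩ := aPlus_bounds
  have hpi := Real.pi_pos
  have hpos : 0 < aPlus := by linarith
  set I : ℕ → ℝ := fun n => ∫ φ in (0 : ℝ)..Real.pi / 2, Real.sin φ ^ n with hI
  have hI0 : I 0 = Real.pi / 2 := by simp [hI]
  have hIs : ∀ n : ℕ, I (n + 2) = (n + 1) / (n + 2) * I n := integral_sin_pow_succ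
  have hI2 : I 2 = 1 / 2 * I 0 := by rw [hIs 0]; norm_num
  have hI4 : I 4 = 3 / 4 * I 2 := by rw [hIs 2]; norm_num
  have hI6 : I 6 = 5 / 6 * I 4 := by rw [hIs 4]; norm_num
  have hI8 : I 8 = 7 / 8 * I 6 := by rw [hIs 6]; norm_num
  have hI10 : I 10 = 9 / 10 * I 8 := by rw [hIs 8]; norm_num
  have hI12 : I 12 = 11 / 12 * I 10 := by rw [hIs 10]; norm_num
  have hI14 : I 14 = 13 / 14 * I 12 := by rw [hIs 12]; norm_num
  have hint : ∀ n : ℕ, ∀ c : ℝ, IntervalIntegrable (fun φ => c * Real.sin φ ^ n)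
      MeasureTheory.volume 0 (Real.pi / 2) := fun n c =>
    Continuous.intervalIntegrable (by fun_prop) _ _
  have hmain : ∫ φ in (0 : ℝ)..Real.pi / 2,
      2 * aPlus * Real.sin φ ^ 2 * kernelApprox (aPlus * Real.sin φ ^ 2) =
      2 * aPlus * (0.525492573 * I 2 + 0.045075786 * aPlus * I 4 + 0.486335921 * aPlus ^ 2 * I 6 +
      0.077484189 * aPlus ^ 3 * I 8 + 0.473570494 * aPlus ^ 4 * I 10 +
      0.01404752 * aPlus ^ 5 * I 12 + 0.673309084 * aPlus ^ 6 * I 14) := by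
    have he : ∀ φ : ℝ, 2 * aPlus * Real.sin φ ^ 2 * kernelApprox (aPlus * Real.sin φ ^ 2) =
        (2 * aPlus * 0.525492573) * Real.sin φ ^ 2 +
        (2 * aPlus * (0.045075786 * aPlus)) * Real.sin φ ^ 4 +
        (2 * aPlus * (0.486335921 * aPlus ^ 2)) * Real.sin φ ^ 6 +
        (2 * aPlus * (0.077484189 * aPlus ^ 3)) * Real.sin φ ^ 8 +
        (2 * aPlus * (0.473570494 * aPlus ^ 4)) * Real.sin φ ^ 10 +
        (2 * aPlus * (0.01404752 * aPlus ^ 5)) * Real.sin φ ^ 12 +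
        (2 * aPlus * (0.673309084 * aPlus ^ 6)) * Real.sin φ ^ 14 := by
      intro φ
      unfold kernelApprox
      ring
    simp only [he]
    rw [intervalIntegral.integral_add, intervalIntegral.integral_add,
      intervalIntegral.integral_add, intervalIntegral.integral_add,
      intervalIntegral.integral_add, intervalIntegral.integral_add]
    · simp only [intervalIntegral.integral_const_mul]
      ring
    all_goals exact Continuous.intervalIntegrable (by fun_prop) _ _
  -- The kernel error 3·10⁻⁷ contributes at most 2a₊ · 3·10⁻⁷ · π/4 < 10⁻⁷ to the width.
  have hdiff : |stripWidth - ∫ φ in (0 : ℝ)..Real.pi / 2,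
      2 * aPlus * Real.sin φ ^ 2 * kernelApprox (aPlus * Real.sin φ ^ 2)| ≤
      2 * aPlus * (3 * 10⁻¹ ^ 7) * I 2 := by
    have hk : Continuous fun φ => 2 * aPlus * Real.sin φ ^ 2 *
        kernelApprox (aPlus * Real.sin φ ^ 2) := by
      unfold kernelApprox
      fun_prop
    rw [stripWidth_eq_sinSq, ← intervalIntegral.integral_sub
      (continuous_widthKernel_sinSq.intervalIntegrable _ _) (hk.intervalIntegrable _ _),
      ← intervalIntegral.integral_const_mul]
    refine (intervalIntegral.abs_integral_le_integral_abs (by linarith)).trans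
      (intervalIntegral.integral_mono_on (by linarith) ?_ ?_ fun φ _ => ?_)
    · exact (continuous_widthKernel_sinSq.sub hk).abs.intervalIntegrable _ _
    · exact hint 2 _
    · rw [← mul_sub, abs_mul, abs_of_nonneg (by positivity : 0 ≤ 2 * aPlus * Real.sin φ ^ 2)]
      have := widthKernel_approx (sinSq_mem φ)
      have h3 : 0 ≤ 2 * aPlus * Real.sin φ ^ 2 := by positivity
      nlinarith
  rw [hmain, hI14, hI12, hI10, hI8, hI6, hI4, hI2, hI0] at hdiff
  have hpw : ∀ k : ℕ, (0.20710678 : ℝ) ^ k ≤ aPlus ^ k ∧ aPlus ^ k ≤ 0.20710679 ^ k := fun k =>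
    ⟨pow_le_pow_left₀ (by norm_num) ha1.le k, pow_le_pow_left₀ hpos.le ha2.le k⟩
  -- The fractions are the Wallis ratios of the integrals of sin^{2k} to π/2, so the approximating
  -- integral equals πY/2.
  set Y := 2 * (0.525492573 * (1 / 2) * aPlus ^ 1 + 0.045075786 * (3 / 8) * aPlus ^ 2 +
    0.486335921 * (15 / 48) * aPlus ^ 3 + 0.077484189 * (105 / 384) * aPlus ^ 4 +
    0.473570494 * (945 / 3840) * aPlus ^ 5 + 0.01404752 * (10395 / 46080) * aPlus ^ 6 +
    0.673309084 * (135135 / 645120) * aPlus ^ 7) with hY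
  have hY1 : 0.11315525 < Y ∧ Y < 0.11315529 := by
    constructor <;> linarith [(hpw 1).1, (hpw 2).1, (hpw 3).1, (hpw 4).1, (hpw 5).1, (hpw 6).1,
      (hpw 7).1, (hpw 1).2, (hpw 2).2, (hpw 3).2, (hpw 4).2, (hpw 5).2, (hpw 6).2, (hpw 7).2]
  have hp1 := Real.pi_gt_d20
  have hp2 := Real.pi_lt_d20
  have hYpi : 0.11315525 * 3.14159265 < Y * Real.pi ∧ Y * Real.pi < 0.11315529 * 3.14159266 :=
    ⟨mul_lt_mul'' hY1.1 (by linarith) (by norm_num) (by norm_num),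
      mul_lt_mul'' hY1.2 (by linarith) (by linarith [hY1.1]) hpi.le⟩
  have hapi : aPlus * Real.pi < 0.20710679 * 3.14159266 :=
    mul_lt_mul'' ha2 (by linarith) hpos.le hpi.le
  have hrew : ∀ w : ℝ, |stripWidth - w| ≤ 2 * aPlus * (3 * 10⁻¹ ^ 7) * (1 / 2 * (Real.pi / 2)) →
      w = Y * Real.pi / 2 → |stripWidth - 0.177744| < 5 * 10 ^ (-7 : ℤ) := by
    rintro w hw rfl
    obtain ⟨h1, h2⟩ := abs_le.1 hw
    rw [abs_lt]
    constructor <;> linarith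
  exact hrew _ hdiff (by rw [hY]; ring)

/-! ### The width as the value of the time map at the corner -/

/-- The time density on the imaginary axis. -/
noncomputable def imagDensity (s : ℝ) : ℝ :=
  Real.sqrt (2 / 21 * ((Real.cos s - kap) * (Real.cos s + 1) /
    ((Real.cos s + poleM) * (Real.cos s + poleN))))

theorem cos_sub_kap_nonneg {s : ℝ} (hs : s ∈ Icc 0 bet) : 0 ≤ Real.cos s - kap := by
  rw [← cos_bet, sub_nonneg]
  exact Real.cos_le_cos_of_nonneg_of_le_pi hs.1 (by linarith [bet_lt, Real.pi_pos]) hs.2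

theorem timeDensity_imaginary {s : ℝ} (hs : s ∈ Icc 0 bet) :
    timeDensity ⟨0, s⟩ = (imagDensity s : ℂ) := by
  have h1 := cos_sub_kap_nonneg hs
  have h2 := kap_bounds.1
  have h3 := poleM_bounds.1
  have h4 := poleN_bounds.1
  have hc : Complex.cosh ⟨0, s⟩ = (Real.cos s : ℂ) := by
    apply Complex.ext
    · rw [Complex.cosh_re_eq, Complex.ofReal_re]; simp
    · rw [Complex.cosh_im_eq]; simp
  rw [timeDensity, imagDensity, ← Complex.sqrt_ofReal_of_nonneg, hc, densitySq]
  · push_cast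
    rfl
  · have : 0 < Real.cos s + 1 := by linarith
    have : 0 < Real.cos s + poleM := by linarith
    have : 0 < Real.cos s + poleN := by linarith
    positivity

theorem continuousOn_imagDensity : ContinuousOn imagDensity (Icc 0 bet) := by
  unfold imagDensity
  refine (ContinuousOn.mul continuousOn_const (ContinuousOn.div (by fun_prop) (by fun_prop)
    fun s hs => ?_)).sqrt
  have h1 := cos_sub_kap_nonneg hs
  have h2 := kap_bounds.1
  have h3 := poleM_bounds.1
  have h4 := poleN_bounds.1
  have : 0 < Real.cos s + poleM := by linarith
  have : 0 < Real.cos s + poleN := by linarith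
  positivity

theorem timeMap_imaginary_im_eq {θ : ℝ} (h0 : 0 ≤ θ) (h1 : θ < bet) :
    (timeMap ⟨0, θ⟩).im = ∫ s in (0 : ℝ)..θ, imagDensity s := by
  have hsub : uIcc 0 θ ⊆ Icc 0 bet := by
    rw [uIcc_of_le h0]
    exact Icc_subset_Icc_right h1.le
  have := intervalIntegral.integral_eq_sub_of_hasDerivAt (a := 0) (b := θ)
    (f := fun θ : ℝ => (timeMap ⟨0, θ⟩).im) (f' := imagDensity) (fun s hs => by
      rw [uIcc_of_le h0] at hs
      have hsb : |s| < bet := abs_lt.2 ⟨by linarith [hs.1, bet_pos], by linarith [hs.2]⟩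
      have := hasDerivAt_timeMap_imaginary_im hsb
      rwa [timeDensity_imaginary ⟨hs.1, by linarith [hs.2]⟩, Complex.ofReal_re] at this)
    (continuousOn_imagDensity.mono hsub).intervalIntegrable
  rw [this]
  simp [timeMap_real_im]

theorem isTimeWidth_integral : IsTimeWidth (∫ s in (0 : ℝ)..bet, imagDensity s) := by
  have hint : MeasureTheory.IntegrableOn imagDensity (Icc 0 bet) :=
    continuousOn_imagDensity.integrableOn_Icc
  have hc := (intervalIntegral.continuousOn_primitive_interval (a := 0) (b := bet)
    (by rwa [uIcc_of_le bet_pos.le])) bet (by rw [uIcc_of_le bet_pos.le]; exact ⟨bet_pos.le, le_rfl⟩)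
  rw [uIcc_of_le bet_pos.le] at hc
  have h2 : Tendsto (fun θ => ∫ s in (0 : ℝ)..θ, imagDensity s) (𝓝[<] bet)
      (𝓝 (∫ s in (0 : ℝ)..bet, imagDensity s)) := by
    refine hc.tendsto.mono_left (nhdsWithin_le_iff.2 ?_)
    exact mem_of_superset (Ioo_mem_nhdsLT bet_pos) Ioo_subset_Icc_self
  refine h2.congr' ?_
  filter_upwards [Ioo_mem_nhdsLT bet_pos] with θ hθ
  exact (timeMap_imaginary_im_eq hθ.1.le hθ.2).symm

/-- `cos (l / 2)` as a function of `θ` on the imaginary axis `y = i θ`. -/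
noncomputable def imagCos (s : ℝ) : ℝ := (Real.cos s - kap) / (Real.cos s + 1)

theorem hasDerivAt_imagCos {s : ℝ} (hs : Real.cos s + 1 ≠ 0) :
    HasDerivAt imagCos (-(Real.sin s * (1 + kap) / (Real.cos s + 1) ^ 2)) s := by
  refine (((Real.hasDerivAt_cos s).sub_const kap).div
    ((Real.hasDerivAt_cos s).add_const 1) hs).congr_deriv ?_
  field_simp
  ring

theorem imagCos_image : imagCos '' Ioo 0 bet = Ioo 0 aPlus := by
  have ha := aPlus_bounds
  have hk := kap_bounds
  have hak : aPlus + kap = 1 - aPlus := by unfold aPlus kap; ring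
  ext x
  constructor
  · rintro ⟨s, hs, rfl⟩
    have h1 : kap < Real.cos s := kap_lt_cos (abs_lt.2 ⟨by linarith [hs.1, bet_pos], hs.2⟩)
    have h2 : Real.cos s < 1 := by
      rw [← Real.cos_zero]
      exact Real.cos_lt_cos_of_nonneg_of_le_pi le_rfl (by linarith [bet_lt, Real.pi_pos, hs.2]) hs.1
    have h3 : 0 < Real.cos s + 1 := by linarith
    refine ⟨div_pos (by linarith) h3, ?_⟩
    rw [imagCos, div_lt_iff₀ h3]
    nlinarith
  · intro hx
    have hx1 : 0 < 1 - x := by linarith [hx.2]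
    set w := (kap + x) / (1 - x) with hw
    have h1 : kap < w := by
      rw [hw, lt_div_iff₀ hx1]
      nlinarith [hx.1]
    have h2 : w < 1 := by
      rw [hw, div_lt_one hx1]
      linarith [hx.2]
    refine ⟨Real.arccos w, ⟨Real.arccos_pos.2 h2, ?_⟩, ?_⟩
    · exact Real.arccos_lt_arccos (by linarith) h1 h2.le
    · rw [imagCos, Real.cos_arccos (by linarith) h2.le, hw]
      have : 1 + kap ≠ 0 := by linarith
      field_simp
      ring_nf
      field_simp
      ring

/-- On y = is the variable x of the width integral is c = cos(λ/2). Each linear factor of the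
radicand becomes a Möbius factor in C = cos s, and the factor 1 − C coming from a₊ − x cancels
against sin² s. -/
theorem widthIntegrand_imagCos {s : ℝ} (hs : s ∈ Ioo 0 bet) :
    |-(Real.sin s * (1 + kap) / (Real.cos s + 1) ^ 2)| • widthIntegrand (imagCos s) =
      imagDensity s := by
  have hk := kap_bounds
  have hm := poleM_bounds
  have hn := poleN_bounds
  have h1 : kap < Real.cos s := kap_lt_cos (abs_lt.2 ⟨by linarith [hs.1, bet_pos], hs.2⟩)
  have h2 : Real.cos s < 1 := by
    rw [← Real.cos_zero]
    exact Real.cos_lt_cos_of_nonneg_of_le_pi le_rfl (by linarith [bet_lt, Real.pi_pos, hs.2]) hs.1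
  have hsin : 0 < Real.sin s :=
    Real.sin_pos_of_pos_of_lt_pi hs.1 (by linarith [bet_lt, Real.pi_pos, hs.2])
  have hsq := Real.sin_sq_add_cos_sq s
  set C := Real.cos s with hC
  have hC1 : 0 < C + 1 := by linarith
  have hCm : 0 < C + poleM := by linarith
  have hCn : 0 < C + poleN := by linarith
  have h1C : 0 < 1 - C := by linarith
  have e1 : 1 - imagCos s = (1 + kap) / (C + 1) := by
    rw [imagCos, ← hC]
    field_simp
    ring
  have s2 : Real.sqrt 2 * Real.sqrt 2 = 2 := Real.mul_self_sqrt (by norm_num)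
  have e2 : imagCos s + 1 = 2 * (C + poleM) / (C + 1) := by
    rw [imagCos, ← hC]
    field_simp
    unfold kap poleM
    ring
  have e3 : aPlus - imagCos s = (3 - Real.sqrt 2) / 2 * (1 - C) / (C + 1) := by
    rw [imagCos, ← hC]
    field_simp
    unfold kap aPlus
    ring
  have e4 : imagCos s - aMinus = (3 + Real.sqrt 2) / 2 * (C + poleN) / (C + 1) := by
    rw [imagCos, ← hC]
    field_simp
    unfold kap aMinus poleN
    linear_combination (-12 / 7 : ℝ) * s2
  have e5 : imagCos s / (3 * (imagCos s + 1) * (aPlus - imagCos s) * (imagCos s - aMinus)) =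
      2 / 21 * ((C - kap) * (C + 1) ^ 2 / ((1 - C) * (C + poleM) * (C + poleN))) := by
    rw [e2, e3, e4, imagCos, ← hC]
    -- This product, together with the factor 3 of the radicand, produces the constant 2/21 of the
    -- density.
    have h7 : (3 - Real.sqrt 2) * (3 + Real.sqrt 2) = 7 := by linear_combination -s2
    have h8 : 3 * (2 * (C + poleM) / (C + 1)) * ((3 - Real.sqrt 2) / 2 * (1 - C) / (C + 1)) *
        ((3 + Real.sqrt 2) / 2 * (C + poleN) / (C + 1)) =
        21 / 2 * ((1 - C) * (C + poleM) * (C + poleN)) / (C + 1) ^ 3 := by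
      field_simp
      linear_combination 3 * h7
    rw [h8]
    field_simp
  have hk1 : 0 < 1 + kap := by linarith
  rw [widthIntegrand, e5, e1, abs_neg, abs_of_pos (by positivity), smul_eq_mul, imagDensity, ← hC]
  have e6 : Real.sin s * (1 + kap) / (C + 1) ^ 2 * (1 / ((1 + kap) / (C + 1)) *
      Real.sqrt (2 / 21 * ((C - kap) * (C + 1) ^ 2 / ((1 - C) * (C + poleM) * (C + poleN))))) =
      Real.sin s / (C + 1) *
      Real.sqrt (2 / 21 * ((C - kap) * (C + 1) ^ 2 / ((1 - C) * (C + poleM) * (C + poleN)))) := by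
    field_simp
  rw [e6, ← Real.sqrt_sq (by positivity : 0 ≤ Real.sin s / (C + 1)), ← Real.sqrt_mul (sq_nonneg _)]
  congr 1
  have : Real.sin s ^ 2 = (1 - C) * (1 + C) := by linarith
  rw [div_pow, this]
  field_simp
  ring

theorem injOn_imagCos : InjOn imagCos (Ioo 0 bet) := by
  intro a ha b hb hab
  have hk := kap_bounds
  have key : ∀ s ∈ Ioo 0 bet, 0 < Real.cos s + 1 := fun s hs => by
    have : kap < Real.cos s := kap_lt_cos (abs_lt.2 ⟨by linarith [hs.1, bet_pos], hs.2⟩)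
    linarith
  have h1 := key a ha
  have h2 := key b hb
  rw [imagCos, imagCos, div_eq_div_iff h1.ne' h2.ne'] at hab
  have h3 : Real.cos a = Real.cos b := by
    have : (1 + kap) * (Real.cos a - Real.cos b) = 0 := by linear_combination hab
    rcases mul_eq_zero.1 this with h | h <;> linarith
  have hpi := Real.pi_pos
  exact Real.injOn_cos ⟨ha.1.le, by linarith [ha.2, bet_lt]⟩ ⟨hb.1.le, by linarith [hb.2, bet_lt]⟩ h3

theorem isTimeWidth_stripWidth : IsTimeWidth stripWidth := by
  have hpos : 0 < aPlus := by linarith [aPlus_bounds.1]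
  have hd : ∀ s ∈ Ioo 0 bet, HasDerivWithinAt imagCos
      (-(Real.sin s * (1 + kap) / (Real.cos s + 1) ^ 2)) (Ioo 0 bet) s := fun s hs => by
    have : kap < Real.cos s := kap_lt_cos (abs_lt.2 ⟨by linarith [hs.1, bet_pos], hs.2⟩)
    have hk := kap_bounds
    exact (hasDerivAt_imagCos (by linarith)).hasDerivWithinAt
  have : stripWidth = ∫ s in (0 : ℝ)..bet, imagDensity s := by
    rw [stripWidth, ← integral_Ioo_eq_interval hpos.le, ← imagCos_image,
      MeasureTheory.integral_image_eq_integral_abs_deriv_smul measurableSet_Ioo hd injOn_imagCos,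
      MeasureTheory.setIntegral_congr_fun measurableSet_Ioo
        (fun s hs => widthIntegrand_imagCos hs), integral_Ioo_eq_interval bet_pos.le]
  rw [this]
  exact isTimeWidth_integral

/-! ### The separatrix on the real line -/

theorem two_add_two_cos (l : ℝ) : 2 + 2 * Real.cos l = (2 * Real.cos (l / 2)) ^ 2 := by
  have h := Real.cos_two_mul (l / 2)
  rw [mul_div_cancel₀ l (two_ne_zero)] at h
  rw [h]
  ring

theorem sin_eq_half (l : ℝ) : Real.sin l = 2 * Real.sin (l / 2) * Real.cos (l / 2) := by
  have h := Real.sin_two_mul (l / 2)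
  rwa [mul_div_cancel₀ l (two_ne_zero)] at h

theorem sqrt_two_add_two_cos {l : ℝ} (hc : 0 < Real.cos (l / 2)) :
    Real.sqrt (2 + 2 * Real.cos l) = 2 * Real.cos (l / 2) := by
  rw [two_add_two_cos, Real.sqrt_sq (by positivity)]

theorem hasDerivAt_pendH_momentum (l L : ℝ) : HasDerivAt (fun y => pendH l y) (-3 * L) L := by
  unfold pendH
  refine (((hasDerivAt_pow 2 L).const_mul (-(3 / 2) : ℝ)).add_const (pendV l)).congr_deriv ?_
  norm_num
  ring

theorem hasDerivAt_pendH_angle {l : ℝ} (L : ℝ) (hc : 0 < Real.cos (l / 2)) :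
    HasDerivAt (fun x => pendH x L) (2 * Real.sin (l / 2) * Real.cos (l / 2) -
      Real.sin (l / 2) / (4 * Real.cos (l / 2) ^ 2)) l := by
  unfold pendH pendV
  have h0 : 2 + 2 * Real.cos l ≠ 0 := by
    rw [two_add_two_cos]
    positivity
  have hs : Real.sqrt (2 + 2 * Real.cos l) ≠ 0 := by
    rw [sqrt_two_add_two_cos hc]
    positivity
  have h1 := (((Real.hasDerivAt_cos l).const_mul 2).const_add 2).sqrt h0
  have h2 := (hasDerivAt_const l (1 : ℝ)).div h1 hs
  have h3 := ((((Real.hasDerivAt_cos l).const_sub 1).sub h2).const_add (-(3 / 2) * L ^ 2))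
  refine h3.congr_deriv ?_
  rw [sqrt_two_add_two_cos hc, sin_eq_half]
  field_simp
  ring

theorem continuous_at_pendH_zero : ContinuousAt (fun p : ℝ × ℝ => pendH p.1 p.2) (0, 0) := by
  unfold pendH pendV
  have : Real.sqrt (2 + 2 * Real.cos (0 : ℝ)) ≠ 0 := by
    rw [Real.cos_zero]
    positivity
  have h1 : ContinuousAt (fun p : ℝ × ℝ => Real.sqrt (2 + 2 * Real.cos p.1)) (0, 0) :=
    Continuous.continuousAt (by fun_prop)
  have h2 : ContinuousAt (fun p : ℝ × ℝ => 1 / Real.sqrt (2 + 2 * Real.cos p.1)) (0, 0) :=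
    continuousAt_const.div h1 this
  exact ContinuousAt.add (Continuous.continuousAt (by fun_prop))
    (ContinuousAt.sub (Continuous.continuousAt (by fun_prop)) h2)

theorem pendH_zero : pendH 0 0 = -(1 / 2) := by
  have : Real.sqrt (2 + 2) = 2 := by
    rw [show (2 : ℝ) + 2 = 2 ^ 2 by norm_num, Real.sqrt_sq (by norm_num)]
  simp [pendH, pendV, this]

namespace IsRightSeparatrix

variable {l L : ℝ → ℝ}

theorem angle_ne (h : IsRightSeparatrix l L) (t : ℝ) : l t ≠ Real.pi ∧ l t ≠ -Real.pi := by
  constructor <;> (intro h1; apply h.avoids_collision t; rw [h1]; simp)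

theorem continuous_angle (h : IsRightSeparatrix l L) : Continuous l :=
  continuous_iff_continuousAt.2 fun t => (h.hasDerivAt_angle t).continuousAt

/-- By the intermediate value theorem the lifted angle would have to pass through a collision ±π to
leave the interval. -/
theorem angle_mem (h : IsRightSeparatrix l L) (t : ℝ) : l t ∈ Ioo (-Real.pi) Real.pi := by
  have h0 := h.angle_zero
  have hpi := Real.pi_pos
  constructor
  · by_contra! hlt
    obtain ⟨s, hs⟩ := mem_range_of_exists_le_of_exists_ge h.continuous_angle ⟨t, hlt⟩
      ⟨0, by linarith [h0.1]⟩
    exact (h.angle_ne s).2 hs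
  · by_contra! hlt
    obtain ⟨s, hs⟩ := mem_range_of_exists_le_of_exists_ge h.continuous_angle
      ⟨0, h0.2.le⟩ ⟨t, hlt⟩
    exact (h.angle_ne s).1 hs

theorem cos_half_pos (h : IsRightSeparatrix l L) (t : ℝ) : 0 < Real.cos (l t / 2) := by
  have := h.angle_mem t
  exact Real.cos_pos_of_mem_Ioo ⟨by linarith [this.1], by linarith [this.2]⟩

theorem hasDerivAt_l (h : IsRightSeparatrix l L) (t : ℝ) : HasDerivAt l (-3 * L t) t := by
  have := h.hasDerivAt_angle t
  rwa [(hasDerivAt_pendH_momentum (l t) (L t)).deriv] at this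

theorem hasDerivAt_L (h : IsRightSeparatrix l L) (t : ℝ) :
    HasDerivAt L (-(2 * Real.sin (l t / 2) * Real.cos (l t / 2) -
      Real.sin (l t / 2) / (4 * Real.cos (l t / 2) ^ 2))) t := by
  have := h.hasDerivAt_momentum t
  rwa [(hasDerivAt_pendH_angle (L t) (h.cos_half_pos t)).deriv] at this

theorem hasDerivAt_cos_half (h : IsRightSeparatrix l L) (t : ℝ) :
    HasDerivAt (fun t => Real.cos (l t / 2)) (3 / 2 * L t * Real.sin (l t / 2)) t := by
  refine ((h.hasDerivAt_l t).div_const 2).cos.congr_deriv ?_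
  ring

theorem energy (h : IsRightSeparatrix l L) (t : ℝ) : pendH (l t) (L t) = -(1 / 2) := by
  have hd : ∀ t, HasDerivAt (fun t => pendH (l t) (L t)) 0 t := by
    intro t
    have h1 : HasDerivAt (fun t => pendH (l t) 0) _ t :=
      (hasDerivAt_pendH_angle 0 (h.cos_half_pos t)).comp t (h.hasDerivAt_l t)
    have h2 := ((h.hasDerivAt_L t).pow 2).const_mul (-(3 / 2) : ℝ)
    have h3 := h2.add h1
    refine (h3.congr_deriv ?_).congr_of_eventuallyEq (Eventually.of_forall fun s => ?_)
    · norm_num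
      ring
    · simp [pendH]
  have hconst : ∀ t, pendH (l t) (L t) = pendH (l 0) (L 0) := fun t =>
    is_const_of_deriv_eq_zero (fun t => (hd t).differentiableAt) (fun t => (hd t).deriv) t 0
  -- The conserved value is read off in the limit at the saddle.
  have hlim : Tendsto (fun t => pendH (l t) (L t)) atTop (𝓝 (pendH 0 0)) :=
    continuous_at_pendH_zero.tendsto.comp h.tendsto_atTop
  simp only [hconst] at hlim
  rw [hconst t, ← pendH_zero]
  exact tendsto_nhds_unique tendsto_const_nhds hlim

theorem momentum_sq (h : IsRightSeparatrix l L) (t : ℝ) : L t ^ 2 * Real.cos (l t / 2) =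
    4 / 3 * ((1 - Real.cos (l t / 2)) * (Real.cos (l t / 2) - aPlus) *
      (Real.cos (l t / 2) - aMinus)) := by
  have hc := h.cos_half_pos t
  have he := h.energy t
  have hcos : Real.cos (l t) = 2 * Real.cos (l t / 2) ^ 2 - 1 := by
    linarith [two_add_two_cos (l t)]
  have s2 : Real.sqrt 2 * Real.sqrt 2 = 2 := Real.mul_self_sqrt (by norm_num)
  rw [pendH, pendV, sqrt_two_add_two_cos hc, hcos] at he
  have h1 : 1 / (2 * Real.cos (l t / 2)) * Real.cos (l t / 2) = 1 / 2 := by field_simp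
  unfold aPlus aMinus
  linear_combination (-2 / 3 * Real.cos (l t / 2)) * he - 2 / 3 * h1 +
    (1 - Real.cos (l t / 2)) / 3 * s2

theorem aMinus_neg : aMinus < -1 := by
  have := sqrt_two_bounds
  unfold aMinus
  linarith

/-- For 0 < c < a₊ the energy relation would make Λ²c negative. -/
theorem aPlus_le_cos_half (h : IsRightSeparatrix l L) (t : ℝ) : aPlus ≤ Real.cos (l t / 2) := by
  have hc := h.cos_half_pos t
  have ha := aPlus_bounds
  have hm := aMinus_neg
  have he := h.momentum_sq t
  by_contra! hlt
  have : 0 < (1 - Real.cos (l t / 2)) * (aPlus - Real.cos (l t / 2)) *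
      (Real.cos (l t / 2) - aMinus) :=
    mul_pos (mul_pos (by linarith) (by linarith)) (by linarith)
  nlinarith [mul_nonneg (sq_nonneg (L t)) hc.le]

theorem cos_half_zero (h : IsRightSeparatrix l L) : Real.cos (l 0 / 2) = aPlus := by
  have h0 := h.angle_zero
  have he := h.momentum_sq 0
  have hc := h.cos_half_pos 0
  have hm := aMinus_neg
  rw [h.momentum_zero] at he
  have hlt : Real.cos (l 0 / 2) < 1 := by
    rw [← Real.cos_zero]
    exact Real.cos_lt_cos_of_nonneg_of_le_pi le_rfl (by linarith [h0.2, Real.pi_pos])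
      (by linarith [h0.1, Real.pi_pos])
  have h1 : (1 - Real.cos (l 0 / 2)) * (Real.cos (l 0 / 2) - aPlus) *
      (Real.cos (l 0 / 2) - aMinus) = 0 := by linarith
  rcases mul_eq_zero.1 h1 with h2 | h2
  · rcases mul_eq_zero.1 h2 with h3 | h3 <;> linarith
  · linarith

/-- Both Λ² and sin²(λ/2) are O(1 − c), hence so is c′. The constant comes from (9/4)(4/3)(2.3)(2) =
13.8 < 4². -/
theorem abs_deriv_cos_half_le (h : IsRightSeparatrix l L) (t : ℝ) :
    |3 / 2 * L t * Real.sin (l t / 2)| ≤ 4 * (1 - Real.cos (l t / 2)) := by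
  have hc := h.cos_half_pos t
  have hc1 := Real.cos_le_one (l t / 2)
  have hs := Real.sin_sq_add_cos_sq (l t / 2)
  have hp := h.aPlus_le_cos_half t
  have ha := aPlus_bounds
  have hm : -1.3 < aMinus := by
    have := sqrt_two_bounds
    unfold aMinus
    linarith
  have hm2 := aMinus_neg
  have he := h.momentum_sq t
  set c := Real.cos (l t / 2) with hcdef
  refine abs_le_of_sq_le_sq ?_ (by linarith)
  have h1 : L t ^ 2 ≤ 4 / 3 * ((1 - c) * (c - aMinus)) := by
    have : L t ^ 2 * c ≤ 4 / 3 * ((1 - c) * (c - aMinus)) * c := by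
      rw [he]
      have : 0 ≤ (1 - c) * (c - aMinus) := mul_nonneg (by linarith) (by linarith)
      nlinarith
    exact le_of_mul_le_mul_right this hc
  have h2 : Real.sin (l t / 2) ^ 2 = (1 - c) * (1 + c) := by linarith
  have h3 : 4 / 3 * ((1 - c) * (c - aMinus)) ≤ 4 / 3 * ((1 - c) * 2.3) := by
    have : (1 - c) * (c - aMinus) ≤ (1 - c) * 2.3 :=
      mul_le_mul_of_nonneg_left (by linarith) (by linarith)
    linarith
  have h4 : (1 - c) * (1 + c) ≤ (1 - c) * 2 := mul_le_mul_of_nonneg_left (by linarith) (by linarith)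
  calc (3 / 2 * L t * Real.sin (l t / 2)) ^ 2 = 9 / 4 * (L t ^ 2 * Real.sin (l t / 2) ^ 2) := by ring
    _ ≤ 9 / 4 * (4 / 3 * ((1 - c) * 2.3) * ((1 - c) * 2)) := by
        rw [h2]
        refine mul_le_mul_of_nonneg_left (mul_le_mul (h1.trans h3) h4 ?_ ?_) (by norm_num)
        · exact mul_nonneg (by linarith) (by linarith)
        · exact mul_nonneg (by norm_num) (mul_nonneg (by linarith) (by norm_num))
    _ ≤ (4 * (1 - c)) ^ 2 := by nlinarith [sq_nonneg (1 - c)]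

/-- Grönwall: |c′| ≤ 4(1 − c) makes (1 − c)e^{4t} nondecreasing and (1 − c)e^{−4t} nonincreasing, so
c = 1 is not reached in finite time in either direction. -/
theorem cos_half_lt_one (h : IsRightSeparatrix l L) (t : ℝ) : Real.cos (l t / 2) < 1 := by
  have hd : ∀ t, HasDerivAt (fun t => 1 - Real.cos (l t / 2))
      (-(3 / 2 * L t * Real.sin (l t / 2))) t := fun t => (h.hasDerivAt_cos_half t).const_sub 1
  have hb := fun t => abs_le.1 (h.abs_deriv_cos_half_le t)
  have h0 : Real.cos (l 0 / 2) < 1 := by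
    rw [h.cos_half_zero]
    linarith [aPlus_bounds.2]
  have he : ∀ k t : ℝ, HasDerivAt (fun t => Real.exp (k * t)) (Real.exp (k * t) * k) t := fun k t => by
    simpa using ((hasDerivAt_id t).const_mul k).exp
  rcases le_total 0 t with ht | ht
  · have hm : Monotone fun t => (1 - Real.cos (l t / 2)) * Real.exp (4 * t) := by
      have hd' := fun t => (hd t).mul (he 4 t)
      refine monotone_of_deriv_nonneg (fun t => (hd' t).differentiableAt) fun t => ?_
      have := (hd' t).deriv
      rw [show (fun t => (1 - Real.cos (l t / 2)) * Real.exp (4 * t)) =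
        (fun t => 1 - Real.cos (l t / 2)) * (fun t => Real.exp (4 * t)) from rfl, this]
      nlinarith [hb t, Real.exp_pos (4 * t)]
    have h1 := hm ht
    simp only [mul_zero, Real.exp_zero, mul_one] at h1
    have h2 : 0 < (1 - Real.cos (l t / 2)) * Real.exp (4 * t) := by linarith
    linarith [(pos_iff_pos_of_mul_pos h2).2 (Real.exp_pos _)]
  · have hm : Antitone fun t => (1 - Real.cos (l t / 2)) * Real.exp (-4 * t) := by
      have hd' := fun t => (hd t).mul (he (-4) t)
      refine antitone_of_deriv_nonpos (fun t => (hd' t).differentiableAt) fun t => ?_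
      have := (hd' t).deriv
      rw [show (fun t => (1 - Real.cos (l t / 2)) * Real.exp (-4 * t)) =
        (fun t => 1 - Real.cos (l t / 2)) * (fun t => Real.exp (-4 * t)) from rfl, this]
      nlinarith [hb t, Real.exp_pos (-4 * t)]
    have h1 := hm ht
    simp only [mul_zero, Real.exp_zero, mul_one] at h1
    have h2 : 0 < (1 - Real.cos (l t / 2)) * Real.exp (-4 * t) := by linarith
    linarith [(pos_iff_pos_of_mul_pos h2).2 (Real.exp_pos _)]

theorem angle_pos (h : IsRightSeparatrix l L) (t : ℝ) : 0 < l t := by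
  by_contra! hle
  obtain ⟨s, hs⟩ := mem_range_of_exists_le_of_exists_ge h.continuous_angle ⟨t, hle⟩
    ⟨0, by linarith [h.angle_zero.1, Real.pi_pos]⟩
  have := h.cos_half_lt_one s
  rw [hs] at this
  simp at this

end IsRightSeparatrix

/-! ### The real uniformizing variable of the separatrix -/

/-- The factor `W` in the energy relation `L² = (4/3) (c - a₊) W(c)`. -/
noncomputable def energyFactor (c : ℝ) : ℝ := 1 + aMinus - c - aMinus / c

theorem energyFactor_eq {c : ℝ} (hc : c ≠ 0) : energyFactor c = (1 - c) * (c - aMinus) / c := by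
  unfold energyFactor
  field_simp
  ring

theorem hasDerivAt_energyFactor {c : ℝ} (hc : c ≠ 0) :
    HasDerivAt energyFactor (-1 + aMinus / c ^ 2) c := by
  unfold energyFactor
  refine (((hasDerivAt_id c).const_sub (1 + aMinus)).sub
    ((hasDerivAt_const c aMinus).div (hasDerivAt_id c) hc)).congr_deriv ?_
  simp only [id]
  field_simp
  ring

theorem hasDerivAt_log_ratio {u : ℝ} (h1 : -1 < u) (h2 : u < 1) :
    HasDerivAt (fun u => Real.log ((1 + u) / (1 - u))) (2 / (1 - u ^ 2)) u := by
  have e1 : 1 + u ≠ 0 := by linarith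
  have e2 : 1 - u ≠ 0 := by linarith
  have e3 : 1 - u ^ 2 ≠ 0 := by
    have : 1 - u ^ 2 = (1 + u) * (1 - u) := by ring
    rw [this]
    exact mul_ne_zero e1 e2
  refine ((((hasDerivAt_id u).const_add 1).div ((hasDerivAt_id u).const_sub 1) e2).log
    (div_ne_zero e1 e2)).congr_deriv ?_
  simp only [id, Pi.div_apply]
  field_simp
  ring

theorem cosh_log_ratio {u : ℝ} (h1 : -1 < u) (h2 : u < 1) :
    Real.cosh (Real.log ((1 + u) / (1 - u))) = (1 + u ^ 2) / (1 - u ^ 2) := by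
  have e1 : 0 < 1 + u := by linarith
  have e2 : 0 < 1 - u := by linarith
  have e3 : 1 - u ^ 2 ≠ 0 := by
    have : 1 - u ^ 2 = (1 + u) * (1 - u) := by ring
    rw [this]
    positivity
  rw [Real.cosh_log (by positivity)]
  field_simp
  ring

theorem timeDensity_ofReal (x : ℝ) : timeDensity (x : ℂ) = (Real.sqrt (2 / 21 *
    ((Real.cosh x - kap) * (Real.cosh x + 1) /
      ((Real.cosh x + poleM) * (Real.cosh x + poleN)))) : ℝ) := by
  have h1 := Real.one_le_cosh x
  have h2 := kap_bounds
  have h3 := poleM_bounds.1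
  have h4 := poleN_bounds.1
  rw [timeDensity, ← Complex.sqrt_ofReal_of_nonneg, densitySq]
  · push_cast
    rfl
  · have : 0 < Real.cosh x - kap := by linarith
    have : 0 < Real.cosh x + poleM := by linarith
    have : 0 < Real.cosh x + poleN := by linarith
    positivity

/-- The real uniformizing variable of the point `(l, L)` of the separatrix. -/
noncomputable def realParam (l L : ℝ) : ℝ :=
  L / (Real.sqrt (4 / 3 * (1 - aPlus)) * Real.sqrt (energyFactor (Real.cos (l / 2))))

namespace IsRightSeparatrix

variable {l L : ℝ → ℝ}

theorem energyFactor_pos (h : IsRightSeparatrix l L) (t : ℝ) :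
    0 < energyFactor (Real.cos (l t / 2)) := by
  have hc := h.cos_half_pos t
  rw [energyFactor_eq hc.ne']
  have := h.cos_half_lt_one t
  have hm := aMinus_neg
  exact div_pos (mul_pos (by linarith) (by linarith)) hc

/-- This quantity is u = tanh(y/2). Defining it as Λ divided by a positive square root, rather than
as a root of (c − a₊)/(1 − a₊), gives it the sign of Λ and makes it smooth through the turning point
t = 0. -/
theorem realParam_sq (h : IsRightSeparatrix l L) (t : ℝ) :
    realParam (l t) (L t) ^ 2 = (Real.cos (l t / 2) - aPlus) / (1 - aPlus) := by
  have hc := h.cos_half_pos t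
  have hW := h.energyFactor_pos t
  have he := h.momentum_sq t
  have ha : 0 < 1 - aPlus := by linarith [aPlus_bounds.2]
  have h1 := h.cos_half_lt_one t
  have hm : 0 < Real.cos (l t / 2) - aMinus := by linarith [aMinus_neg]
  rw [realParam, div_pow, mul_pow, Real.sq_sqrt (by positivity), Real.sq_sqrt hW.le,
    energyFactor_eq hc.ne']
  have h1' : 0 < 1 - Real.cos (l t / 2) := by linarith
  rw [div_eq_div_iff (by positivity) ha.ne']
  field_simp
  linear_combination 3 * he

theorem realParam_mem (h : IsRightSeparatrix l L) (t : ℝ) :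
    -1 < realParam (l t) (L t) ∧ realParam (l t) (L t) < 1 := by
  have ha : 0 < 1 - aPlus := by linarith [aPlus_bounds.2]
  have h1 := h.cos_half_lt_one t
  have h2 : realParam (l t) (L t) ^ 2 < 1 := by
    rw [h.realParam_sq, div_lt_one ha]
    linarith
  exact abs_lt.1 ((sq_lt_one_iff_abs_lt_one _).1 h2)

theorem hasDerivAt_realParam (h : IsRightSeparatrix l L) (t : ℝ) :
    HasDerivAt (fun t => realParam (l t) (L t))
      (Real.sin (l t / 2) * Real.sqrt (energyFactor (Real.cos (l t / 2))) /
        Real.sqrt (4 / 3 * (1 - aPlus))) t := by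
  have hc := h.cos_half_pos t
  have hW := h.energyFactor_pos t
  have he := h.momentum_sq t
  have ha : 0 < 1 - aPlus := by linarith [aPlus_bounds.2]
  have hk : Real.sqrt (4 / 3 * (1 - aPlus)) ≠ 0 := (Real.sqrt_pos.2 (by positivity)).ne'
  have hw := Real.sqrt_pos.2 hW
  have h1 : HasDerivAt (fun t => energyFactor (Real.cos (l t / 2))) _ t :=
    HasDerivAt.comp (h := fun t => Real.cos (l t / 2)) t (hasDerivAt_energyFactor hc.ne')
      (h.hasDerivAt_cos_half t)
  have h2 := (h1.sqrt hW.ne').const_mul (Real.sqrt (4 / 3 * (1 - aPlus)))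
  have h3 := (h.hasDerivAt_L t).div h2 (mul_ne_zero hk hw.ne')
  refine h3.congr_deriv ?_
  have hww := Real.sq_sqrt hW.le
  have hWc : energyFactor (Real.cos (l t / 2)) * Real.cos (l t / 2) =
      (1 - Real.cos (l t / 2)) * (Real.cos (l t / 2) - aMinus) := by
    rw [energyFactor_eq hc.ne']
    field_simp
  have hL2 : L t ^ 2 = 4 / 3 * (Real.cos (l t / 2) - aPlus) *
      Real.sqrt (energyFactor (Real.cos (l t / 2))) ^ 2 := by
    rw [hww]
    refine mul_right_cancel₀ hc.ne' ?_
    linear_combination he - 4 / 3 * (Real.cos (l t / 2) - aPlus) * hWc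
  have hE : energyFactor (Real.cos (l t / 2)) = 1 + aMinus - Real.cos (l t / 2) -
    aMinus / Real.cos (l t / 2) := rfl
  rw [← hww] at hE
  set w := Real.sqrt (energyFactor (Real.cos (l t / 2))) with hwdef
  set k := Real.sqrt (4 / 3 * (1 - aPlus)) with hkdef
  set c := Real.cos (l t / 2) with hcdef
  set s := Real.sin (l t / 2) with hsdef
  -- Differentiating Λ² = (4/3)(c − a₊)W(c) with c′ = (3/2)Λ sin(λ/2) suggests this form of Λ′ after
  -- division by Λ; as an identity in c it remains valid where Λ = 0.
  have hkey : -(2 * s * c - s / (4 * c ^ 2)) = s * (w ^ 2 + (c - aPlus) * (-1 + aMinus / c ^ 2)) := by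
    have s2 : Real.sqrt 2 * Real.sqrt 2 = 2 := Real.mul_self_sqrt (by norm_num)
    rw [hE]
    field_simp
    unfold aPlus aMinus
    linear_combination (-s) * s2
  rw [hkey]
  have hwne := hw.ne'
  have hcne := hc.ne'
  have : s * (w ^ 2 + (c - aPlus) * (-1 + aMinus / c ^ 2)) * (k * w) -
      L t * (k * ((-1 + aMinus / c ^ 2) * (3 / 2 * L t * s) / (2 * w))) = s * k * w ^ 3 := by
    have e : L t * (k * ((-1 + aMinus / c ^ 2) * (3 / 2 * L t * s) / (2 * w))) =
      L t ^ 2 * (3 / 4 * k * s * (-1 + aMinus / c ^ 2) / w) := by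
      field_simp
      ring
    rw [e, hL2]
    field_simp
    ring
  rw [this]
  field_simp

/-- Take y = 2 artanh u. Then T(y(t)) − t has derivative f(y) y′ − 1 = 0, and it vanishes at t = 0
because Λ(0) = 0. -/
theorem exists_uniformization (h : IsRightSeparatrix l L) : ∃ y : ℝ → ℝ, ∀ t : ℝ,
    timeMap (y t : ℂ) = t ∧
      Real.cos (l t / 2) = (Real.cosh (y t) - kap) / (Real.cosh (y t) + 1) := by
  set u : ℝ → ℝ := fun t => realParam (l t) (L t) with hu
  have ha : 0 < 1 - aPlus := by linarith [aPlus_bounds.2]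
  have hak : aPlus + kap = 1 - aPlus := by unfold aPlus kap; ring
  have hkb := kap_bounds
  have hcosh : ∀ t, Real.cosh (Real.log ((1 + u t) / (1 - u t))) =
      (kap + Real.cos (l t / 2)) / (1 - Real.cos (l t / 2)) := by
    intro t
    have h1 := h.cos_half_lt_one t
    have h1' : 0 < 1 - Real.cos (l t / 2) := by linarith
    rw [cosh_log_ratio (h.realParam_mem t).1 (h.realParam_mem t).2, h.realParam_sq]
    have : 1 - (Real.cos (l t / 2) - aPlus) / (1 - aPlus) =
      (1 - Real.cos (l t / 2)) / (1 - aPlus) := by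
      field_simp
      ring
    rw [this]
    field_simp
    linarith
  have hy : ∀ t, HasDerivAt (fun t => Real.log ((1 + u t) / (1 - u t))) _ t := fun t =>
    HasDerivAt.comp (h := u) t (hasDerivAt_log_ratio (h.realParam_mem t).1 (h.realParam_mem t).2)
      (h.hasDerivAt_realParam t)
  refine ⟨fun t => Real.log ((1 + u t) / (1 - u t)), fun t => ⟨?_, ?_⟩⟩
  · have hone : ∀ t, HasDerivAt
        (fun t => timeMap ((Real.log ((1 + u t) / (1 - u t)) : ℝ) : ℂ) - t) 0 t := by
      intro t
      have hmem : ((Real.log ((1 + u t) / (1 - u t)) : ℝ) : ℂ) ∈ slitStrip :=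
        innerStrip_subset (by simpa [innerStrip] using bet_pos)
      have h1 := (hasDerivAt_timeMap hmem).comp t (hy t).ofReal_comp
      refine (h1.sub (Complex.ofRealCLM.hasDerivAt (x := t))).congr_deriv ?_
      simp only [Complex.ofRealCLM_apply, Complex.ofReal_one]
      rw [timeDensity_ofReal, ← Complex.ofReal_mul, ← Complex.ofReal_one, ← Complex.ofReal_sub,
        Complex.ofReal_eq_zero, sub_eq_zero]
      have hc := h.cos_half_pos t
      have hc1 := h.cos_half_lt_one t
      have hc1' : 0 < 1 - Real.cos (l t / 2) := by linarith
      have hW := h.energyFactor_pos t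
      have hm : 0 < Real.cos (l t / 2) - aMinus := by linarith [aMinus_neg]
      have hpos : 0 < l t := h.angle_pos t
      have hs : 0 < Real.sin (l t / 2) := Real.sin_pos_of_pos_of_lt_pi (by linarith)
        (by linarith [(h.angle_mem t).2, Real.pi_pos])
      have hsq := Real.sin_sq_add_cos_sq (l t / 2)
      have hu2 : 1 - u t ^ 2 = (1 - Real.cos (l t / 2)) / (1 - aPlus) := by
        simp only [hu]
        rw [h.realParam_sq]
        field_simp
        ring
      have s2 : Real.sqrt 2 * Real.sqrt 2 = 2 := Real.mul_self_sqrt (by norm_num)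
      -- The squared density rewritten in c, so that it can be compared with the speed of y.
      have hD : ∀ C : ℝ, C = (kap + Real.cos (l t / 2)) / (1 - Real.cos (l t / 2)) →
          2 / 21 * ((C - kap) * (C + 1) / ((C + poleM) * (C + poleN))) =
          2 / 21 * ((3 + Real.sqrt 2) * Real.cos (l t / 2) /
            ((1 + Real.cos (l t / 2)) * (Real.cos (l t / 2) - aMinus))) := by
        intro C hC
        have e1 : C - kap = Real.cos (l t / 2) * (1 + kap) / (1 - Real.cos (l t / 2)) := by
          rw [hC]; field_simp; ring
        have e2 : C + 1 = (1 + kap) / (1 - Real.cos (l t / 2)) := by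
          rw [hC]; field_simp; ring
        have e3 : C + poleM = (1 + Real.cos (l t / 2)) / 2 * (1 + kap) /
            (1 - Real.cos (l t / 2)) := by
          rw [hC]; field_simp; unfold kap poleM; ring
        have e4 : C + poleN = (Real.cos (l t / 2) - aMinus) * (2 * (3 - Real.sqrt 2) / 7) *
            (1 + kap) / (1 - Real.cos (l t / 2)) := by
          rw [hC]; field_simp; unfold kap poleN aMinus
          linear_combination (5 - 2 * Real.cos (l t / 2) - Real.sqrt 2) * s2
        have e5 : 0 < 3 - Real.sqrt 2 := by linarith [sqrt_two_bounds.2]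
        have hk1 : 0 < 1 + kap := by linarith
        rw [e1, e2, e3, e4]
        field_simp
        linear_combination s2
      rw [hD _ (hcosh t), hu2]
      have hk : 0 < Real.sqrt (4 / 3 * (1 - aPlus)) := Real.sqrt_pos.2 (by positivity)
      have hw := Real.sqrt_pos.2 hW
      have hg : 0 ≤ 2 / 21 * ((3 + Real.sqrt 2) * Real.cos (l t / 2) /
            ((1 + Real.cos (l t / 2)) * (Real.cos (l t / 2) - aMinus))) := by positivity
      -- Comparing squares suffices because f y′ ≥ 0; its sign is that of sin(λ/2), positive as 0 <
      -- λ < π.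
      refine (sq_eq_sq₀ (by positivity) zero_le_one).1 ?_
      rw [mul_pow, mul_pow, div_pow, div_pow, div_pow, mul_pow, Real.sq_sqrt hg,
        Real.sq_sqrt hW.le, Real.sq_sqrt (by positivity), energyFactor_eq hc.ne']
      rw [show Real.sin (l t / 2) ^ 2 = (1 - Real.cos (l t / 2)) * (1 + Real.cos (l t / 2)) by
        linarith]
      have e6 : (3 + Real.sqrt 2) * (1 - aPlus) = 7 / 2 := by
        unfold aPlus
        linear_combination (-1 / 2 : ℝ) * s2
      field_simp
      linear_combination 24 * e6
    have hconst := is_const_of_deriv_eq_zero (fun t => (hone t).differentiableAt)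
      (fun t => (hone t).deriv) t 0
    have h0 : u 0 = 0 := by simp [hu, realParam, h.momentum_zero]
    simp only [h0] at hconst
    simp [timeMap_zero] at hconst
    have := sub_eq_zero.1 hconst
    simpa using this
  · have h1 := h.cos_half_lt_one t
    have h1' : 0 < 1 - Real.cos (l t / 2) := by linarith
    have hk1 : 0 < 1 + kap := by linarith
    simp only
    rw [hcosh t]
    have e2 : (kap + Real.cos (l t / 2)) / (1 - Real.cos (l t / 2)) + 1 =
      (1 + kap) / (1 - Real.cos (l t / 2)) := by field_simp; ring
    have e1 : (kap + Real.cos (l t / 2)) / (1 - Real.cos (l t / 2)) - kap =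
      Real.cos (l t / 2) * (1 + kap) / (1 - Real.cos (l t / 2)) := by field_simp; ring
    rw [e1, e2]
    field_simp

end IsRightSeparatrix

/-! ### The angle as a function of the uniformizing variable -/

/-- The branch cuts of arctan lie on the imaginary axis. If (1+iz)/(1−iz) were a nonpositive real,
its imaginary relation would force the value −1, and the real parts would then read 1 = −1. -/
theorem Complex.hasDerivAt_arctan_of_re_pos {z : ℂ} (hz : 0 < z.re) :
    HasDerivAt Complex.arctan (1 / (1 + z ^ 2)) z := by
  have h1 : 1 + z * Complex.I ≠ 0 := by
    intro h
    have h2 := congrArg Complex.im h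
    simp at h2
    linarith
  have h2 : 1 - z * Complex.I ≠ 0 := by
    intro h
    have h2 := congrArg Complex.im h
    simp at h2
    linarith
  have h3 : 1 + z ^ 2 = (1 + z * Complex.I) * (1 - z * Complex.I) := by
    linear_combination z ^ 2 * Complex.I_sq
  have hslit : (1 + z * Complex.I) / (1 - z * Complex.I) ∈ Complex.slitPlane := by
    rw [Complex.mem_slitPlane_iff_not_le_zero]
    intro hle
    obtain ⟨hre, him⟩ := Complex.le_def.1 hle
    set w := (1 + z * Complex.I) / (1 - z * Complex.I) with hw
    have hwr : w = (w.re : ℂ) := Complex.ext rfl (by simpa using him)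
    have h4 : 1 + z * Complex.I = (w.re : ℂ) * (1 - z * Complex.I) := by
      rw [← hwr, hw]
      field_simp
    have h5 := congrArg Complex.im h4
    have h6 : z.re = w.re * -z.re := by simpa using h5
    have h7 : w.re = -1 := by
      have : z.re * (1 + w.re) = 0 := by linarith
      rcases mul_eq_zero.1 this with h | h <;> linarith
    rw [h7] at h4
    have h8 := congrArg Complex.re h4
    simp at h8
    linarith
  have hn : HasDerivAt (fun z : ℂ => 1 + z * Complex.I) Complex.I z := by
    simpa using ((hasDerivAt_id z).mul_const Complex.I).const_add 1
  have hd : HasDerivAt (fun z : ℂ => 1 - z * Complex.I) (-Complex.I) z := by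
    simpa using ((hasDerivAt_id z).mul_const Complex.I).const_sub 1
  have h := ((hn.div hd h2).clog hslit).const_mul (-Complex.I / 2)
  refine h.congr_deriv ?_
  have h4 : Complex.I * (1 - z * Complex.I) - (1 + z * Complex.I) * -Complex.I = 2 * Complex.I := by
    ring
  simp only [Pi.div_apply]
  rw [h4, h3]
  generalize 1 + z * Complex.I = a at h1
  generalize 1 - z * Complex.I = b at h2
  have h5 : -Complex.I / 2 * (2 * Complex.I / b ^ 2 / (a / b)) =
      -(Complex.I * Complex.I) * (1 / (a * b)) := by
    field_simp
  rw [h5, Complex.I_mul_I]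
  ring

/-- The square of `tan (l / 4)` as a function of `C = cosh y`. -/
noncomputable def tanSq (C : ℂ) : ℂ := (1 + kap) / (2 * (C + poleM))

/-- The angle of the separatrix as a function of the uniformizing variable. -/
noncomputable def angleFn (y : ℂ) : ℂ :=
  4 * Complex.arctan (Complex.sqrt (tanSq (Complex.cosh y)))

theorem tanSq_mem_slitPlane {C : ℂ} (hC : 0 < C.re) : tanSq C ∈ Complex.slitPlane := by
  left
  have hm := poleM_bounds.1
  have hk := kap_bounds.1
  have h1 : tanSq C = (((1 + kap) / 2 : ℝ) : ℂ) * (C + poleM)⁻¹ := by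
    have := add_ofReal_ne_zero hC (by linarith : 0 < poleM)
    rw [tanSq]
    push_cast
    field_simp
  have hne := Complex.normSq_pos.2 (add_ofReal_ne_zero hC (by linarith : 0 < poleM))
  rw [h1, Complex.re_ofReal_mul, Complex.inv_re]
  refine mul_pos (by linarith) (div_pos ?_ hne)
  simp
  linarith

theorem hasDerivAt_tanSq {C : ℂ} (hC : 0 < C.re) :
    HasDerivAt tanSq (-(1 + kap) / (2 * (C + poleM) ^ 2)) C := by
  have hne := add_ofReal_ne_zero hC (by linarith [poleM_bounds.1] : 0 < poleM)
  have h1 : HasDerivAt (fun C : ℂ => 2 * (C + poleM)) 2 C := by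
    simpa using ((hasDerivAt_id C).add_const (poleM : ℂ)).const_mul 2
  have := (hasDerivAt_const C (1 + kap : ℂ)).div h1 (by simpa using hne)
  refine this.congr_deriv ?_
  field_simp
  ring

/-- Re C > 0 keeps `tanSq` and its square root in the right half-plane, where arctan is analytic.
The corner iβ is included: the angle is regular in y at the collision. -/
theorem differentiableAt_angleFn {y : ℂ} (hy : |y.im| < Real.pi / 2) :
    DifferentiableAt ℂ angleFn y := by
  have hC := cosh_re_pos hy
  have hs := tanSq_mem_slitPlane hC
  have h1 : DifferentiableAt ℂ (fun y => tanSq (Complex.cosh y)) y :=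
    (hasDerivAt_tanSq hC).differentiableAt.comp y Complex.differentiableAt_cosh
  have h2 : DifferentiableAt ℂ (fun y => Complex.sqrt (tanSq (Complex.cosh y))) y :=
    DifferentiableAt.comp (f := fun y => tanSq (Complex.cosh y)) y (Complex.differentiableAt_sqrt hs) h1
  exact ((Complex.hasDerivAt_arctan_of_re_pos (Complex.re_sqrt_pos hs)).differentiableAt.comp y
    h2).const_mul 4

theorem one_sub_kap_eq : 1 - kap = 2 * poleM := by
  unfold kap poleM
  ring

/-- tan²(λ/4) = (1−c)/(1+c), and 0 < λ < π selects the positive root and the principal arctangent.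
-/
theorem angleFn_ofReal {x l : ℝ} (hl : l ∈ Ioo 0 Real.pi)
    (hx : Real.cos (l / 2) = (Real.cosh x - kap) / (Real.cosh x + 1)) :
    angleFn (x : ℂ) = l := by
  have h1 := Real.one_le_cosh x
  have hm := poleM_bounds.1
  have hk := kap_bounds
  have hc4 : 0 < Real.cos (l / 4) :=
    Real.cos_pos_of_mem_Ioo ⟨by linarith [hl.1, Real.pi_pos], by linarith [hl.2, Real.pi_pos]⟩
  have hs4 : 0 < Real.sin (l / 4) :=
    Real.sin_pos_of_pos_of_lt_pi (by linarith [hl.1]) (by linarith [hl.2, Real.pi_pos])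
  have hcos : Real.cos (l / 2) = 2 * Real.cos (l / 4) ^ 2 - 1 := by
    rw [← Real.cos_two_mul]
    ring_nf
  have hsq := Real.sin_sq_add_cos_sq (l / 4)
  have htan : (1 + kap) / (2 * (Real.cosh x + poleM)) = Real.tan (l / 4) ^ 2 := by
    rw [Real.tan_eq_sin_div_cos, div_pow, div_eq_div_iff (by positivity) (by positivity)]
    have e1 : Real.sin (l / 4) ^ 2 = (1 + kap) / (Real.cosh x + 1) / 2 := by
      have : Real.sin (l / 4) ^ 2 = (1 - Real.cos (l / 2)) / 2 := by linarith
      rw [this, hx]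
      field_simp
      ring
    have e2 : Real.cos (l / 4) ^ 2 = (Real.cosh x + poleM) / (Real.cosh x + 1) := by
      have : Real.cos (l / 4) ^ 2 = (1 + Real.cos (l / 2)) / 2 := by linarith
      rw [this, hx]
      field_simp
      linear_combination one_sub_kap_eq
    rw [e1, e2]
    field_simp
  have htanpos : 0 < Real.tan (l / 4) := by
    rw [Real.tan_eq_sin_div_cos]
    positivity
  have h2 : tanSq (Complex.cosh x) = ((Real.tan (l / 4) ^ 2 : ℝ) : ℂ) := by
    rw [← htan, tanSq]
    push_cast
    rfl
  rw [angleFn, h2, Complex.sqrt_ofReal_of_nonneg (sq_nonneg _), Real.sqrt_sq htanpos.le,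
    ← Complex.ofReal_arctan, Real.arctan_tan (by linarith [hl.1, Real.pi_pos])
      (by linarith [hl.2, Real.pi_pos])]
  push_cast
  ring

/-! ### The angle near the corner `i β` -/

/-- The angle along the imaginary axis, the corner being at `0`. -/
noncomputable def cornerAngle (v : ℂ) : ℂ := angleFn (Complex.I * (bet - v))

/-- The square of the time density along the imaginary axis, the corner being at `0`. -/
noncomputable def cornerDensitySq (v : ℂ) : ℂ := densitySq (Complex.cos (bet - v))

theorem cosh_I_mul (z : ℂ) : Complex.cosh (Complex.I * z) = Complex.cos z := by
  rw [mul_comm, Complex.cosh_mul_I]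

theorem sin_bet_pos : 0 < Real.sin bet :=
  Real.sin_pos_of_pos_of_lt_pi bet_pos (by linarith [bet_lt, Real.pi_pos])

theorem hasDerivAt_cos_bet_sub : HasDerivAt (fun v : ℂ => Complex.cos (bet - v))
    (Real.sin bet : ℂ) 0 := by
  have h1 : HasDerivAt (fun v : ℂ => (bet : ℂ) - v) (-1) 0 := by
    simpa using (hasDerivAt_id (0 : ℂ)).const_sub (bet : ℂ)
  have := h1.ccos
  simpa using this

theorem cos_bet_complex : Complex.cos (bet : ℂ) = (kap : ℂ) := by
  rw [← Complex.ofReal_cos, cos_bet]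

theorem cornerAngle_zero : cornerAngle 0 = (Real.pi : ℂ) := by
  have hk : (1 : ℝ) + kap ≠ 0 := by linarith [kap_bounds.1]
  have h1 : tanSq (kap : ℂ) = 1 := by
    have : 2 * (kap + poleM) = 1 + kap := by linarith [one_sub_kap_eq]
    rw [tanSq]
    have h2 : (2 * ((kap : ℂ) + poleM)) = ((1 + kap : ℝ) : ℂ) := by
      rw [← this]
      push_cast
      ring
    rw [h2]
    push_cast
    exact div_self (by exact_mod_cast hk)
  rw [cornerAngle, angleFn, cosh_I_mul, sub_zero, cos_bet_complex, h1, Complex.sqrt_one]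
  have := Complex.ofReal_arctan 1
  rw [Real.arctan_one] at this
  push_cast at this
  rw [← this]
  ring

theorem hasDerivAt_cornerAngle_zero :
    HasDerivAt cornerAngle ((-(2 * Real.sin bet / (1 + kap)) : ℝ) : ℂ) 0 := by
  have hk : (1 : ℝ) + kap ≠ 0 := by linarith [kap_bounds.1]
  have hkr : 0 < ((kap : ℝ) : ℂ).re := by simpa using (by linarith [kap_bounds.1] : 0 < kap)
  have hkm : ((kap : ℂ) + poleM) = ((1 + kap : ℝ) : ℂ) / 2 := by
    have : kap + poleM = (1 + kap) / 2 := by linarith [one_sub_kap_eq]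
    exact_mod_cast congrArg (fun x : ℝ => (x : ℂ)) this
  have hk' : ((1 + kap : ℝ) : ℂ) ≠ 0 := by exact_mod_cast hk
  have h1 : tanSq (kap : ℂ) = 1 := by
    rw [tanSq, hkm, mul_div_cancel₀ _ two_ne_zero]
    push_cast at hk' ⊢
    exact div_self hk'
  have e1 : HasDerivAt (fun v : ℂ => tanSq (Complex.cos (bet - v)))
      (-(1 + kap) / (2 * ((kap : ℂ) + poleM) ^ 2) * (Real.sin bet : ℂ)) 0 := by
    refine HasDerivAt.comp (h₂ := tanSq) (h := fun v : ℂ => Complex.cos (bet - v)) 0 ?_ hasDerivAt_cos_bet_sub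
    simp only [sub_zero, cos_bet_complex]
    exact hasDerivAt_tanSq hkr
  have hone : (1 : ℂ) ∈ Complex.slitPlane := Complex.one_mem_slitPlane
  have e2 : HasDerivAt (fun v : ℂ => Complex.sqrt (tanSq (Complex.cos (bet - v))))
      (1 / 2 * (-(1 + kap) / (2 * ((kap : ℂ) + poleM) ^ 2) * (Real.sin bet : ℂ))) 0 := by
    refine HasDerivAt.comp (h₂ := Complex.sqrt) (h := fun v : ℂ => tanSq (Complex.cos (bet - v))) 0 ?_ e1
    simp only [sub_zero, cos_bet_complex, h1]
    exact (Complex.hasDerivAt_sqrt hone).congr_deriv (by simp)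
  have e3 : HasDerivAt (fun v : ℂ => Complex.arctan (Complex.sqrt (tanSq (Complex.cos (bet - v)))))
      (1 / (1 + 1 ^ 2) *
        (1 / 2 * (-(1 + kap) / (2 * ((kap : ℂ) + poleM) ^ 2) * (Real.sin bet : ℂ)))) 0 := by
    refine HasDerivAt.comp (h₂ := Complex.arctan)
      (h := fun v : ℂ => Complex.sqrt (tanSq (Complex.cos (bet - v)))) 0 ?_ e2
    simp only [sub_zero, cos_bet_complex, h1, Complex.sqrt_one]
    exact Complex.hasDerivAt_arctan_of_re_pos (by simp)
  have e4 := e3.const_mul 4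
  have hfun : cornerAngle =
      fun v : ℂ => 4 * Complex.arctan (Complex.sqrt (tanSq (Complex.cos (bet - v)))) := by
    funext v
    rw [cornerAngle, angleFn, cosh_I_mul]
  rw [hfun]
  refine e4.congr_deriv ?_
  rw [hkm]
  push_cast at hk' ⊢
  field_simp
  ring

theorem abs_im_corner {v : ℂ} (hv : ‖v‖ < Real.pi / 2 - bet) :
    |(Complex.I * (bet - v)).im| < Real.pi / 2 := by
  have h1 := (Complex.abs_re_le_norm v).trans_lt hv
  have h2 := abs_lt.1 h1
  have h3 := bet_pos
  have h4 := bet_lt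
  have : (Complex.I * (bet - v)).im = bet - v.re := by simp
  rw [this, abs_lt]
  constructor <;> linarith

theorem cornerDensitySq_eq (v : ℂ) :
    cornerDensitySq v = densitySq (Complex.cosh (Complex.I * (bet - v))) := by
  rw [cosh_I_mul, cornerDensitySq]

theorem differentiableOn_cornerDensitySq :
    DifferentiableOn ℂ cornerDensitySq (Metric.ball 0 (Real.pi / 2 - bet)) := by
  intro v hv
  have h := abs_im_corner (mem_ball_zero_iff.1 hv)
  have hd := (differentiableAt_densitySq_cosh h).comp v
    (f := fun v : ℂ => Complex.I * (bet - v)) (by fun_prop)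
  refine (hd.congr_of_eventuallyEq (Eventually.of_forall fun w => ?_)).differentiableWithinAt
  simp [cornerDensitySq_eq]

theorem cornerDensitySq_zero : cornerDensitySq 0 = 0 := by
  rw [cornerDensitySq, sub_zero, cos_bet_complex, densitySq]
  simp

/-- The derivative of `cornerDensitySq` at the corner. -/
noncomputable def cornerSlope : ℝ :=
  2 / 21 * (Real.sin bet * (kap + 1) / ((kap + poleM) * (kap + poleN)))

theorem cornerSlope_pos : 0 < cornerSlope := by
  have := sin_bet_pos
  have := kap_bounds.1
  have := poleM_bounds.1
  have := poleN_bounds.1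
  have : 0 < kap := by linarith
  have : 0 < poleM := by linarith
  have : 0 < poleN := by linarith
  unfold cornerSlope
  positivity

theorem hasDerivAt_cornerDensitySq_zero : HasDerivAt cornerDensitySq (cornerSlope : ℂ) 0 := by
  have hk := kap_bounds.1
  have hm := poleM_bounds.1
  have hn := poleN_bounds.1
  have hkr : 0 < ((kap : ℝ) : ℂ).re := by simpa using (by linarith : 0 < kap)
  have hne := densitySq_den_ne_zero hkr
  have h1 : HasDerivAt (fun C : ℂ => (C - kap) * (C + 1)) (kap + 1 : ℂ) (kap : ℂ) := by
    refine (((hasDerivAt_id (kap : ℂ)).sub_const (kap : ℂ)).mul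
      ((hasDerivAt_id (kap : ℂ)).add_const 1)).congr_deriv ?_
    simp
  have h2 : HasDerivAt (fun C : ℂ => (C + poleM) * (C + poleN)) (kap + poleN + (kap + poleM) : ℂ)
      (kap : ℂ) := by
    refine (((hasDerivAt_id (kap : ℂ)).add_const (poleM : ℂ)).mul
      ((hasDerivAt_id (kap : ℂ)).add_const (poleN : ℂ))).congr_deriv ?_
    simp
  have h3 : HasDerivAt densitySq (2 / 21 * ((kap + 1) / ((kap + poleM) * (kap + poleN))) : ℂ)
      (kap : ℂ) := by
    refine ((h1.div h2 hne).const_mul (2 / 21 : ℂ)).congr_deriv ?_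
    simp only [sub_self, zero_mul, sub_zero]
    field_simp
  have h4 : HasDerivAt densitySq (2 / 21 * ((kap + 1) / ((kap + poleM) * (kap + poleN))) : ℂ)
      ((fun v : ℂ => Complex.cos (bet - v)) 0) := by
    simpa only [sub_zero, cos_bet_complex] using h3
  refine (h4.comp 0 hasDerivAt_cos_bet_sub).congr_deriv ?_
  unfold cornerSlope
  push_cast
  ring

/-- The source of α³ = 1/2: the left side is the cube of dλ/dv at the corner, and
(4/9)·`cornerSlope` is the cube of the limit of (A − Im t)^{2/3}/v. It reduces to 7(1−κ)(κ+n) =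
(1+κ)². -/
theorem cornerSlope_relation :
    (-(2 * Real.sin bet / (1 + kap))) ^ 3 = -(27 / 2) * (4 / 9 * cornerSlope) := by
  have hk := kap_bounds.1
  have hm := poleM_bounds.1
  have hn := poleN_bounds.1
  have hsq : Real.sin bet ^ 2 = (1 - kap) * (1 + kap) := by
    have := Real.sin_sq_add_cos_sq bet
    rw [cos_bet] at this
    linarith
  have s2 : Real.sqrt 2 * Real.sqrt 2 = 2 := Real.mul_self_sqrt (by norm_num)
  have hk1 : 0 < 1 + kap := by linarith
  have hkm : kap + poleM = (1 + kap) / 2 := by linarith [one_sub_kap_eq]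
  have hkn : 0 < kap + poleN := by linarith
  have key : 7 * (1 - kap) * (kap + poleN) = (1 + kap) ^ 2 := by
    unfold kap poleN
    linear_combination 4 * s2
  have h3 : Real.sin bet ^ 3 = Real.sin bet * ((1 - kap) * (1 + kap)) := by
    rw [← hsq]
    ring
  unfold cornerSlope
  rw [hkm, neg_pow, div_pow, mul_pow, h3]
  field_simp
  linear_combination (-108 * Real.sin bet) * key

/-! ### The angle as a function of the time near the corner -/

theorem cornerDensitySq_ofReal (v : ℝ) : cornerDensitySq (v : ℂ) =
    ((2 / 21 * ((Real.cos (bet - v) - kap) * (Real.cos (bet - v) + 1) /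
      ((Real.cos (bet - v) + poleM) * (Real.cos (bet - v) + poleN))) : ℝ) : ℂ) := by
  rw [cornerDensitySq, densitySq]
  push_cast
  rfl

/-- The squared density divided by v extends analytically with positive value at the corner, so its
principal square root m is analytic in a small ball and the density is √v · m(v). -/
theorem exists_ball_cornerDensity : ∃ R > 0, R ≤ Real.pi / 2 - bet ∧
    ∃ m : ℂ → ℂ, DifferentiableOn ℂ m (Metric.ball 0 R) ∧ m 0 = (Real.sqrt cornerSlope : ℂ) ∧
      ∀ v : ℝ, 0 < v → v < bet → (Real.sqrt v : ℂ) * m v = (imagDensity (bet - v) : ℂ) := by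
  have hR0 : 0 < Real.pi / 2 - bet := by linarith [bet_lt]
  set G := dslope cornerDensitySq 0 with hG
  have hGd : DifferentiableOn ℂ G (Metric.ball 0 (Real.pi / 2 - bet)) :=
    (Complex.differentiableOn_dslope (Metric.ball_mem_nhds 0 hR0)).2
      differentiableOn_cornerDensitySq
  have hG0 : G 0 = (cornerSlope : ℂ) := by
    rw [hG, dslope_same, hasDerivAt_cornerDensitySq_zero.deriv]
  have hcont : ContinuousAt G 0 :=
    (hGd.differentiableAt (Metric.ball_mem_nhds 0 hR0)).continuousAt
  have hslit : ∀ᶠ z in 𝓝 (0 : ℂ), G z ∈ Complex.slitPlane := by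
    refine hcont.eventually (Complex.isOpen_slitPlane.mem_nhds ?_)
    rw [hG0]
    exact Complex.ofReal_mem_slitPlane.2 cornerSlope_pos
  obtain ⟨R1, hR1, hball⟩ := Metric.eventually_nhds_iff_ball.1 hslit
  refine ⟨min R1 (Real.pi / 2 - bet), lt_min hR1 hR0, min_le_right _ _,
    fun z => Complex.sqrt (G z), ?_, ?_, ?_⟩
  · intro z hz
    have hz1 := Metric.ball_subset_ball (min_le_left R1 _) hz
    have hz2 := Metric.ball_subset_ball (min_le_right R1 _) hz
    exact (DifferentiableAt.comp z (Complex.differentiableAt_sqrt (hball z hz1))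
      (hGd.differentiableAt (Metric.isOpen_ball.mem_nhds hz2))).differentiableWithinAt
  · simp only [hG0]
    exact Complex.sqrt_ofReal_of_nonneg cornerSlope_pos.le
  · intro v hv hvb
    have hmem : bet - v ∈ Icc 0 bet := ⟨by linarith, by linarith⟩
    have h1 := cos_sub_kap_nonneg hmem
    have h2 := kap_bounds.1
    have h3 := poleM_bounds.1
    have h4 := poleN_bounds.1
    have hvne : (v : ℂ) ≠ 0 := by exact_mod_cast hv.ne'
    have hGv : G v = ((2 / 21 * ((Real.cos (bet - v) - kap) * (Real.cos (bet - v) + 1) /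
      ((Real.cos (bet - v) + poleM) * (Real.cos (bet - v) + poleN))) / v : ℝ) : ℂ) := by
      rw [hG, dslope_of_ne _ hvne, slope_def_field, cornerDensitySq_zero, cornerDensitySq_ofReal,
        Complex.ofReal_div, sub_zero, sub_zero]
    have e1 : 0 ≤ 2 / 21 * ((Real.cos (bet - v) - kap) * (Real.cos (bet - v) + 1) /
      ((Real.cos (bet - v) + poleM) * (Real.cos (bet - v) + poleN))) := by
      have : 0 < Real.cos (bet - v) + 1 := by linarith
      have : 0 < Real.cos (bet - v) + poleM := by linarith
      have : 0 < Real.cos (bet - v) + poleN := by linarith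
      positivity
    simp only [hGv]
    rw [Complex.sqrt_ofReal_of_nonneg (div_nonneg e1 hv.le), ← Complex.ofReal_mul,
      ← Real.sqrt_mul hv.le, mul_div_cancel₀ _ hv.ne', imagDensity]

theorem segment_mem_ball {R : ℝ} {z : ℂ} (hz : z ∈ Metric.ball 0 R) :
    ∀ s ∈ Icc (0 : ℝ) 1, (s : ℂ) * z ∈ Metric.ball 0 R := by
  intro s hs
  rw [mem_ball_zero_iff] at hz ⊢
  rw [norm_mul, Complex.norm_real, Real.norm_of_nonneg hs.1]
  nlinarith [hs.2, norm_nonneg z]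

/-- Near the corner the time is `i (A - v ^ {3/2} n(v))` with `n` holomorphic. -/
theorem exists_cornerTime {A : ℝ} (hA : IsTimeWidth A) : ∃ R > 0, R ≤ Real.pi / 2 - bet ∧
    ∃ n : ℂ → ℂ, DifferentiableOn ℂ n (Metric.ball 0 R) ∧
      n 0 = ((2 / 3 * Real.sqrt cornerSlope : ℝ) : ℂ) ∧
      ∀ v : ℝ, 0 < v → v < bet → v < R →
        ((v * Real.sqrt v : ℝ) : ℂ) * n v = ((A - (timeMap ⟨0, bet - v⟩).im : ℝ) : ℂ) := by
  obtain ⟨R, hR, hR', m, hm, hm0, hmv⟩ := exists_ball_cornerDensity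
  set n : ℂ → ℂ := fun w => ∫ s in (0 : ℝ)..1, (Real.sqrt s : ℂ) * m (s * w) with hn
  have hder : ∀ z ∈ Metric.ball (0 : ℂ) R, ∃ n', HasDerivAt n n' z ∧ 3 / 2 * n z + z * n' = m z :=
    fun z hz => hasDerivAt_sqrtWeightedMean Metric.isOpen_ball hm (segment_mem_ball hz)
  refine ⟨R, hR, hR', n, fun z hz => ?_, ?_, ?_⟩
  · obtain ⟨n', h, -⟩ := hder z hz
    exact h.differentiableAt.differentiableWithinAt
  · obtain ⟨n', -, h⟩ := hder 0 (Metric.mem_ball_self hR)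
    rw [hm0] at h
    push_cast
    linear_combination 2 / 3 * h
  · set r := min bet R with hr
    have hr0 : 0 < r := lt_min bet_pos hR
    -- K is constant by the relation (3/2)n + vn′ = m, and it tends to A as v → 0⁺.
    set K : ℝ → ℂ := fun v => ((v * Real.sqrt v : ℝ) : ℂ) * n v +
      (((timeMap ⟨0, bet - v⟩).im : ℝ) : ℂ) with hK
    have hKd : ∀ v ∈ Ioo 0 r, HasDerivAt K 0 v := by
      intro v hv
      have hvb : v < bet := hv.2.trans_le (min_le_left _ _)
      have hvR : v < R := hv.2.trans_le (min_le_right _ _)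
      obtain ⟨n', h1, h2⟩ := hder v (by
        rw [mem_ball_zero_iff, Complex.norm_real, Real.norm_of_nonneg hv.1.le]
        exact hvR)
      have h3 : HasDerivAt (fun v : ℝ => v * Real.sqrt v) (3 / 2 * Real.sqrt v) v := by
        refine ((hasDerivAt_id v).mul (Real.hasDerivAt_sqrt hv.1.ne')).congr_deriv ?_
        have h3 := Real.sq_sqrt hv.1.le
        have h4 : Real.sqrt v ≠ 0 := (Real.sqrt_pos.2 hv.1).ne'
        simp only [id]
        field_simp
        nlinarith
      have h4 := h3.ofReal_comp.mul h1.comp_ofReal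
      have h5 : HasDerivAt (fun v : ℝ => bet - v) (-1) v := by
        simpa using (hasDerivAt_id v).const_sub bet
      have h6 := HasDerivAt.comp (h₂ := fun θ : ℝ => (timeMap ⟨0, θ⟩).im)
        (h := fun v : ℝ => bet - v) v
        (hasDerivAt_timeMap_imaginary_im (abs_lt.2 ⟨by linarith [hv.1, bet_pos], by
          linarith [hv.1]⟩)) h5
      refine (h4.add h6.ofReal_comp).congr_deriv ?_
      rw [timeDensity_imaginary ⟨by linarith, by linarith [hv.1]⟩, Complex.ofReal_re]
      have h7 := hmv v hv.1 hvb
      push_cast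
      rw [← h7, ← h2]
      ring
    have hlim : Tendsto K (𝓝[>] 0) (𝓝 (A : ℂ)) := by
      have h1 : Tendsto (fun v : ℝ => ((v * Real.sqrt v : ℝ) : ℂ) * n v) (𝓝[>] 0) (𝓝 0) := by
        obtain ⟨n', h, -⟩ := hder 0 (Metric.mem_ball_self hR)
        have hc : ContinuousAt (fun v : ℝ => ((v * Real.sqrt v : ℝ) : ℂ) * n v) 0 := by
          refine ContinuousAt.mul (Continuous.continuousAt (by fun_prop)) ?_
          exact ContinuousAt.comp (g := n) (by simpa using h.continuousAt)
            Complex.continuous_ofReal.continuousAt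
        have := hc.tendsto
        simp only [zero_mul, Complex.ofReal_zero] at this
        exact this.mono_left nhdsWithin_le_nhds
      have h2 : Tendsto (fun v : ℝ => bet - v) (𝓝[>] 0) (𝓝[<] bet) := by
        refine tendsto_nhdsWithin_iff.2 ⟨?_, ?_⟩
        · have : Tendsto (fun v : ℝ => bet - v) (𝓝 0) (𝓝 (bet - 0)) :=
            (Continuous.tendsto (by fun_prop) 0)
          rw [sub_zero] at this
          exact this.mono_left nhdsWithin_le_nhds
        · filter_upwards [self_mem_nhdsWithin] with v hv
          have : 0 < v := hv
          show bet - v < bet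
          linarith
      have h3 := (Complex.continuous_ofReal.tendsto A).comp (hA.comp h2)
      simpa [hK, Function.comp_def] using h1.add h3
    intro v hv hvb hvR
    have hvr : v ∈ Ioo 0 r := ⟨hv, lt_min hvb hvR⟩
    have hconst : ∀ w ∈ Ioo 0 r, K w = K v := fun w hw =>
      isOpen_Ioo.is_const_of_deriv_eq_zero isPreconnected_Ioo
        (fun x hx => (hKd x hx).differentiableAt.differentiableWithinAt)
        (fun x hx => (hKd x hx).deriv) hw hvr
    have hKv : K v = A := by
      refine tendsto_nhds_unique (tendsto_const_nhds.congr' ?_) hlim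
      filter_upwards [Ioo_mem_nhdsGT hr0] with w hw
      exact (hconst w hw).symm
    simp only [hK] at hKv
    push_cast at hKv ⊢
    linear_combination hKv

/-- Raising s = A − Im t = v^{3/2} n(v) to the power 2/3 gives s^{2/3} = v n(v)^{2/3} = ψ(v), with
ψ′(0) > 0. Then F is `cornerAngle` composed with the local inverse of ψ. -/
theorem exists_cornerExpansion {A : ℝ} (hA : IsTimeWidth A) : ∃ F : ℂ → ℂ, AnalyticAt ℂ F 0 ∧
    F 0 = (Real.pi : ℂ) ∧ (∃ d : ℝ, d ^ 3 = -(27 / 2) ∧ HasDerivAt F (d : ℂ) 0) ∧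
    ∃ r > 0, r ≤ bet ∧ ∀ v ∈ Ioo 0 r, angleFn ⟨0, bet - v⟩ =
      F (((A - (timeMap ⟨0, bet - v⟩).im : ℝ) : ℂ) ^ (2 / 3 : ℂ)) := by
  obtain ⟨R, hR, hR', n, hn, hn0, hnv⟩ := exists_cornerTime hA
  set a : ℝ := 2 / 3 * Real.sqrt cornerSlope with ha
  have ha0 : 0 < a := mul_pos (by norm_num) (Real.sqrt_pos.2 cornerSlope_pos)
  have hn0s : n 0 ∈ Complex.slitPlane := by
    rw [hn0]
    exact Complex.ofReal_mem_slitPlane.2 ha0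
  have hnat : AnalyticAt ℂ n 0 := hn.analyticAt (Metric.ball_mem_nhds 0 hR)
  set ψ : ℂ → ℂ := fun z => z * n z ^ (2 / 3 : ℂ) with hψ
  have hψan : AnalyticAt ℂ ψ 0 := analyticAt_id.mul (hnat.cpow analyticAt_const hn0s)
  set p : ℝ := a ^ (2 / 3 : ℝ) with hp
  have hp0 : 0 < p := Real.rpow_pos_of_pos ha0 _
  have hpow : n 0 ^ (2 / 3 : ℂ) = (p : ℂ) := by
    rw [hn0, hp, Complex.ofReal_cpow ha0.le]
    norm_num
  have hψd : HasDerivAt ψ (p : ℂ) 0 := by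
    have h1 := (hnat.cpow analyticAt_const hn0s (g := fun _ => (2 / 3 : ℂ))).differentiableAt.hasDerivAt
    refine ((hasDerivAt_id (0 : ℂ)).mul h1).congr_deriv ?_
    simp [hpow]
  have hev : ∀ᶠ z in 𝓝 (0 : ℂ), AnalyticAt ℂ ψ z ∧ 0 < (deriv ψ z).re ∧ ‖z‖ < R := by
    refine hψan.eventually_analyticAt.and (Eventually.and ?_ ?_)
    · have : ContinuousAt (fun z => (deriv ψ z).re) 0 :=
        Complex.continuous_re.continuousAt.comp hψan.deriv.continuousAt
      refine this.eventually (lt_mem_nhds ?_)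
      show 0 < (deriv ψ 0).re
      rw [hψd.deriv]
      exact hp0
    · filter_upwards [Metric.ball_mem_nhds (0 : ℂ) hR] with z hz
      exact mem_ball_zero_iff.1 hz
  obtain ⟨R2, hR2, hball⟩ := Metric.eventually_nhds_iff_ball.1 hev
  set B := Metric.ball (0 : ℂ) R2 with hB
  have h0B : (0 : ℂ) ∈ B := Metric.mem_ball_self hR2
  have hψB : DifferentiableOn ℂ ψ B := fun z hz =>
    (hball z hz).1.differentiableAt.differentiableWithinAt
  have hne : ∀ z ∈ B, deriv ψ z ≠ 0 := fun z hz h0 => by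
    have := (hball z hz).2.1
    simp [h0] at this
  have hinj : InjOn ψ B := injOn_of_re_deriv_pos (convex_ball 0 R2)
    (fun z hz => (hball z hz).1.differentiableAt.hasDerivAt) fun z hz => (hball z hz).2.1
  set E := Function.invFunOn ψ B with hE
  have hEψ : ∀ z ∈ B, E (ψ z) = z := fun z hz => hinj.leftInvOn_invFunOn hz
  have hEd : ∀ z ∈ B, HasDerivAt E (deriv ψ z)⁻¹ (ψ z) := fun z hz =>
    hasDerivAt_invFunOn Metric.isOpen_ball hψB hinj hz (hne z hz)
  have hopen : IsOpen (ψ '' B) := isOpen_image_of_deriv_ne_zero Metric.isOpen_ball hψB hne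
  have hψ0 : ψ 0 = 0 := by simp [hψ]
  have hca : ∀ z ∈ B, DifferentiableAt ℂ cornerAngle z := fun z hz =>
    DifferentiableAt.comp (f := fun v : ℂ => Complex.I * (bet - v)) z
      (differentiableAt_angleFn (abs_im_corner ((hball z hz).2.2.trans_le hR'))) (by fun_prop)
  have hFd : DifferentiableOn ℂ (cornerAngle ∘ E) (ψ '' B) := by
    rintro _ ⟨z, hz, rfl⟩
    refine (DifferentiableAt.comp (ψ z) ?_ (hEd z hz).differentiableAt).differentiableWithinAt
    rw [hEψ z hz]
    exact hca z hz
  refine ⟨cornerAngle ∘ E, hFd.analyticAt (hopen.mem_nhds ⟨0, h0B, hψ0⟩), ?_,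
    ⟨-(2 * Real.sin bet / (1 + kap)) * p⁻¹, ?_, ?_⟩, min bet R2, lt_min bet_pos hR2,
    min_le_left _ _, ?_⟩
  · have := hEψ 0 h0B
    rw [hψ0] at this
    rw [Function.comp_apply, this, cornerAngle_zero]
  · have hp3 : p ^ 3 = 4 / 9 * cornerSlope := by
      rw [hp, ← Real.rpow_natCast, ← Real.rpow_mul ha0.le]
      norm_num
      rw [ha, mul_pow, Real.sq_sqrt cornerSlope_pos.le]
      norm_num
    rw [mul_pow, cornerSlope_relation, inv_pow, hp3]
    have := cornerSlope_pos
    field_simp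
  · have h1 := hEd 0 h0B
    rw [hψ0, hψd.deriv] at h1
    have h2 := hEψ 0 h0B
    rw [hψ0] at h2
    have h3 : HasDerivAt cornerAngle ((-(2 * Real.sin bet / (1 + kap)) : ℝ) : ℂ) (E 0) := by
      rw [h2]
      exact hasDerivAt_cornerAngle_zero
    refine (h3.comp 0 h1).congr_deriv ?_
    push_cast
    ring
  · intro v hv
    have hvb : v < bet := hv.2.trans_le (min_le_left _ _)
    have hvB : (v : ℂ) ∈ B := by
      rw [hB, mem_ball_zero_iff, Complex.norm_real, Real.norm_of_nonneg hv.1.le]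
      exact hv.2.trans_le (min_le_right _ _)
    have hvR : v < R := by
      have := (hball v hvB).2.2
      rwa [Complex.norm_real, Real.norm_of_nonneg hv.1.le] at this
    have h1 := hnv v hv.1 hvb hvR
    set s := A - (timeMap ⟨0, bet - v⟩).im with hs
    have hs0 : 0 < s := by
      have := timeMap_imaginary_im_lt hA (θ := bet - v) (by linarith) (by linarith [hv.1])
      linarith
    have hvv : 0 < v * Real.sqrt v := mul_pos hv.1 (Real.sqrt_pos.2 hv.1)
    have h2 : n v = ((s / (v * Real.sqrt v) : ℝ) : ℂ) := by
      rw [Complex.ofReal_div, ← h1, mul_div_cancel_left₀]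
      exact_mod_cast hvv.ne'
    have h3 : ψ v = (s : ℂ) ^ (2 / 3 : ℂ) := by
      have e : (2 / 3 : ℂ) = ((2 / 3 : ℝ) : ℂ) := by norm_num
      simp only [hψ]
      rw [h2, e, ← Complex.ofReal_cpow (by positivity), ← Complex.ofReal_cpow hs0.le,
        ← Complex.ofReal_mul, Real.div_rpow hs0.le hvv.le]
      congr 1
      have h4 : (v * Real.sqrt v) ^ (2 / 3 : ℝ) = v := by
        have : v * Real.sqrt v = v ^ (3 / 2 : ℝ) := by
          rw [Real.sqrt_eq_rpow]
          nth_rewrite 1 [← Real.rpow_one v]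
          rw [← Real.rpow_add hv.1]
          norm_num
        rw [this, ← Real.rpow_mul hv.1.le]
        norm_num
      rw [h4]
      have := hv.1.ne'
      field_simp
    rw [← h3, Function.comp_apply, hEψ _ hvB, cornerAngle]
    congr 1
    apply Complex.ext <;> simp

/-! ### Branches of powers and expansions at a branch point -/

theorem I_mul_polarPoint_sub (c : ℂ) {r : ℝ} (hr : 0 < r) (θ : ℝ) :
    Complex.I * (polarPoint c r θ - c) =
      Complex.exp ((Real.log r : ℂ) + ((θ + Real.pi / 2 : ℝ) : ℂ) * Complex.I) := by
  have h1 : Complex.exp ((Real.pi / 2 : ℂ) * Complex.I) = Complex.I := by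
    rw [Complex.exp_mul_I]
    simp
  rw [Complex.exp_add, ← Complex.ofReal_exp, Real.exp_log hr]
  push_cast
  rw [add_mul, Complex.exp_add, h1, polarPoint]
  ring

/-- For θ in (−3π/2, π/2) the angle θ + π/2 lies in (−π, π): multiplication by i turns the
prescribed determination into the principal branch. -/
theorem log_I_mul_polarPoint_sub (c : ℂ) {r : ℝ} (hr : 0 < r) {θ : ℝ}
    (hθ : θ ∈ Ioo (-(3 * Real.pi / 2)) (Real.pi / 2)) :
    Complex.log (Complex.I * (polarPoint c r θ - c)) =
      (Real.log r : ℂ) + ((θ + Real.pi / 2 : ℝ) : ℂ) * Complex.I := by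
  have him : ((Real.log r : ℂ) + ((θ + Real.pi / 2 : ℝ) : ℂ) * Complex.I).im = θ + Real.pi / 2 := by
    rw [Complex.add_im, Complex.ofReal_im, Complex.im_ofReal_mul, Complex.I_im]
    ring
  rw [I_mul_polarPoint_sub c hr, Complex.log_exp]
  · rw [him]
    linarith [hθ.1]
  · rw [him]
    linarith [hθ.2]

theorem I_mul_polarPoint_sub_mem (c : ℂ) {r : ℝ} (hr : 0 < r) {θ : ℝ}
    (hθ : θ ∈ Ioo (-(3 * Real.pi / 2)) (Real.pi / 2)) :
    Complex.I * (polarPoint c r θ - c) ∈ Complex.slitPlane := by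
  have h1 : Complex.I * (polarPoint c r θ - c) ≠ 0 := by
    rw [I_mul_polarPoint_sub c hr]
    exact Complex.exp_ne_zero _
  refine Complex.mem_slitPlane_iff_arg.2 ⟨?_, h1⟩
  rw [← Complex.log_im, log_I_mul_polarPoint_sub c hr hθ, Complex.add_im, Complex.ofReal_im,
    Complex.im_ofReal_mul, Complex.I_im]
  have := hθ.2
  intro h
  linarith

theorem I_mul_polarPoint_sub_cpow (c : ℂ) {r : ℝ} (hr : 0 < r) {θ : ℝ}
    (hθ : θ ∈ Ioo (-(3 * Real.pi / 2)) (Real.pi / 2)) (s : ℝ) :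
    (Complex.I * (polarPoint c r θ - c)) ^ (s : ℂ) =
      polarPow r θ s * Complex.exp ((s * (Real.pi / 2) : ℝ) * Complex.I) := by
  have h1 := Complex.slitPlane_ne_zero (I_mul_polarPoint_sub_mem c hr hθ)
  rw [Complex.cpow_def_of_ne_zero h1, log_I_mul_polarPoint_sub c hr hθ, polarPow,
    Real.rpow_def_of_pos hr, Complex.ofReal_exp, ← Complex.exp_add, ← Complex.exp_add]
  congr 1
  push_cast
  ring

theorem norm_polarPow {r : ℝ} (hr : 0 < r) (θ s : ℝ) : ‖polarPow r θ s‖ = r ^ s := by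
  have h : (s : ℂ) * (θ : ℂ) * Complex.I = ((s * θ : ℝ) : ℂ) * Complex.I := by push_cast; ring
  rw [polarPow, norm_mul, h, Complex.norm_exp_ofReal_mul_I, mul_one, Complex.norm_real,
    Real.norm_of_nonneg (Real.rpow_nonneg hr.le s)]

theorem norm_polarPoint_sub (c : ℂ) {r : ℝ} (hr : 0 < r) (θ : ℝ) : ‖polarPoint c r θ - c‖ = r := by
  rw [polarPoint, add_sub_cancel_left, norm_mul, Complex.norm_exp_ofReal_mul_I, mul_one,
    Complex.norm_real, Real.norm_of_nonneg hr.le]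

theorem conj_exp_ofReal_mul_I (x : ℝ) : starRingEnd ℂ (Complex.exp ((x : ℂ) * Complex.I)) =
    Complex.exp (((-x : ℝ) : ℂ) * Complex.I) := by
  rw [← Complex.exp_conj]
  simp

theorem conj_polarPoint (c : ℂ) (r θ : ℝ) :
    starRingEnd ℂ (polarPoint c r θ) = polarPoint (starRingEnd ℂ c) r (-θ) := by
  simp only [polarPoint, map_add, map_mul, Complex.conj_ofReal]
  rw [conj_exp_ofReal_mul_I]

theorem conj_polarPow (r θ s : ℝ) : starRingEnd ℂ (polarPow r θ s) = polarPow r (-θ) s := by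
  have h : ∀ θ : ℝ, (s : ℂ) * (θ : ℂ) * Complex.I = ((s * θ : ℝ) : ℂ) * Complex.I := fun θ => by
    push_cast; ring
  simp only [polarPow, map_mul, Complex.conj_ofReal]
  rw [h, h, conj_exp_ofReal_mul_I]
  ring_nf

theorem HasBranchExpansion.congr {σ σ' : ℂ → ℂ × ℂ} {c : ℂ} {ν θ₁ θ₂ : ℝ} {α : ℂ}
    (h : HasBranchExpansion σ c ν θ₁ θ₂ α) (he : EqOn σ σ' (sector c ν θ₁ θ₂)) :
    HasBranchExpansion σ' c ν θ₁ θ₂ α := by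
  obtain ⟨C, hC⟩ := h
  refine ⟨C, fun r hr θ hθ => ?_⟩
  rw [← he ⟨r, hr, θ, hθ, rfl⟩]
  exact hC r hr θ hθ

theorem HasBranchExpansion.conj {σ : ℂ → ℂ × ℂ} {c : ℂ} {ν θ₁ θ₂ : ℝ} {α : ℂ}
    (h : HasBranchExpansion σ c ν θ₁ θ₂ α) :
    HasBranchExpansion (fun t => (starRingEnd ℂ (σ (starRingEnd ℂ t)).1,
      starRingEnd ℂ (σ (starRingEnd ℂ t)).2)) (starRingEnd ℂ c) ν (-θ₂) (-θ₁)
      (starRingEnd ℂ α) := by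
  obtain ⟨C, hC⟩ := h
  refine ⟨C, fun r hr θ hθ => ?_⟩
  obtain ⟨h1, h2⟩ := hC r hr (-θ) ⟨by linarith [hθ.2], by linarith [hθ.1]⟩
  rw [← Complex.norm_conj] at h1 h2
  simp only [map_sub, map_add, map_mul, map_neg, map_div₀, Complex.conj_ofReal, conj_polarPow,
    Complex.conj_ofNat, neg_neg] at h1 h2
  simp only [conj_polarPoint, Complex.conj_conj]
  exact ⟨h1, h2⟩

/-- The second component blows up at a branch point. -/
theorem HasBranchExpansion.not_analytic {σ : ℂ → ℂ × ℂ} {c : ℂ} {ν θ₁ θ₂ : ℝ} {α : ℂ}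
    (h : HasBranchExpansion σ c ν θ₁ θ₂ α) (hα : α ≠ 0) (hν : 0 < ν) {θ : ℝ}
    (hθ : θ ∈ Ioo θ₁ θ₂) {Ω : Set ℂ} (hΩ : ∀ᶠ r in 𝓝[>] (0 : ℝ), polarPoint c r θ ∈ Ω) :
    ¬ ∃ g : ℂ → ℂ × ℂ, AnalyticAt ℂ g c ∧ ∀ᶠ t in 𝓝[Ω] c, g t = σ t := by
  rintro ⟨g, hg, hgσ⟩
  obtain ⟨C, hC⟩ := h
  have hpc : Tendsto (fun r : ℝ => polarPoint c r θ) (𝓝[>] 0) (𝓝 c) := by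
    have : Continuous fun r : ℝ => polarPoint c r θ := by
      unfold polarPoint
      fun_prop
    have h2 := this.tendsto 0
    simp only [polarPoint, Complex.ofReal_zero, zero_mul, add_zero] at h2
    exact h2.mono_left nhdsWithin_le_nhds
  have hpΩ : Tendsto (fun r : ℝ => polarPoint c r θ) (𝓝[>] 0) (𝓝[Ω] c) :=
    tendsto_nhdsWithin_iff.2 ⟨hpc, hΩ⟩
  have hbd : Tendsto (fun r : ℝ => ‖(g (polarPoint c r θ)).2‖) (𝓝[>] 0) (𝓝 ‖(g c).2‖) :=
    ((hg.continuousAt.snd).norm.tendsto).comp hpc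
  -- For r ≤ 1 the remainder is at most |C|, so the leading term r^{−1/3} drives the second
  -- component to infinity.
  have hblow : Tendsto (fun r : ℝ => ‖2 * α / 3‖ * r ^ (-(1 / 3) : ℝ) - |C|) (𝓝[>] 0) atTop := by
    have h1 : Tendsto (fun r : ℝ => r ^ (-(1 / 3) : ℝ)) (𝓝[>] 0) atTop :=
      tendsto_rpow_neg_nhdsGT_zero (by norm_num)
    have h2 : 0 < ‖2 * α / 3‖ := norm_pos_iff.2 (by simpa using hα)
    exact tendsto_atTop_add_const_right _ _ (h1.const_mul_atTop h2)
  have hle : ∀ᶠ r in 𝓝[>] (0 : ℝ), ‖2 * α / 3‖ * r ^ (-(1 / 3) : ℝ) - |C| ≤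
      ‖(g (polarPoint c r θ)).2‖ := by
    filter_upwards [hpΩ.eventually hgσ, Ioo_mem_nhdsGT (lt_min hν one_pos)] with r hr1 hr2
    have hrν : r ∈ Ioo 0 ν := ⟨hr2.1, hr2.2.trans_le (min_le_left _ _)⟩
    have hr1' : r ≤ 1 := (hr2.2.trans_le (min_le_right _ _)).le
    have h1 := (hC r hrν θ hθ).2
    rw [← hr1] at h1
    have h2 : C * r ^ (1 / 3 : ℝ) ≤ |C| := by
      have h3 : r ^ (1 / 3 : ℝ) ≤ 1 := Real.rpow_le_one hr2.1.le hr1' (by norm_num)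
      have h4 : 0 ≤ r ^ (1 / 3 : ℝ) := Real.rpow_nonneg hr2.1.le _
      calc C * r ^ (1 / 3 : ℝ) ≤ |C| * r ^ (1 / 3 : ℝ) :=
            mul_le_mul_of_nonneg_right (le_abs_self C) h4
        _ ≤ |C| * 1 := mul_le_mul_of_nonneg_left h3 (abs_nonneg C)
        _ = |C| := mul_one _
    have h5 : ‖-(2 * α / 3) * polarPow r θ (-(1 / 3))‖ = ‖2 * α / 3‖ * r ^ (-(1 / 3) : ℝ) := by
      rw [norm_mul, norm_neg, norm_polarPow hr2.1]
    have h6 := norm_sub_norm_le (-(2 * α / 3) * polarPow r θ (-(1 / 3))) (g (polarPoint c r θ)).2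
    rw [norm_sub_rev] at h6
    linarith
  exact not_tendsto_nhds_of_tendsto_atTop (tendsto_atTop_mono' _ hle hblow) _ hbd

/-- Uniform first order bounds for an analytic function and its derivative. -/
theorem AnalyticAt.exists_taylor_bounds {F : ℂ → ℂ} {d : ℂ} (hF : AnalyticAt ℂ F 0)
    (hd : HasDerivAt F d 0) : ∃ ρ > 0, ∃ C : ℝ, 0 ≤ C ∧ ∀ q ∈ Metric.ball (0 : ℂ) ρ,
      AnalyticAt ℂ F q ∧ ‖deriv F q - d‖ ≤ C * ‖q‖ ∧ ‖F q - (F 0 + d * q)‖ ≤ C * ‖q‖ ^ 2 := by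
  have hO := hF.deriv.differentiableAt.hasDerivAt.isBigO_sub
  rw [hd.deriv] at hO
  obtain ⟨C, hC0, hC⟩ := hO.exists_nonneg
  obtain ⟨ρ, hρ, hball⟩ := Metric.eventually_nhds_iff_ball.1 (hF.eventually_analyticAt.and hC.bound)
  refine ⟨ρ, hρ, C, hC0, fun q hq => ⟨(hball q hq).1, by simpa using (hball q hq).2, ?_⟩⟩
  have hsub : Metric.closedBall (0 : ℂ) ‖q‖ ⊆ Metric.ball 0 ρ :=
    Metric.closedBall_subset_ball (mem_ball_zero_iff.1 hq)
  have h := (convex_closedBall (0 : ℂ) ‖q‖).norm_image_sub_le_of_norm_hasDerivWithin_le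
    (f := fun z => F z - d * z) (f' := fun z => deriv F z - d) (C := C * ‖q‖) (x := 0) (y := q)
    (fun z hz => by
      have h1 : HasDerivAt (fun z => F z - d * z) (deriv F z - d * 1) z :=
        ((hball z (hsub hz)).1.differentiableAt.hasDerivAt).sub ((hasDerivAt_id z).const_mul d)
      rw [mul_one] at h1
      exact h1.hasDerivWithinAt)
    (fun z hz => by
      have h1 := (hball z (hsub hz)).2
      rw [sub_zero] at h1
      exact h1.trans (mul_le_mul_of_nonneg_left (mem_closedBall_zero_iff.1 hz) hC0))
    (Metric.mem_closedBall_self (norm_nonneg q)) (by simp)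
  simp only [mul_zero, sub_zero] at h
  calc ‖F q - (F 0 + d * q)‖ = ‖F q - d * q - F 0‖ := by congr 1; ring
    _ ≤ C * ‖q‖ * ‖q‖ := h
    _ = C * ‖q‖ ^ 2 := by ring

/-- The disc of radius `ν` around `c` slit along the upward ray. -/
def slitDisc (c : ℂ) (ν : ℝ) : Set ℂ := {t | ‖t - c‖ < ν ∧ Complex.I * (t - c) ∈ Complex.slitPlane}

theorem isOpen_slitDisc (c : ℂ) (ν : ℝ) : IsOpen (slitDisc c ν) := by
  have h : slitDisc c ν =
      {t | ‖t - c‖ < ν} ∩ (fun t => Complex.I * (t - c)) ⁻¹' Complex.slitPlane := rfl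
  rw [h]
  exact (isOpen_lt (by fun_prop) continuous_const).inter
    (Complex.isOpen_slitPlane.preimage (by fun_prop))

theorem sector_subset_slitDisc (c : ℂ) (ν : ℝ) :
    sector c ν (-(3 * Real.pi / 2)) (Real.pi / 2) ⊆ slitDisc c ν := by
  rintro _ ⟨r, hr, θ, hθ, rfl⟩
  refine ⟨?_, I_mul_polarPoint_sub_mem c hr.1 hθ⟩
  rw [norm_polarPoint_sub c hr.1]
  exact hr.2

/-- The function `F ((i (t - c)) ^ {2/3})`. -/
noncomputable def twoThirds (F : ℂ → ℂ) (c t : ℂ) : ℂ := F ((Complex.I * (t - c)) ^ (2 / 3 : ℂ))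

theorem hasDerivAt_twoThirds {F : ℂ → ℂ} {c : ℂ} {t : ℂ}
    (ht : Complex.I * (t - c) ∈ Complex.slitPlane)
    (hF : DifferentiableAt ℂ F ((Complex.I * (t - c)) ^ (2 / 3 : ℂ))) :
    HasDerivAt (twoThirds F c) (deriv F ((Complex.I * (t - c)) ^ (2 / 3 : ℂ)) *
      (2 / 3 * (Complex.I * (t - c)) ^ (-(1 / 3) : ℂ) * Complex.I)) t := by
  have h1 : HasDerivAt (fun t : ℂ => Complex.I * (t - c)) Complex.I t := by
    simpa using ((hasDerivAt_id t).sub_const c).const_mul Complex.I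
  have h2 := h1.cpow_const (c := (2 / 3 : ℂ)) ht
  rw [show (2 / 3 - 1 : ℂ) = -(1 / 3) by norm_num] at h2
  exact HasDerivAt.comp (h₂ := F) t hF.hasDerivAt h2

theorem norm_twoThirds_arg {c t : ℂ} : ‖(Complex.I * (t - c)) ^ (2 / 3 : ℂ)‖ =
    ‖t - c‖ ^ (2 / 3 : ℝ) := by
  have e : (2 / 3 : ℂ) = ((2 / 3 : ℝ) : ℂ) := by norm_num
  rw [e, Complex.norm_cpow_real, norm_mul, Complex.norm_I, one_mul]

/-- Since (i(t−c))^{2/3} = e^{iπ/3}(t−c)^{2/3}, the linear term of F yields the stated coefficient.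
The error in the derivative is r^{−1/3} times O(r^{2/3}). -/
theorem hasBranchExpansion_twoThirds {F : ℂ → ℂ} {d : ℂ} {ρ C : ℝ} (hC : 0 ≤ C)
    (hF : ∀ q ∈ Metric.ball (0 : ℂ) ρ, AnalyticAt ℂ F q ∧ ‖deriv F q - d‖ ≤ C * ‖q‖ ∧
      ‖F q - (F 0 + d * q)‖ ≤ C * ‖q‖ ^ 2) (hF0 : F 0 = (Real.pi : ℂ)) {ν : ℝ}
    (hν : ∀ r ∈ Ioo 0 ν, r ^ (2 / 3 : ℝ) < ρ) (c : ℂ) :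
    HasBranchExpansion (fun t => (twoThirds F c t, -(1 / 3) * deriv (twoThirds F c) t)) c ν
      (-(3 * Real.pi / 2)) (Real.pi / 2)
      (d * Complex.exp ((Real.pi / 3 : ℝ) * Complex.I) / 3) := by
  refine ⟨C, fun r hr θ hθ => ?_⟩
  have hslit := I_mul_polarPoint_sub_mem c hr.1 hθ
  set q := (Complex.I * (polarPoint c r θ - c)) ^ (2 / 3 : ℂ) with hq
  have hqn : ‖q‖ = r ^ (2 / 3 : ℝ) := by
    rw [hq, norm_twoThirds_arg, norm_polarPoint_sub c hr.1]
  have hqb : q ∈ Metric.ball (0 : ℂ) ρ := by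
    rw [mem_ball_zero_iff, hqn]
    exact hν r hr
  obtain ⟨h1, h2, h3⟩ := hF q hqb
  have hqe : q = polarPow r θ (2 / 3) * Complex.exp ((Real.pi / 3 : ℝ) * Complex.I) := by
    have := I_mul_polarPoint_sub_cpow c hr.1 hθ (2 / 3)
    rw [show (((2 / 3 : ℝ) : ℂ)) = 2 / 3 by norm_num,
      show (2 / 3 * (Real.pi / 2) : ℝ) = Real.pi / 3 by ring] at this
    exact this
  have hinv : (Complex.I * (polarPoint c r θ - c)) ^ (-(1 / 3) : ℂ) =
      polarPow r θ (-(1 / 3)) * Complex.exp ((-(Real.pi / 6) : ℝ) * Complex.I) := by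
    have := I_mul_polarPoint_sub_cpow c hr.1 hθ (-(1 / 3))
    rw [show (((-(1 / 3) : ℝ) : ℂ)) = -(1 / 3) by norm_num,
      show (-(1 / 3) * (Real.pi / 2) : ℝ) = -(Real.pi / 6) by ring] at this
    exact this
  -- The factor i from differentiating i(t−c) combines with i^{−1/3} into i^{2/3}, so the same
  -- coefficient governs both components.
  have hI : Complex.exp ((-(Real.pi / 6) : ℝ) * Complex.I) * Complex.I =
      Complex.exp ((Real.pi / 3 : ℝ) * Complex.I) := by
    have e : Complex.exp ((Real.pi / 2 : ℝ) * Complex.I) = Complex.I := by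
      rw [Complex.exp_mul_I]
      simp
    nth_rewrite 2 [← e]
    rw [← Complex.exp_add]
    congr 1
    push_cast
    ring
  constructor
  · have e1 : (Real.pi : ℂ) + 3 * (d * Complex.exp ((Real.pi / 3 : ℝ) * Complex.I) / 3) *
        polarPow r θ (2 / 3) = F 0 + d * q := by
      rw [hF0, hqe]
      ring
    have e2 : ‖q‖ ^ 2 = r ^ (4 / 3 : ℝ) := by
      rw [hqn, ← Real.rpow_natCast, ← Real.rpow_mul hr.1.le]
      norm_num
    rw [e1, ← e2]
    exact h3
  · have hd := (hasDerivAt_twoThirds hslit h1.differentiableAt).deriv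
    have e1 : -(1 / 3) * deriv (twoThirds F c) (polarPoint c r θ) -
        -(2 * (d * Complex.exp ((Real.pi / 3 : ℝ) * Complex.I) / 3) / 3) *
          polarPow r θ (-(1 / 3)) =
        -(2 / 9) * (polarPow r θ (-(1 / 3)) * Complex.exp ((Real.pi / 3 : ℝ) * Complex.I)) *
          (deriv F q - d) := by
      rw [hd, hinv, ← hI]
      ring
    have e3 : ‖(-(2 / 9) : ℂ)‖ = 2 / 9 := by norm_num
    show ‖-(1 / 3) * deriv (twoThirds F c) (polarPoint c r θ) -
        -(2 * (d * Complex.exp ((Real.pi / 3 : ℝ) * Complex.I) / 3) / 3) *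
          polarPow r θ (-(1 / 3))‖ ≤ _
    rw [e1, norm_mul, norm_mul, norm_mul, norm_polarPow hr.1, Complex.norm_exp_ofReal_mul_I, e3]
    have e2 : r ^ (-(1 / 3) : ℝ) * r ^ (2 / 3 : ℝ) = r ^ (1 / 3 : ℝ) := by
      rw [← Real.rpow_add hr.1]
      norm_num
    have hr3 : 0 < r ^ (-(1 / 3) : ℝ) := Real.rpow_pos_of_pos hr.1 _
    rw [hqn] at h2
    calc 2 / 9 * (r ^ (-(1 / 3) : ℝ) * 1) * ‖deriv F q - d‖
        ≤ 2 / 9 * (r ^ (-(1 / 3) : ℝ) * 1) * (C * r ^ (2 / 3 : ℝ)) :=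
          mul_le_mul_of_nonneg_left h2 (by positivity)
      _ = 2 / 9 * (C * r ^ (1 / 3 : ℝ)) := by rw [← e2]; ring
      _ ≤ C * r ^ (1 / 3 : ℝ) := by
          have : 0 ≤ C * r ^ (1 / 3 : ℝ) := mul_nonneg hC (Real.rpow_nonneg hr.1.le _)
          linarith

/-! ### The complex separatrix -/

/-- The angle of the separatrix as a function of complex time. -/
noncomputable def angleExt (w : ℂ) : ℂ := angleFn (timeInv w)

theorem analyticOnNhd_angleExt : AnalyticOnNhd ℂ angleExt (timeMap '' innerStrip) := by
  refine DifferentiableOn.analyticOnNhd (fun w hw => ?_) isOpen_timeMap_image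
  have h1 : DifferentiableAt ℂ timeInv w :=
    differentiableOn_timeInv.differentiableAt (isOpen_timeMap_image.mem_nhds hw)
  have h2 : |(timeInv w).im| < bet := timeInv_mem hw
  exact (DifferentiableAt.comp (g := angleFn) w (differentiableAt_angleFn (h2.trans bet_lt))
    h1).differentiableWithinAt

theorem complexStrip_subset_timeMap_image {A : ℝ} (hA : IsTimeWidth A) :
    complexStrip A ⊆ timeMap '' innerStrip := fun _ ht =>
  mem_timeMap_image hA (le_of_lt ht) fun _ => ht

theorem isOpen_complexStrip (a : ℝ) : IsOpen (complexStrip a) :=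
  isOpen_lt (by fun_prop) continuous_const

theorem convex_complexStrip (a : ℝ) : Convex ℝ (complexStrip a) := by
  have h : complexStrip a = Complex.imLm ⁻¹' Ioo (-a) a := by
    ext t
    simp [complexStrip, abs_lt]
  rw [h]
  exact (convex_Ioo _ _).linear_preimage _

theorem angleExt_ofReal {l L : ℝ → ℝ} (h : IsRightSeparatrix l L) (t : ℝ) :
    angleExt (t : ℂ) = l t := by
  obtain ⟨y, hy⟩ := h.exists_uniformization
  obtain ⟨h1, h2⟩ := hy t
  have h3 : (y t : ℂ) ∈ innerStrip := by
    simp [innerStrip, bet_pos]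
  rw [angleExt, ← h1, timeInv_timeMap h3]
  exact angleFn_ofReal ⟨h.angle_pos t, (h.angle_mem t).2⟩ h2

/-- Schwarz reflection: both functions are analytic on the connected strip and agree on the real
axis. -/
theorem eqOn_conj_of_real_on_real {f : ℂ → ℂ} {a : ℝ} (ha : 0 < a)
    (hf : AnalyticOnNhd ℂ f (complexStrip a))
    (hr : ∀ t : ℝ, starRingEnd ℂ (f t) = f t) :
    EqOn (starRingEnd ℂ ∘ f ∘ starRingEnd ℂ) f (complexStrip a) := by
  have hg : AnalyticOnNhd ℂ (starRingEnd ℂ ∘ f ∘ starRingEnd ℂ) (complexStrip a) := by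
    refine DifferentiableOn.analyticOnNhd (fun t ht => ?_) (isOpen_complexStrip a)
    have h1 : starRingEnd ℂ t ∈ complexStrip a := by
      simpa [complexStrip] using ht
    exact (differentiableAt_conj_conj_iff.2 (hf _ h1).differentiableAt).differentiableWithinAt
  refine hg.eqOn_of_preconnected_of_frequently_eq hf (convex_complexStrip a).isPreconnected
    (z₀ := ((0 : ℝ) : ℂ)) (by simpa [complexStrip] using ha) ?_
  have h1 : Tendsto (fun x : ℝ => (x : ℂ)) (𝓝[≠] (0 : ℝ)) (𝓝[≠] ((0 : ℝ) : ℂ)) :=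
    ((hasDerivAt_id (0 : ℝ)).ofReal_comp).tendsto_nhdsNE (by simp)
  refine h1.frequently (Eventually.frequently (Eventually.of_forall fun x => ?_))
  simp [hr x]

theorem analyticAt_twoThirds {F : ℂ → ℂ} {ρ ν : ℝ}
    (hF : ∀ q ∈ Metric.ball (0 : ℂ) ρ, AnalyticAt ℂ F q)
    (hν : ∀ r ∈ Ioo 0 ν, r ^ (2 / 3 : ℝ) < ρ) (c : ℂ) :
    AnalyticOnNhd ℂ (twoThirds F c) (slitDisc c ν) := by
  refine DifferentiableOn.analyticOnNhd (fun t ht => ?_) (isOpen_slitDisc c ν)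
  have h0 : 0 < ‖t - c‖ := by
    rw [norm_pos_iff]
    intro h
    have h1 := Complex.slitPlane_ne_zero ht.2
    simp [h] at h1
  have hq : (Complex.I * (t - c)) ^ (2 / 3 : ℂ) ∈ Metric.ball (0 : ℂ) ρ := by
    rw [mem_ball_zero_iff, norm_twoThirds_arg]
    exact hν _ ⟨h0, ht.1⟩
  exact (hasDerivAt_twoThirds ht.2 (hF _ hq).differentiableAt).differentiableAt.differentiableWithinAt

theorem lower_half_subset_slitDisc {A ν : ℝ} :
    Metric.ball ((A : ℂ) * Complex.I) ν ∩ {t | t.im < A} ⊆ slitDisc (A * Complex.I) ν := by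
  rintro t ⟨h1, h2⟩
  have h3 : t.im < A := h2
  refine ⟨by simpa [dist_eq_norm] using h1, Or.inl ?_⟩
  simpa using h3

theorem im_pos_of_mem_slitDisc {A ν : ℝ} (hν : ν ≤ A) {t : ℂ}
    (ht : ‖t - A * Complex.I‖ < ν) : 0 < t.im := by
  have h1 := Complex.abs_im_le_norm (t - A * Complex.I)
  have h2 : (t - A * Complex.I).im = t.im - A := by simp
  rw [h2] at h1
  linarith [(abs_le.1 h1).1]

/-- The expansion along the imaginary axis propagates to a half disc. -/
theorem eqOn_angleExt_twoThirds {A : ℝ} (hA : IsTimeWidth A) {F : ℂ → ℂ} {r ν : ℝ} (hr : 0 < r)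
    (hrb : r ≤ bet) (hF : ∀ v ∈ Ioo 0 r, angleFn ⟨0, bet - v⟩ =
      F (((A - (timeMap ⟨0, bet - v⟩).im : ℝ) : ℂ) ^ (2 / 3 : ℂ))) (hν : 0 < ν) (hνA : ν ≤ A)
    (hd : AnalyticOnNhd ℂ (twoThirds F (A * Complex.I)) (slitDisc (A * Complex.I) ν)) :
    EqOn angleExt (twoThirds F (A * Complex.I))
      (Metric.ball ((A : ℂ) * Complex.I) ν ∩ {t | t.im < A}) := by
  have hmem : ∀ v ∈ Ioo 0 r, |bet - v| < bet := fun v hv => by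
    rw [abs_lt]
    constructor <;> linarith [hv.1, hv.2, bet_pos]
  have hval : ∀ v ∈ Ioo 0 r,
      timeMap ⟨0, bet - v⟩ = ((timeMap ⟨0, bet - v⟩).im : ℂ) * Complex.I := fun v hv => by
    apply Complex.ext <;> simp [timeMap_imaginary_re (hmem v hv)]
  have heq : ∀ v ∈ Ioo 0 r, angleExt (timeMap ⟨0, bet - v⟩) =
      twoThirds F (A * Complex.I) (timeMap ⟨0, bet - v⟩) := fun v hv => by
    rw [angleExt, timeInv_timeMap (mk_mem_innerStrip (hmem v hv)), hF v hv, twoThirds]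
    nth_rewrite 2 [hval v hv]
    rw [show Complex.I * (((timeMap ⟨0, bet - v⟩).im : ℂ) * Complex.I - A * Complex.I) =
      ((A - (timeMap ⟨0, bet - v⟩).im : ℝ) : ℂ) by
        push_cast
        linear_combination ((timeMap ⟨0, bet - v⟩).im - (A : ℂ)) * Complex.I_mul_I]
  have hconv : Convex ℝ (Metric.ball ((A : ℂ) * Complex.I) ν ∩ {t | t.im < A}) :=
    (convex_ball _ _).inter (convex_halfSpace_im_lt A)
  have hsub : Metric.ball ((A : ℂ) * Complex.I) ν ∩ {t | t.im < A} ⊆ complexStrip A := by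
    rintro t ⟨h1, h2⟩
    have h3 : ‖t - A * Complex.I‖ < ν := by simpa [dist_eq_norm] using h1
    have h4 := im_pos_of_mem_slitDisc hνA h3
    have h5 : t.im < A := h2
    exact abs_lt.2 ⟨by linarith, h5⟩
  have hev : ∀ᶠ θ in 𝓝[<] bet, A - ν < (timeMap ⟨0, θ⟩).im ∧ θ ∈ Ioo (bet - r) bet :=
    (hA.eventually (lt_mem_nhds (by linarith))).and (Ioo_mem_nhdsLT (by linarith))
  obtain ⟨θ, h1, h2⟩ := hev.exists
  have hv : bet - θ ∈ Ioo 0 r := ⟨by linarith [h2.2], by linarith [h2.1]⟩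
  have hθ : |θ| < bet := by simpa using hmem _ hv
  have hlt := timeMap_imaginary_im_lt hA (by linarith [h2.1]) h2.2
  refine AnalyticOnNhd.eqOn_of_preconnected_of_frequently_eq
    (analyticOnNhd_angleExt.mono (hsub.trans (complexStrip_subset_timeMap_image hA)))
    (hd.mono lower_half_subset_slitDisc) hconv.isPreconnected (z₀ := timeMap ⟨0, θ⟩) ⟨?_, hlt⟩ ?_
  · have h3 := hval _ hv
    rw [sub_sub_cancel] at h3
    rw [mem_ball_iff_norm, h3, ← sub_mul, norm_mul, Complex.norm_I, mul_one, ← Complex.ofReal_sub,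
      Complex.norm_real, Real.norm_eq_abs, abs_lt]
    constructor <;> linarith
  -- The curve ψ ↦ T(iψ) passes through the base point with nonzero velocity, so the known
  -- coincidences accumulate there and the identity theorem applies.
  · have hy := innerStrip_subset (mk_mem_innerStrip (x := 0) hθ)
    have hne : timeDensity ⟨0, θ⟩ * Complex.I ≠ 0 := by
      refine mul_ne_zero (fun h => ?_) Complex.I_ne_zero
      have := timeDensity_re_pos hy
      simp [h] at this
    refine ((hasDerivAt_timeMap_vertical hy).tendsto_nhdsNE hne).frequently
      (Eventually.frequently ?_)
    filter_upwards [nhdsWithin_le_nhds (Ioo_mem_nhds h2.1 h2.2)] with ψ hψ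
    have := heq (bet - ψ) ⟨by linarith [hψ.2], by linarith [hψ.1]⟩
    rwa [sub_sub_cancel] at this

/-! ### Gluing the strip and the two slit discs -/

/-- The function equal to `f` on the strip, to `g` above it and to the reflection of `g` below. -/
noncomputable def symmGlue (A : ℝ) (f g : ℂ → ℂ) (t : ℂ) : ℂ :=
  open Classical in
  if |t.im| < A then f t else if 0 < t.im then g t else starRingEnd ℂ (g (starRingEnd ℂ t))

theorem eqOn_symmGlue_strip (A : ℝ) (f g : ℂ → ℂ) : EqOn (symmGlue A f g) f (complexStrip A) :=
  fun _ ht => if_pos ht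

/-- ν ≤ A keeps the upper disc in Im t > 0, so the reflected branch of the definition never occurs
in it. -/
theorem eqOn_symmGlue_upper {A ν : ℝ} (hν : ν ≤ A) {f g : ℂ → ℂ}
    (hfg : EqOn f g (Metric.ball ((A : ℂ) * Complex.I) ν ∩ {t | t.im < A})) :
    EqOn (symmGlue A f g) g (slitDisc (A * Complex.I) ν) := by
  intro t ht
  unfold symmGlue
  split_ifs with h1 h2
  · exact hfg ⟨mem_ball_iff_norm.2 ht.1, (abs_lt.1 h1).2⟩
  · rfl
  · exact absurd (im_pos_of_mem_slitDisc hν ht.1) h2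

/-- In the part of the lower disc inside the strip, the symmetry of f transports the agreement with
g from the upper half-plane. -/
theorem eqOn_symmGlue_lower {A ν : ℝ} (hν : ν ≤ A) {f g : ℂ → ℂ}
    (hfg : EqOn f g (Metric.ball ((A : ℂ) * Complex.I) ν ∩ {t | t.im < A}))
    (hf : EqOn (starRingEnd ℂ ∘ f ∘ starRingEnd ℂ) f (complexStrip A)) :
    EqOn (symmGlue A f g) (starRingEnd ℂ ∘ g ∘ starRingEnd ℂ)
      (starRingEnd ℂ ⁻¹' slitDisc (A * Complex.I) ν) := by
  intro t ht
  have h0 := im_pos_of_mem_slitDisc hν ht.1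
  unfold symmGlue
  split_ifs with h1 h2
  · rw [← hf h1]
    have h3 : (starRingEnd ℂ t).im < A := by
      rw [Complex.conj_im]
      linarith [(abs_lt.1 h1).1]
    exact congrArg (starRingEnd ℂ) (hfg ⟨mem_ball_iff_norm.2 ht.1, h3⟩)
  · rw [Complex.conj_im] at h0
    linarith
  · rfl

/-! ### The momentum component and the boundary points -/

/-- The momentum attached to an angle function by `λ' = -3 Λ`. -/
noncomputable def withMomentum (f : ℂ → ℂ) (t : ℂ) : ℂ × ℂ := (f t, -(1 / 3) * deriv f t)

theorem AnalyticAt.withMomentum {f : ℂ → ℂ} {t : ℂ} (hf : AnalyticAt ℂ f t) :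
    AnalyticAt ℂ (withMomentum f) t :=
  hf.prod (analyticAt_const.mul hf.deriv)

theorem Set.EqOn.withMomentum {f g : ℂ → ℂ} {s : Set ℂ} (hs : IsOpen s) (h : EqOn f g s) :
    EqOn (withMomentum f) (withMomentum g) s := fun t ht => by
  rw [_root_.withMomentum, _root_.withMomentum, h ht, (h.eventuallyEq_of_mem
    (hs.mem_nhds ht)).deriv_eq]

theorem withMomentum_conj_conj (f : ℂ → ℂ) (t : ℂ) :
    withMomentum (starRingEnd ℂ ∘ f ∘ starRingEnd ℂ) t =
      (starRingEnd ℂ (withMomentum f (starRingEnd ℂ t)).1,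
        starRingEnd ℂ (withMomentum f (starRingEnd ℂ t)).2) := by
  simp [withMomentum, Complex.conj_ofNat]

theorem withMomentum_ofReal {l L : ℝ → ℝ} (h : IsRightSeparatrix l L) {f : ℂ → ℂ}
    (hf : ∀ t : ℝ, AnalyticAt ℂ f t) (hfl : ∀ t : ℝ, f t = l t) (t : ℝ) :
    withMomentum f (t : ℂ) = ((l t : ℂ), (L t : ℂ)) := by
  have h1 := (hf t).differentiableAt.hasDerivAt.comp_ofReal
  simp only [hfl] at h1
  have h2 := h1.unique (h.hasDerivAt_l t).ofReal_comp
  rw [withMomentum, hfl, h2]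
  congr 1
  push_cast
  ring

theorem abs_im_eq_of_mem_frontier_complexStrip {a : ℝ} {t : ℂ}
    (ht : t ∈ frontier (complexStrip a)) : |t.im| = a :=
  frontier_lt_subset_eq (f := fun t : ℂ => |t.im|) (by fun_prop) continuous_const ht

theorem polarPoint_vertical_mem_complexStrip {A : ℝ} (hA : 0 < A) :
    ∀ᶠ r in 𝓝[>] (0 : ℝ), polarPoint (A * Complex.I) r (-(Real.pi / 2)) ∈ complexStrip A := by
  filter_upwards [Ioo_mem_nhdsGT hA] with r hr
  have h1 : (polarPoint (A * Complex.I) r (-(Real.pi / 2))).im = A - r := by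
    rw [polarPoint, Complex.exp_mul_I, ← Complex.ofReal_cos, ← Complex.ofReal_sin]
    simp
    ring
  show |_| < A
  rw [h1, abs_lt]
  constructor <;> linarith [hr.1, hr.2]

theorem HasBranchExpansion.isBoundarySingularity {σ : ℂ → ℂ × ℂ} {c : ℂ} {ν θ₁ θ₂ : ℝ} {α : ℂ}
    (h : HasBranchExpansion σ c ν θ₁ θ₂ α) (hα : α ≠ 0) (hν : 0 < ν) {θ : ℝ}
    (hθ : θ ∈ Ioo θ₁ θ₂) {Ω : Set ℂ} (hO : IsOpen Ω) (hc : c ∉ Ω)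
    (hΩ : ∀ᶠ r in 𝓝[>] (0 : ℝ), polarPoint c r θ ∈ Ω) : IsBoundarySingularity σ Ω c := by
  refine ⟨?_, h.not_analytic hα hν hθ hΩ⟩
  rw [hO.frontier_eq]
  refine ⟨?_, hc⟩
  have h1 : Tendsto (fun r : ℝ => polarPoint c r θ) (𝓝[>] 0) (𝓝 c) := by
    have : Continuous fun r : ℝ => polarPoint c r θ := by
      unfold polarPoint
      fun_prop
    have h2 := this.tendsto 0
    simp only [polarPoint, Complex.ofReal_zero, zero_mul, add_zero] at h2
    exact h2.mono_left nhdsWithin_le_nhds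
  exact mem_closure_of_tendsto h1 hΩ

/-- The cube of e^{iπ/3} is −1, so the result is −(−27/2)/27. -/
theorem branchCoefficient_cube {d : ℝ} (hd : d ^ 3 = -(27 / 2)) :
    ((d : ℂ) * Complex.exp ((Real.pi / 3 : ℝ) * Complex.I) / 3) ^ 3 = 1 / 2 := by
  have h1 : Complex.exp ((Real.pi / 3 : ℝ) * Complex.I) ^ 3 = -1 := by
    rw [← Complex.exp_nat_mul, ← Complex.exp_pi_mul_I]
    congr 1
    push_cast
    ring
  have h2 : (d : ℂ) ^ 3 = -(27 / 2) := by
    rw [← Complex.ofReal_pow, hd]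
    push_cast
    ring
  rw [div_pow, mul_pow, h1, h2]
  norm_num

theorem exists_radius {ρ A : ℝ} (hρ : 0 < ρ) (hA : 0 < A) :
    ∃ ν > 0, ν ≤ A ∧ ∀ r ∈ Ioo 0 ν, r ^ (2 / 3 : ℝ) < ρ := by
  refine ⟨min (ρ ^ (3 / 2 : ℝ)) A, lt_min (Real.rpow_pos_of_pos hρ _) hA, min_le_right _ _,
    fun r hr => ?_⟩
  have h1 : r < ρ ^ (3 / 2 : ℝ) := hr.2.trans_le (min_le_left _ _)
  have h2 := Real.rpow_lt_rpow hr.1.le h1 (show (0 : ℝ) < 2 / 3 by norm_num)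
  rw [← Real.rpow_mul hρ.le] at h2
  norm_num at h2
  exact h2

/-! ### Assembly -/

theorem theorem2p2 :
    IntervalIntegrable widthIntegrand MeasureTheory.volume 0 aPlus ∧
    |stripWidth - 0.177744| < 5 * 10 ^ (-7 : ℤ) ∧
    ∀ l L : ℝ → ℝ, IsRightSeparatrix l L →
      ∃ ν : ℝ, 0 < ν ∧ ∃ σ : ℂ → ℂ × ℂ,
        (∀ t : ℝ, σ (t : ℂ) = ((l t : ℂ), (L t : ℂ))) ∧
        AnalyticOnNhd ℂ σ
          (complexStrip stripWidth ∪
            sector (stripWidth * Complex.I) ν (-(3 * Real.pi / 2)) (Real.pi / 2) ∪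
            sector (-(stripWidth * Complex.I)) ν (-(Real.pi / 2)) (3 * Real.pi / 2)) ∧
        {t : ℂ | IsBoundarySingularity σ (complexStrip stripWidth) t} =
          {stripWidth * Complex.I, -(stripWidth * Complex.I)} ∧
        ∃ α : ℂ, α ^ 3 = 1 / 2 ∧
          HasBranchExpansion σ (stripWidth * Complex.I) ν
            (-(3 * Real.pi / 2)) (Real.pi / 2) α ∧
          HasBranchExpansion σ (-(stripWidth * Complex.I)) ν
            (-(Real.pi / 2)) (3 * Real.pi / 2) (starRingEnd ℂ α) := by
  refine ⟨intervalIntegrable_widthIntegrand, abs_stripWidth_sub_lt, fun l L h => ?_⟩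
  have hA := isTimeWidth_stripWidth
  -- From here A enters only as the limit of Im T at the corner.
  generalize stripWidth = A at hA ⊢
  have hA0 := width_pos hA
  have hpi := Real.pi_pos
  obtain ⟨F, hFa, hF0, ⟨d, hd3, hFd⟩, r, hr, hrb, hFr⟩ := exists_cornerExpansion hA
  obtain ⟨ρ, hρ, C, hC, hFb⟩ := hFa.exists_taylor_bounds hFd
  obtain ⟨ν, hν, hνA, hνρ⟩ := exists_radius hρ hA0
  set c : ℂ := A * Complex.I with hc
  set g := twoThirds F c with hg
  set f := symmGlue A angleExt g with hf
  have hgD : AnalyticOnNhd ℂ g (slitDisc c ν) :=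
    analyticAt_twoThirds (fun q hq => (hFb q hq).1) hνρ c
  have hag := eqOn_angleExt_twoThirds hA hr hrb hFr hν hνA hgD
  have haS := analyticOnNhd_angleExt.mono (complexStrip_subset_timeMap_image hA)
  have hsymm := eqOn_conj_of_real_on_real hA0 haS fun t => by
    rw [angleExt_ofReal h, Complex.conj_ofReal]
  have hS := isOpen_complexStrip A
  have hD := isOpen_slitDisc c ν
  have hD' : IsOpen (starRingEnd ℂ ⁻¹' slitDisc c ν) := hD.preimage Complex.continuous_conj
  have hgD' : AnalyticOnNhd ℂ (starRingEnd ℂ ∘ g ∘ starRingEnd ℂ)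
      (starRingEnd ℂ ⁻¹' slitDisc c ν) :=
    DifferentiableOn.analyticOnNhd (fun t ht =>
      (differentiableAt_conj_conj_iff.2 (hgD _ ht).differentiableAt).differentiableWithinAt) hD'
  have e0 : EqOn f angleExt (complexStrip A) := eqOn_symmGlue_strip A angleExt g
  have e1 : EqOn f g (slitDisc c ν) := eqOn_symmGlue_upper hνA hag
  have e2 : EqOn f (starRingEnd ℂ ∘ g ∘ starRingEnd ℂ) (starRingEnd ℂ ⁻¹' slitDisc c ν) :=
    eqOn_symmGlue_lower hνA hag hsymm
  have hsec := sector_subset_slitDisc c ν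
  have hconj : starRingEnd ℂ c = -c := by simp [hc]
  have hsec' : sector (-c) ν (-(Real.pi / 2)) (3 * Real.pi / 2) ⊆
      starRingEnd ℂ ⁻¹' slitDisc c ν := by
    rintro _ ⟨r, hr, θ, hθ, rfl⟩
    refine hsec ⟨r, hr, -θ, ⟨by linarith [hθ.2], by linarith [hθ.1]⟩, ?_⟩
    rw [conj_polarPoint, map_neg, hconj, neg_neg]
  have hfS : AnalyticOnNhd ℂ f (complexStrip A) := haS.congr hS e0.symm
  have hx1 : HasBranchExpansion (withMomentum f) c ν (-(3 * Real.pi / 2)) (Real.pi / 2)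
      (d * Complex.exp ((Real.pi / 3 : ℝ) * Complex.I) / 3) :=
    (hasBranchExpansion_twoThirds hC hFb hF0 hνρ c).congr
      ((e1.symm.withMomentum hD).mono hsec)
  have hx2 : HasBranchExpansion (withMomentum f) (-c) ν (-(Real.pi / 2)) (3 * Real.pi / 2)
      (starRingEnd ℂ (d * Complex.exp ((Real.pi / 3 : ℝ) * Complex.I) / 3)) := by
    have h1 := (hasBranchExpansion_twoThirds hC hFb hF0 hνρ c).conj
    rw [hconj, neg_neg] at h1
    refine h1.congr fun t ht => ?_
    rw [e2.withMomentum hD' (hsec' ht), withMomentum_conj_conj]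
    rfl
  have hα3 := branchCoefficient_cube hd3
  have hα0 : (d * Complex.exp ((Real.pi / 3 : ℝ) * Complex.I) / 3 : ℂ) ≠ 0 := by
    intro h0
    rw [h0] at hα3
    norm_num at hα3
  refine ⟨ν, hν, withMomentum f, withMomentum_ofReal h (fun t => hfS _ ?_) (fun t => ?_), ?_, ?_,
    _, hα3, hx1, hx2⟩
  · simpa [complexStrip] using hA0
  · rw [e0 (by simpa [complexStrip] using hA0), angleExt_ofReal h]
  · rintro t ((ht | ht) | ht)
    · exact (hfS t ht).withMomentum
    · exact (hgD.congr hD e1.symm t (hsec ht)).withMomentum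
    · exact (hgD'.congr hD' e2.symm t (hsec' ht)).withMomentum
  · have hcS : c ∉ complexStrip A := by simp [complexStrip, hc, le_abs_self]
    have hcS' : -c ∉ complexStrip A := by simp [complexStrip, hc, le_abs_self]
    ext t
    constructor
    · rintro ⟨ht, hsing⟩
      have him := abs_im_eq_of_mem_frontier_complexStrip ht
      by_contra hne
      have hre : t.re ≠ 0 := fun hre => by
        refine hne ?_
        rcases (abs_eq hA0.le).1 him with h1 | h1
        · exact Or.inl (Complex.ext (by simp [hc, hre]) (by simp [hc, h1]))
        · exact Or.inr (Complex.ext (by simp [hc, hre]) (by simp [hc, h1]))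
      -- A frontier point off the imaginary axis lies in the open image of T, so λ∘T⁻¹ is itself the
      -- analytic continuation there.
      refine hsing ⟨withMomentum angleExt, (analyticOnNhd_angleExt t
        (mem_timeMap_image hA him.le fun h0 => absurd h0 hre)).withMomentum, ?_⟩
      filter_upwards [self_mem_nhdsWithin] with s hs
      exact (e0.withMomentum hS hs).symm
    · rintro (rfl | rfl)
      -- The corner is approached vertically from inside the strip, along θ = −π/2.
      · exact hx1.isBoundarySingularity hα0 hν ⟨by linarith, by linarith⟩ hS hcS
          (polarPoint_vertical_mem_complexStrip hA0)
      · refine hx2.isBoundarySingularity (by simpa using hα0) hν (θ := Real.pi / 2)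
          ⟨by linarith, by linarith⟩ hS hcS' ?_
        filter_upwards [polarPoint_vertical_mem_complexStrip hA0] with r hr
        have h1 := conj_polarPoint c r (-(Real.pi / 2))
        rw [neg_neg, hconj] at h1
        rw [← h1]
        simpa [complexStrip] using hr
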